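/- Let $n\ge 1$ and let $\mathbb{H}^n=\mathbb{C}^n\times\mathbb{R}$ be the Heisenberg group with group law $(z,t)(w,t')=(z+w,\,t+t'+\tfrac12\Im(z\cdot\bar w))$ and Lebesgue (Haar) measure. Writing $z_j=x_j+iy_j$, let $$X_j=\frac{\partial}{\partial x_j}+\frac12 y_j\frac{\partial}{\partial t},\qquad Y_j=\frac{\partial}{\partial y_j}-\frac12 x_j\frac{\partial}{\partial t}\quad(1\le j\le n),\qquad T=\frac{\partial}{\partial t},$$ and let $\mathcal{L}=-\sum_{j=1}^n(X_j^2+Y_j^2)$ be the sublaplacian; the same letter denotes the non-negative self-adjoint operator in $L^2(\mathbb{H}^n)$ that it defines. For $s\ge 0$ let $W^{s,2}(\mathbb{H}^n)$ be the Hilbert space of all $f=(I+\mathcal{L})^{-s/2}f_0$ with $f_0\in L^2(\mathbb{H}^n)$, with inner product $\langle f,g\rangle_s=\langle f_0,g_0\rangle_{L^2}$ for $f=(I+\mathcal{L})^{-s/2}f_0$ and $g=(I+\mathcal{L})^{-s/2}g_0$. Let $D(A)$ be the space of all smooth functions $f:\mathbb{H}^n\to\mathbb{C}$ such that for all $\alpha,\beta\in\mathbb{N}^n$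 and $j\in\mathbb{N}$ (with $0\in\mathbb{N}$) the derivative $X^\alpha Y^\beta T^jf$ is in $L^2(\mathbb{H}^n)$ and vanishes at the origin, and let $A$ be the restriction of $\mathcal{L}$ to $D(A)$. If $n-1<s\le n+1$, then $f$ and $\mathcal{L}f$ are in $W^{s,2}(\mathbb{H}^n)$ for every $f\in D(A)$, so that $A$ is an operator in $W^{s,2}(\mathbb{H}^n)$; the domain $D(A)$ is dense in $W^{s,2}(\mathbb{H}^n)$ and $A$ is symmetric there, but $(I+A)D(A)$ is not dense in $W^{s,2}(\mathbb{H}^n)$, and $A$ is not essentially self-adjoint, that is, its closure is not self-adjoint. -/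

import Mathlib

open MeasureTheory
open scoped NNReal ContDiff InnerProductSpace

noncomputable section

namespace Heisenberg

/-- The underlying manifold `ℂⁿ × ℝ` of the Heisenberg group. The group law is
`(z, t) (w, s) = (z + w, t + s + Im (z · conj w) / 2)`; its identity is `0` and its Haar measure is
the Lebesgue measure `volume`. -/
abbrev Heis (n : ℕ) : Type := (Fin n → ℂ) × ℝ

/-- Smooth complex-valued functions on the Heisenberg group. -/
def Smooth (n : ℕ) : Submodule ℂ (Heis n → ℂ) where
  carrier := {f | ContDiff ℝ ∞ f}
  add_mem' {f g} (hf : ContDiff ℝ ∞ f) (hg : ContDiff ℝ ∞ g) :=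
    show ContDiff ℝ ∞ (f + g) from hf.add hg
  zero_mem' := show ContDiff ℝ ∞ (fun _ => 0) from contDiff_const
  smul_mem' c f (hf : ContDiff ℝ ∞ f) := show ContDiff ℝ ∞ (c • f) from hf.const_smul c

theorem contDiff_coe {n : ℕ} (f : Smooth n) : ContDiff ℝ ∞ (f : Heis n → ℂ) := f.2

theorem differentiableAt_coe {n : ℕ} (f : Smooth n) (p : Heis n) :
    DifferentiableAt ℝ (f : Heis n → ℂ) p :=
  ((contDiff_coe f).differentiable (by simp)).differentiableAt

/-- A smooth vector field `v`, acting on smooth functions as a first order differential operator. -/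
def fieldOp {n : ℕ} (v : Heis n → Heis n) (hv : ContDiff ℝ ∞ v) : Module.End ℂ (Smooth n) where
  toFun f := ⟨fun p => fderiv ℝ (f : Heis n → ℂ) p (v p),
    show ContDiff ℝ ∞ _ from ((contDiff_coe f).fderiv_right (m := ∞) (by simp)).clm_apply hv⟩
  map_add' f g := by
    ext p
    simp [fderiv_add (differentiableAt_coe f p) (differentiableAt_coe g p)]
  map_smul' c f := by
    ext p
    simp [fderiv_const_smul (differentiableAt_coe f p) c]

/-- The left invariant field `X_j = ∂/∂x_j + (y_j / 2) ∂/∂t`, where `z_j = x_j + i y_j`. -/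
def X {n : ℕ} (j : Fin n) : Module.End ℂ (Smooth n) :=
  fieldOp (fun p => (Pi.single j 1, (p.1 j).im / 2)) <| by
    have h : ContDiff ℝ ∞ fun p : Heis n => Complex.imCLM (p.1 j) := by fun_prop
    exact contDiff_const.prodMk (h.div_const 2)

/-- The left invariant field `Y_j = ∂/∂y_j - (x_j / 2) ∂/∂t`, where `z_j = x_j + i y_j`. -/
def Y {n : ℕ} (j : Fin n) : Module.End ℂ (Smooth n) :=
  fieldOp (fun p => (Pi.single j Complex.I, -((p.1 j).re / 2))) <| by
    have h : ContDiff ℝ ∞ fun p : Heis n => Complex.reCLM (p.1 j) := by fun_prop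
    exact contDiff_const.prodMk (h.div_const 2).neg

/-- The central field `T = ∂/∂t`. -/
def T (n : ℕ) : Module.End ℂ (Smooth n) :=
  fieldOp (fun _ => (0, 1)) contDiff_const

/-- `X^α = X_1^{α_1} ⋯ X_n^{α_n}`. -/
def Xpow {n : ℕ} (α : Fin n → ℕ) : Module.End ℂ (Smooth n) :=
  (List.ofFn fun j => X j ^ α j).prod

/-- `Y^β = Y_1^{β_1} ⋯ Y_n^{β_n}`. -/
def Ypow {n : ℕ} (β : Fin n → ℕ) : Module.End ℂ (Smooth n) :=
  (List.ofFn fun j => Y j ^ β j).prod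

/-- The sublaplacian `ℒ = -∑_j (X_j² + Y_j²)` on smooth functions. -/
def sublaplacian (n : ℕ) : Module.End ℂ (Smooth n) :=
  -∑ j, (X j ^ 2 + Y j ^ 2)

/-- `L²` of the Heisenberg group. -/
abbrev L2 (n : ℕ) : Type := Lp ℂ 2 (volume : Measure (Heis n))

/-- The Hilbert space in which the horizontal first order jets `(φ, X_1 φ, …, Y_n φ)` live. -/
abbrev JetSpace (n : ℕ) : Type := PiLp 2 fun _ : Option (Fin n ⊕ Fin n) => L2 n

/-- The horizontal jets `(φ, X_1 φ, …, X_n φ, Y_1 φ, …, Y_n φ)` of the functions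
`φ ∈ C_c^∞`. -/
def testJets (n : ℕ) : Submodule ℂ (JetSpace n) where
  carrier := {u | ∃ φ : Smooth n, HasCompactSupport (φ : Heis n → ℂ) ∧
    u none =ᵐ[volume] (φ : Heis n → ℂ) ∧
    (∀ j, u (some (Sum.inl j)) =ᵐ[volume] (X j φ : Heis n → ℂ)) ∧
    ∀ j, u (some (Sum.inr j)) =ᵐ[volume] (Y j φ : Heis n → ℂ)}
  add_mem' := by
    rintro u v ⟨φ, hφ, h0, hX, hY⟩ ⟨ψ, hψ, k0, kX, kY⟩
    refine ⟨φ + ψ, hφ.add hψ, ?_, fun j => ?_, fun j => ?_⟩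
    · exact (Lp.coeFn_add _ _).trans (h0.add k0)
    · rw [map_add]
      exact (Lp.coeFn_add _ _).trans ((hX j).add (kX j))
    · rw [map_add]
      exact (Lp.coeFn_add _ _).trans ((hY j).add (kY j))
  zero_mem' := by
    refine ⟨0, HasCompactSupport.zero, ?_, fun j => ?_, fun j => ?_⟩
    · exact Lp.coeFn_zero _ _ _
    · rw [map_zero]
      exact Lp.coeFn_zero _ _ _
    · rw [map_zero]
      exact Lp.coeFn_zero _ _ _
  smul_mem' := by
    rintro c u ⟨φ, hφ, h0, hX, hY⟩
    refine ⟨c • φ, hφ.smul_left (f := fun _ => c), ?_, fun j => ?_, fun j => ?_⟩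
    · exact (Lp.coeFn_smul _ _).trans (h0.const_smul c)
    · rw [map_smul]
      exact (Lp.coeFn_smul _ _).trans ((hX j).const_smul c)
    · rw [map_smul]
      exact (Lp.coeFn_smul _ _).trans ((hY j).const_smul c)

/-- The domain of the closed quadratic form `u ↦ ∑_j ‖X_j u‖² + ‖Y_j u‖²` of the sublaplacian,
as a closed space of horizontal jets. -/
def formDomain (n : ℕ) : Submodule ℂ (JetSpace n) := (testJets n).topologicalClosure

instance (n : ℕ) : CompleteSpace (formDomain n) :=
  (Submodule.isClosed_topologicalClosure _).completeSpace_coe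

/-- The projection of a jet to its function component. -/
def jetProj (n : ℕ) : JetSpace n →L[ℂ] L2 n := PiLp.proj 2 (fun _ => L2 n) none

/-- The resolvent `(I + ℒ)⁻¹` on `L²` of the (self-adjoint) sublaplacian. By the definition of the
orthogonal projection, `u = resolvent n f` is the unique element of the form domain with
`⟨u, v⟩ + ∑_j (⟨X_j u, X_j v⟩ + ⟨Y_j u, Y_j v⟩) = ⟨f, v⟩` for all `v` in the form domain, which is
the weak form of `(I + ℒ) u = f`. -/
def resolvent (n : ℕ) : L2 n →L[ℂ] L2 n :=
  jetProj n ∘L (formDomain n).starProjection ∘L ContinuousLinearMap.adjoint (jetProj n)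

theorem resolvent_isPositive (n : ℕ) : (resolvent n).IsPositive := by
  have h : ((formDomain n).starProjection).IsPositive :=
    ContinuousLinearMap.IsPositive.of_isStarProjection isStarProjection_starProjection
  simpa [resolvent] using h.conj_adjoint (jetProj n)

theorem exists_testJet {n : ℕ} (φ : Smooth n) (hφ : HasCompactSupport (φ : Heis n → ℂ)) :
    ∃ u ∈ testJets n, jetProj n u =ᵐ[volume] (φ : Heis n → ℂ) := by
  have hsupp : ∀ v hv, HasCompactSupport (fieldOp v hv φ : Heis n → ℂ) := fun v hv => by
    refine (hφ.fderiv (𝕜 := ℝ)).mono fun p hp h0 => hp ?_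
    change fderiv ℝ (φ : Heis n → ℂ) p (v p) = 0
    rw [h0]
    rfl
  have hmem : ∀ ψ : Smooth n, HasCompactSupport (ψ : Heis n → ℂ) →
      MemLp (ψ : Heis n → ℂ) 2 volume := fun ψ hψ =>
    (contDiff_coe ψ).continuous.memLp_of_hasCompactSupport hψ
  refine ⟨WithLp.toLp 2 fun i => match i with
    | none => (hmem φ hφ).toLp _
    | some (Sum.inl j) => (hmem (X j φ) (hsupp _ _)).toLp _
    | some (Sum.inr j) => (hmem (Y j φ) (hsupp _ _)).toLp _, ⟨φ, hφ, ?_, ?_, ?_⟩, ?_⟩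
  · exact (hmem φ hφ).coeFn_toLp
  · exact fun j => (hmem (X j φ) (hsupp _ _)).coeFn_toLp
  · exact fun j => (hmem (Y j φ) (hsupp _ _)).coeFn_toLp
  · exact (hmem φ hφ).coeFn_toLp

theorem resolvent_injective (n : ℕ) : Function.Injective (resolvent n) := by
  refine (injective_iff_map_eq_zero (resolvent n)).2 fun f hf => ?_
  set w := ContinuousLinearMap.adjoint (jetProj n) f with hw
  have h0 : (formDomain n).starProjection w = 0 := by
    rw [← inner_self_eq_zero (𝕜 := ℂ), Submodule.inner_starProjection_left_eq_right,
      (formDomain n).starProjection_eq_self_iff.2 (Submodule.starProjection_apply_mem _ _),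
      ← Submodule.inner_starProjection_left_eq_right, hw,
      ContinuousLinearMap.adjoint_inner_right]
    change ⟪resolvent n f, f⟫_ℂ = 0
    rw [hf, inner_zero_left]
  have horth : ∀ u ∈ testJets n, ⟪jetProj n u, f⟫_ℂ = 0 := fun u hu => by
    rw [← ContinuousLinearMap.adjoint_inner_right, ← hw]
    exact ((Submodule.starProjection_apply_eq_zero_iff _).1 h0) u
      (Submodule.le_topologicalClosure _ hu)
  have hloc : LocallyIntegrable (f : Heis n → ℂ) volume :=
    (Lp.memLp f).locallyIntegrable (by norm_num)
  rw [Lp.eq_zero_iff_ae_eq_zero]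
  refine ae_eq_zero_of_integral_contDiff_smul_eq_zero hloc fun g hg hgs => ?_
  obtain ⟨u, hu, hug⟩ := exists_testJet
    (⟨fun p => (g p : ℂ), Complex.ofRealCLM.contDiff.comp hg⟩ : Smooth n)
    (hgs.comp_left (g := fun x : ℝ => (x : ℂ)) Complex.ofReal_zero)
  rw [← horth u hu, L2.inner_def]
  refine integral_congr_ae ?_
  filter_upwards [hug] with p hp
  rw [hp]
  simp [mul_comm]

/-- The power `a ^ y` of a positive operator in a Hilbert space, in the sense of the (continuous)
functional calculus. -/
def opPow {H : Type*} [NormedAddCommGroup H] [InnerProductSpace ℂ H] [CompleteSpace H]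
    (a : H →L[ℂ] H) (y : ℝ) : H →L[ℂ] H := CFC.rpow a y

theorem opPow_injective {H : Type*} [NormedAddCommGroup H] [InnerProductSpace ℂ H]
    [CompleteSpace H] {a : H →L[ℂ] H} (ha : a.IsPositive) (hinj : Function.Injective a)
    {y : ℝ} (hy : 0 ≤ y) : Function.Injective (opPow a y) := by
  have ha' : 0 ≤ a := ContinuousLinearMap.nonneg_iff_isPositive a |>.mpr ha
  rcases hy.eq_or_lt with rfl | hy
  · have : opPow a 0 = 1 := CFC.rpow_zero a
    rw [this]
    exact Function.injective_id
  · obtain ⟨m, hm⟩ := exists_nat_gt y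
    have key : a ^ m = opPow a (m - y) * opPow a y := by
      rw [← CFC.rpow_natCast a m]
      have hc : ∀ r : ℝ, 0 ≤ r → ContinuousOn (fun x : ℝ≥0 => x ^ r) (spectrum ℝ≥0 a) :=
        fun r hr => (NNReal.continuous_rpow_const hr).continuousOn
      change cfc (fun x : ℝ≥0 => x ^ (m : ℝ)) a =
        cfc (fun x : ℝ≥0 => x ^ ((m : ℝ) - y)) a * cfc (fun x : ℝ≥0 => x ^ y) a
      rw [← cfc_mul _ _ a (hc _ (by linarith)) (hc _ hy.le)]
      refine cfc_congr fun x _ => ?_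
      change x ^ (m : ℝ) = x ^ ((m : ℝ) - y) * x ^ y
      rw [← NNReal.rpow_add_of_nonneg x (by linarith) hy.le, sub_add_cancel]
    have h1 : Function.Injective (a ^ m : H →L[ℂ] H) := by
      simpa using hinj.iterate m
    rw [key] at h1
    exact Function.Injective.of_comp h1

/-- The bounded operator `(I + ℒ)^{-s/2}` on `L²`, for `s ≥ 0`, as a power of the positive operator
`(I + ℒ)⁻¹`. -/
def besselPotential (n : ℕ) (s : ℝ≥0) : L2 n →L[ℂ] L2 n := opPow (resolvent n) ((s : ℝ) / 2)

theorem besselPotential_injective (n : ℕ) (s : ℝ≥0) :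
    Function.Injective (besselPotential n s) :=
  opPow_injective (resolvent_isPositive n) (resolvent_injective n) (by positivity)

/-- The Sobolev space `W^{s,2}`, `s ≥ 0`: the space of all `f = (I + ℒ)^{-s/2} f₀` with
`f₀ ∈ L²`. -/
def Sobolev (n : ℕ) (s : ℝ≥0) : Type := LinearMap.range (besselPotential n s).toLinearMap

namespace Sobolev

variable {n : ℕ} {s : ℝ≥0}

instance : AddCommGroup (Sobolev n s) :=
  inferInstanceAs (AddCommGroup (LinearMap.range (besselPotential n s).toLinearMap))

instance : Module ℂ (Sobolev n s) :=
  inferInstanceAs (Module ℂ (LinearMap.range (besselPotential n s).toLinearMap))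

/-- The inclusion of `W^{s,2}` in `L²`. -/
def toL2 : Sobolev n s →ₗ[ℂ] L2 n :=
  (LinearMap.range (besselPotential n s).toLinearMap).subtype

/-- The bijection `f₀ ↦ (I + ℒ)^{-s/2} f₀` of `L²` to `W^{s,2}`. -/
def ofL2 (n : ℕ) (s : ℝ≥0) : L2 n ≃ₗ[ℂ] Sobolev n s :=
  LinearEquiv.ofInjective (besselPotential n s).toLinearMap (besselPotential_injective n s)

/-- The norm `‖f‖_{(s)} = ‖(I + ℒ)^{s/2} f‖ = ‖f₀‖` for `f = (I + ℒ)^{-s/2} f₀`. -/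
instance : NormedAddCommGroup (Sobolev n s) :=
  NormedAddCommGroup.induced _ _ (ofL2 n s).symm (ofL2 n s).symm.injective

/-- The inner product `⟨f, g⟩_s = ⟨f₀, g₀⟩` for `f = (I + ℒ)^{-s/2} f₀`,
`g = (I + ℒ)^{-s/2} g₀`. -/
instance : InnerProductSpace ℂ (Sobolev n s) where
  norm_smul_le c f := by
    change ‖(ofL2 n s).symm (c • f)‖ ≤ ‖c‖ * ‖(ofL2 n s).symm f‖
    rw [map_smul, norm_smul]
  inner f g := ⟪(ofL2 n s).symm f, (ofL2 n s).symm g⟫_ℂ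
  norm_sq_eq_re_inner f := norm_sq_eq_re_inner ((ofL2 n s).symm f)
  conj_inner_symm f g := inner_conj_symm ((ofL2 n s).symm f) ((ofL2 n s).symm g)
  add_left f g h := by rw [map_add, inner_add_left]
  smul_left f g c := by rw [map_smul, inner_smul_left]

instance : CompleteSpace (Sobolev n s) := by
  have h : Isometry (ofL2 n s) := AddMonoidHomClass.isometry_of_norm (ofL2 n s) fun f => by
    change ‖(ofL2 n s).symm (ofL2 n s f)‖ = ‖f‖
    rw [LinearEquiv.symm_apply_apply]
  exact (IsometryEquiv.mk (ofL2 n s).toEquiv h).completeSpace_iff.mp inferInstance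

end Sobolev

/-- The space of all smooth functions `f` such that all the derivatives `X^α Y^β T^k f` are in `L²`
and vanish at the origin. -/
def flatFunctions (n : ℕ) : Submodule ℂ (Smooth n) where
  carrier := {f | ∀ (α β : Fin n → ℕ) (k : ℕ),
    MemLp (Xpow α (Ypow β ((T n ^ k) f)) : Heis n → ℂ) 2 volume ∧
    (Xpow α (Ypow β ((T n ^ k) f)) : Heis n → ℂ) 0 = 0}
  add_mem' hf hg α β k := by
    refine ⟨?_, ?_⟩
    · rw [map_add, map_add, map_add]
      exact (hf α β k).1.add (hg α β k).1
    · simp [(hf α β k).2, (hg α β k).2]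
  zero_mem' α β k := by simp
  smul_mem' c f hf α β k := by
    refine ⟨?_, ?_⟩
    · rw [map_smul, map_smul, map_smul]
      exact (hf α β k).1.const_smul c
    · simp [(hf α β k).2]

/-- The graph of the sublaplacian, restricted to the above space of functions, as a subset of
`W^{s,2} × W^{s,2}`. -/
def graphA (n : ℕ) (s : ℝ≥0) : Submodule ℂ (Sobolev n s × Sobolev n s) where
  carrier := {u | ∃ f ∈ flatFunctions n, u.1.toL2 =ᵐ[volume] (f : Heis n → ℂ) ∧
    u.2.toL2 =ᵐ[volume] (sublaplacian n f : Heis n → ℂ)}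
  add_mem' := by
    rintro u v ⟨f, hf, h1, h2⟩ ⟨g, hg, k1, k2⟩
    refine ⟨f + g, add_mem hf hg, ?_, ?_⟩
    · rw [Prod.fst_add, map_add]
      exact (Lp.coeFn_add _ _).trans (h1.add k1)
    · rw [Prod.snd_add, map_add, map_add]
      exact (Lp.coeFn_add _ _).trans (h2.add k2)
  zero_mem' := by
    refine ⟨0, zero_mem _, ?_, ?_⟩
    · rw [Prod.fst_zero, map_zero]
      exact Lp.coeFn_zero _ _ _
    · rw [Prod.snd_zero, map_zero, map_zero]
      exact Lp.coeFn_zero _ _ _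
  smul_mem' := by
    rintro c u ⟨f, hf, h1, h2⟩
    refine ⟨c • f, Submodule.smul_mem _ c hf, ?_, ?_⟩
    · rw [Prod.smul_fst, map_smul]
      exact (Lp.coeFn_smul _ _).trans (h1.const_smul c)
    · rw [Prod.smul_snd, map_smul, map_smul]
      exact (Lp.coeFn_smul _ _).trans (h2.const_smul c)

/-- The operator `A` in the Hilbert space `W^{s,2}`: the sublaplacian with domain the functions all
of whose derivatives `X^α Y^β T^k f` are in `L²` and vanish at the origin. -/
def opA (n : ℕ) (s : ℝ≥0) : Sobolev n s →ₗ.[ℂ] Sobolev n s := (graphA n s).toLinearPMap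

end Heisenberg

/-- An unbounded operator in a Hilbert space is essentially self-adjoint if it is densely defined
and symmetric and its closure is self-adjoint. -/
def IsEssentiallySelfAdjoint {H : Type*} [NormedAddCommGroup H] [InnerProductSpace ℂ H]
    [CompleteSpace H] (A : H →ₗ.[ℂ] H) : Prop :=
  Dense (A.domain : Set H) ∧ A.IsFormalAdjoint A ∧ IsSelfAdjoint A.closure

end

noncomputable section

namespace Heisenberg

open Filter Topology

variable {n : ℕ}

/-! ### Calculus of vector fields -/

/-! The dilations (z, t) ↦ (r z, r² t) make the homogeneous dimension of the group 2n + 2, so n + 1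
is the critical Sobolev order for evaluation at the origin. For n - 1 < s ≤ n + 1 the order s is at
most critical, while s + 2 is above it. Flatness at the origin is therefore invisible in the norm of
W^{s,2}, and D(A) is dense; but u ↦ u(0) is bounded by the norm of (I + ℒ)u in W^{s,2}, so a vector
(I + ℒ)φ with φ(0) = 1 stays away from (I + A)D(A).

Write R = (I + ℒ)⁻¹. On smooth functions with square integrable derivatives R inverts I + ℒ
(`resolvent_shifted`), so (I + A)⁻¹ is a restriction of R, which is a symmetric contraction on
W^{s,2} as well. Hence A is symmetric and ‖u‖ ≤ ‖(I + A)u‖. A vector orthogonal to the range of I +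
A would be an eigenvector of the adjoint with eigenvalue -1. If the closure were self-adjoint, the
lower bound would exclude it and the range would be dense (`dense_range_of_isSelfAdjoint_closure`).

Evaluation is estimated in three stages. A crude inequality |f(0)| ≤ C‖(I + ℒ)^m f‖ with
uncontrolled m comes from the fundamental theorem of calculus and commutator bounds for horizontal
derivatives (`exists_norm_apply_zero_le`). Dilating it gives |f(0)| ≤ C r^{-(n+1)} ‖(I + r²ℒ)^m f‖
for all r > 0. A dyadic decomposition of the spectrum of R, with the best r on each block, then
gives the sharp exponent (`exists_norm_le_opPow`).

For density, a test function φ is multiplied by η(δ_r ·), where η = 1 near the origin and r → ∞. The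
products are bounded in W^{n+1,2} and tend to zero in L², so they tend weakly to zero in W^{s,2}
(`tendsto_inner_concentrated`), and φ minus the product is flat. Thus a vector orthogonal to D(A) is
orthogonal to all test functions.

Both halves need (I + ℒ)^m C_c^∞ to be dense in L² (`eq_zero_of_inner_shifted_pow_eq_zero`). An
orthogonal vector, convolved with test functions, gives smooth solutions of (I + ℒ)^m u = 0 of
polynomial growth, and these vanish by the maximum principle (`eq_zero_of_shifted_eq_zero`). -/

theorem fieldOp_apply (v : Heis n → Heis n) (hv : ContDiff ℝ ∞ v) (f : Smooth n) (p : Heis n) :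
    (fieldOp v hv f : Heis n → ℂ) p = fderiv ℝ (f : Heis n → ℂ) p (v p) := rfl

/-- The horizontal left invariant vector fields. -/
def hvec (i : Fin n ⊕ Fin n) (p : Heis n) : Heis n :=
  Sum.elim (fun j => (Pi.single j 1, (p.1 j).im / 2))
    (fun j => (Pi.single j Complex.I, -((p.1 j).re / 2))) i

/-- The horizontal left invariant vector fields, as differential operators. -/
def V (i : Fin n ⊕ Fin n) : Module.End ℂ (Smooth n) := Sum.elim X Y i

@[simp] theorem V_inl (j : Fin n) : V (Sum.inl j) = X j := rfl
@[simp] theorem V_inr (j : Fin n) : V (Sum.inr j) = Y j := rfl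

theorem V_apply (i : Fin n ⊕ Fin n) (f : Smooth n) (p : Heis n) :
    (V i f : Heis n → ℂ) p = fderiv ℝ (f : Heis n → ℂ) p (hvec i p) := by
  cases i <;> rfl

theorem T_apply (f : Smooth n) (p : Heis n) :
    (T n f : Heis n → ℂ) p = fderiv ℝ (f : Heis n → ℂ) p (0, 1) := rfl

theorem contDiff_hvec (i : Fin n ⊕ Fin n) : ContDiff ℝ ∞ (hvec (n := n) i) := by
  cases i with
  | inl j =>
    have h : ContDiff ℝ ∞ fun p : Heis n => Complex.imCLM (p.1 j) := by fun_prop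
    exact contDiff_const.prodMk (h.div_const 2)
  | inr j =>
    have h : ContDiff ℝ ∞ fun p : Heis n => Complex.reCLM (p.1 j) := by fun_prop
    exact contDiff_const.prodMk (h.div_const 2).neg

theorem V_eq_fieldOp (i : Fin n ⊕ Fin n) : V i = fieldOp (hvec i) (contDiff_hvec i) := by
  cases i <;> rfl

theorem sublaplacian_eq : sublaplacian n = -∑ i, V i ^ 2 := by
  simp [sublaplacian, Finset.sum_add_distrib]

/-- The second derivatives of `f` cancel by symmetry; what remains is the derivative of `f` along
the Lie bracket, which `h` identifies with `u`. -/
theorem fieldOp_commutator (v w u : Heis n → Heis n) (hv : ContDiff ℝ ∞ v) (hw : ContDiff ℝ ∞ w)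
    (hu : ContDiff ℝ ∞ u) (h : ∀ p, fderiv ℝ w p (v p) - fderiv ℝ v p (w p) = u p) :
    fieldOp v hv * fieldOp w hw = fieldOp w hw * fieldOp v hv + fieldOp u hu := by
  ext f p
  have key : ∀ (a b : Heis n → Heis n) (ha : ContDiff ℝ ∞ a) (hb : ContDiff ℝ ∞ b),
      (fieldOp a ha (fieldOp b hb f) : Heis n → ℂ) p =
        fderiv ℝ (fderiv ℝ (f : Heis n → ℂ)) p (a p) (b p) +
        fderiv ℝ (f : Heis n → ℂ) p (fderiv ℝ b p (a p)) := by
    intro a b ha hb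
    rw [fieldOp_apply]
    change fderiv ℝ (fun q => fderiv ℝ (f : Heis n → ℂ) q (b q)) p (a p) = _
    have h1 : DifferentiableAt ℝ (fderiv ℝ (f : Heis n → ℂ)) p :=
      (((contDiff_coe f).fderiv_right (m := ∞) (by simp)).differentiable (by simp)).differentiableAt
    have h2 : DifferentiableAt ℝ b p := (hb.differentiable (by simp)).differentiableAt
    rw [fderiv_clm_apply h1 h2]
    simp [add_comm]
  have hs : IsSymmSndFDerivAt ℝ (f : Heis n → ℂ) p :=
    (contDiff_coe f).contDiffAt.isSymmSndFDerivAt (by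
      simp only [minSmoothness_of_isRCLikeNormedField]
      exact WithTop.coe_le_coe.2 (le_top : (2 : ℕ∞) ≤ ⊤))
  change (fieldOp v hv (fieldOp w hw f) : Heis n → ℂ) p =
    (fieldOp w hw (fieldOp v hv f) : Heis n → ℂ) p + (fieldOp u hu f : Heis n → ℂ) p
  rw [key, key, hs.eq (v p) (w p), fieldOp_apply, ← h p, map_sub]
  ring

theorem fieldOp_zero : fieldOp (0 : Heis n → Heis n) contDiff_const = 0 := by
  ext f p
  exact map_zero _

theorem fderiv_hvec (i : Fin n ⊕ Fin n) (p w : Heis n) :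
    fderiv ℝ (hvec i) p w =
      (0, Sum.elim (fun j => (w.1 j).im / 2) (fun j => -((w.1 j).re / 2)) i) := by
  cases i with
  | inl j =>
    have h : HasFDerivAt (fun p : Heis n => (p.1 j).im / 2)
        ((1 / 2 : ℝ) • (Complex.imCLM ∘L ContinuousLinearMap.proj j ∘L
          ContinuousLinearMap.fst ℝ (Fin n → ℂ) ℝ)) p := by
      have := ((1 / 2 : ℝ) • (Complex.imCLM ∘L ContinuousLinearMap.proj j ∘L
          ContinuousLinearMap.fst ℝ (Fin n → ℂ) ℝ)).hasFDerivAt (x := p)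
      refine this.congr_of_eventuallyEq (.of_forall fun q => ?_)
      simp; ring
    have h2 : HasFDerivAt (hvec (Sum.inl j)) _ p :=
      (hasFDerivAt_const (Pi.single j 1 : Fin n → ℂ) p).prodMk h
    rw [h2.fderiv]
    ext <;> simp; ring
  | inr j =>
    have h : HasFDerivAt (fun p : Heis n => -((p.1 j).re / 2))
        ((-1 / 2 : ℝ) • (Complex.reCLM ∘L ContinuousLinearMap.proj j ∘L
          ContinuousLinearMap.fst ℝ (Fin n → ℂ) ℝ)) p := by
      have := ((-1 / 2 : ℝ) • (Complex.reCLM ∘L ContinuousLinearMap.proj j ∘L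
          ContinuousLinearMap.fst ℝ (Fin n → ℂ) ℝ)).hasFDerivAt (x := p)
      refine this.congr_of_eventuallyEq (.of_forall fun q => ?_)
      simp; ring
    have h2 : HasFDerivAt (hvec (Sum.inr j)) _ p :=
      (hasFDerivAt_const (Pi.single j Complex.I : Fin n → ℂ) p).prodMk h
    rw [h2.fderiv]
    ext <;> simp; ring

theorem V_T_comm (i : Fin n ⊕ Fin n) : V i * T n = T n * V i := by
  have := fieldOp_commutator (hvec i) (fun _ => (0, 1)) 0 (contDiff_hvec i) contDiff_const
    contDiff_const (fun p => by rw [fderiv_hvec]; cases i <;> simp)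
  rw [V_eq_fieldOp, T, this, fieldOp_zero, add_zero]

theorem Y_X_comm (j : Fin n) : Y j * X j = X j * Y j + T n :=
  fieldOp_commutator (hvec (Sum.inr j)) (hvec (Sum.inl j)) (fun _ => (0, 1))
    (contDiff_hvec _) (contDiff_hvec _) contDiff_const (fun p => by
      rw [fderiv_hvec, fderiv_hvec]; ext <;> simp [hvec]; ring)

theorem V_comm_of_ne {i k : Fin n ⊕ Fin n} (h : k ≠ i.swap) : V i * V k = V k * V i := by
  have := fieldOp_commutator (hvec i) (hvec k) 0
    (contDiff_hvec _) (contDiff_hvec _) contDiff_const (fun p => by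
      rw [fderiv_hvec, fderiv_hvec]
      rcases i with i | i <;> rcases k with k | k
      · ext <;> simp [hvec, Pi.single_apply, apply_ite Complex.im]
      · have h' : k ≠ i := by simpa using h
        ext <;> simp [hvec, Pi.single_apply, h', h'.symm]
      · have h' : k ≠ i := by simpa using h
        ext <;> simp [hvec, Pi.single_apply, h', h'.symm]
      · ext <;> simp [hvec, Pi.single_apply, apply_ite Complex.re])
  rw [V_eq_fieldOp, V_eq_fieldOp, this, fieldOp_zero, add_zero]

/-- This trades `T` for words in horizontal fields; it is where n ≥ 1 enters the estimates. -/
theorem T_eq (j : Fin n) (f : Smooth n) : T n f = Y j (X j f) - X j (Y j f) := by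
  have := LinearMap.congr_fun (Y_X_comm j) f
  simp only [Module.End.mul_apply, LinearMap.add_apply] at this
  rw [this]; abel

theorem V_T_apply (i : Fin n ⊕ Fin n) (f : Smooth n) : V i (T n f) = T n (V i f) :=
  LinearMap.congr_fun (V_T_comm i) f

theorem sublaplacian_apply (f : Smooth n) : sublaplacian n f = -∑ i, V i (V i f) := by
  simp [sublaplacian_eq, pow_two]

theorem sublaplacian_T (f : Smooth n) : sublaplacian n (T n f) = T n (sublaplacian n f) := by
  simp only [sublaplacian_apply, V_T_apply, map_neg, map_sum]

theorem exists_V_swap_V (i : Fin n ⊕ Fin n) :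
    ∃ c : ℂ, ∀ f, V i.swap (V i f) = V i (V i.swap f) + c • T n f := by
  cases i with
  | inl j =>
    refine ⟨1, fun f => ?_⟩
    rw [T_eq j]; simp
  | inr j =>
    refine ⟨-1, fun f => ?_⟩
    rw [T_eq j]
    simp only [Sum.swap_inr, V_inl, V_inr]
    module

/-- Among the squares in ℒ only that of the conjugate field `V i.swap` fails to commute with `V i`;
moving `V i` past its two factors produces the central term twice. -/
theorem exists_sublaplacian_V (i : Fin n ⊕ Fin n) :
    ∃ c : ℂ, ∀ f, sublaplacian n (V i f) = V i (sublaplacian n f) + c • V i.swap (T n f) := by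
  obtain ⟨c, hc⟩ := exists_V_swap_V i
  refine ⟨-2 * c, fun f => ?_⟩
  have h1 : ∀ k, V k (V k (V i f)) =
      V i (V k (V k f)) + if k = i.swap then (2 * c) • V i.swap (T n f) else 0 := by
    intro k
    split_ifs with hk
    · subst hk
      rw [hc, map_add, hc, map_smul, V_T_apply]
      module
    · have h : ∀ g, V k (V i g) = V i (V k g) :=
        fun g => (LinearMap.congr_fun (V_comm_of_ne hk) g).symm
      rw [h, h, add_zero]
  rw [sublaplacian_apply, Finset.sum_congr rfl fun k _ => h1 k, Finset.sum_add_distrib,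
    Finset.sum_ite_eq', sublaplacian_apply, map_neg, map_sum]
  simp
  module

/-! ### Products and compositions -/

/-- Multiplication by a smooth function. -/
def mulS (c : Smooth n) : Module.End ℂ (Smooth n) where
  toFun f := ⟨fun p => (c : Heis n → ℂ) p * (f : Heis n → ℂ) p,
    show ContDiff ℝ ∞ _ from (contDiff_coe c).mul (contDiff_coe f)⟩
  map_add' f g := by ext p; simp [mul_add]
  map_smul' a f := by ext p; simp; ring

@[simp] theorem mulS_apply (c f : Smooth n) (p : Heis n) :
    (mulS c f : Heis n → ℂ) p = (c : Heis n → ℂ) p * (f : Heis n → ℂ) p := rfl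

theorem fieldOp_mulS (v : Heis n → Heis n) (hv : ContDiff ℝ ∞ v) (c f : Smooth n) :
    fieldOp v hv (mulS c f) = mulS (fieldOp v hv c) f + mulS c (fieldOp v hv f) := by
  ext p
  change fderiv ℝ (fun p => (c : Heis n → ℂ) p * (f : Heis n → ℂ) p) p (v p) = _
  rw [fderiv_fun_mul (differentiableAt_coe c p) (differentiableAt_coe f p)]
  simp [fieldOp_apply]
  ring

theorem V_mulS (i : Fin n ⊕ Fin n) (c f : Smooth n) :
    V i (mulS c f) = mulS (V i c) f + mulS c (V i f) := by
  rw [V_eq_fieldOp, fieldOp_mulS]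

/-- Composition with a smooth map. -/
def pull (g : Heis n → Heis n) (hg : ContDiff ℝ ∞ g) : Module.End ℂ (Smooth n) where
  toFun f := ⟨fun p => (f : Heis n → ℂ) (g p), show ContDiff ℝ ∞ _ from (contDiff_coe f).comp hg⟩
  map_add' _ _ := rfl
  map_smul' _ _ := rfl

@[simp] theorem pull_apply (g : Heis n → Heis n) (hg : ContDiff ℝ ∞ g) (f : Smooth n)
    (p : Heis n) : (pull g hg f : Heis n → ℂ) p = (f : Heis n → ℂ) (g p) := rfl

theorem fieldOp_pull_apply (v : Heis n → Heis n) (hv : ContDiff ℝ ∞ v)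
    (g : Heis n → Heis n) (hg : ContDiff ℝ ∞ g) (f : Smooth n) (p : Heis n) :
    (fieldOp v hv (pull g hg f) : Heis n → ℂ) p =
      fderiv ℝ (f : Heis n → ℂ) (g p) (fderiv ℝ g p (v p)) := by
  change fderiv ℝ ((f : Heis n → ℂ) ∘ g) p (v p) = _
  rw [fderiv_comp p (differentiableAt_coe f _) (hg.differentiable (by simp)).differentiableAt]
  rfl

/-- The automorphic dilation `(z, t) ↦ (r z, r² t)`. -/
def dil (r : ℝ) : Heis n →L[ℝ] Heis n :=
  (r • ContinuousLinearMap.id ℝ (Fin n → ℂ)).prodMap (r ^ 2 • ContinuousLinearMap.id ℝ ℝ)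

theorem dil_apply (r : ℝ) (p : Heis n) : dil r p = (r • p.1, r ^ 2 * p.2) := rfl

/-- Composition with a dilation. -/
def dilS (r : ℝ) : Module.End ℂ (Smooth n) := pull (dil r) (dil r).contDiff

@[simp] theorem dilS_apply (r : ℝ) (f : Smooth n) (p : Heis n) :
    (dilS r f : Heis n → ℂ) p = (f : Heis n → ℂ) (dil r p) := rfl

/-- The dilation carries `hvec i p` to `r` times `hvec i (dil r p)`: the horizontal fields are
homogeneous of degree one. -/
theorem V_dilS (i : Fin n ⊕ Fin n) (r : ℝ) (f : Smooth n) :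
    V i (dilS r f) = (r : ℂ) • dilS r (V i f) := by
  ext p
  rw [V_eq_fieldOp, dilS, fieldOp_pull_apply, ContinuousLinearMap.fderiv]
  have : dil r (hvec i p) = r • hvec i (dil r p) := by
    rw [dil_apply]
    cases i <;> ext <;> simp [hvec, dil_apply] <;> ring
  rw [this, map_smul]
  simp [fieldOp_apply]

theorem sublaplacian_dilS (r : ℝ) (f : Smooth n) :
    sublaplacian n (dilS r f) = ((r : ℂ) ^ 2) • dilS r (sublaplacian n f) := by
  simp only [sublaplacian_apply, pow_two, V_dilS, map_smul, map_neg, map_sum, Finset.smul_sum,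
    smul_neg, smul_smul]

/-- The symplectic form `Im (a · conj z) / 2`. -/
def symp (a : Fin n → ℂ) : (Fin n → ℂ) →L[ℝ] ℝ :=
  ∑ j, (((a j).im / 2) • (Complex.reCLM ∘L ContinuousLinearMap.proj j) -
    ((a j).re / 2) • (Complex.imCLM ∘L ContinuousLinearMap.proj j))

theorem symp_apply (a z : Fin n → ℂ) :
    symp a z = ∑ j, ((a j).im / 2 * (z j).re - (a j).re / 2 * (z j).im) := by
  simp [symp]

theorem symp_comm (a z : Fin n → ℂ) : symp a z = - symp z a := by
  rw [symp_apply, symp_apply, ← Finset.sum_neg_distrib]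
  exact Finset.sum_congr rfl fun j _ => by ring

theorem symp_single_one (a : Fin n → ℂ) (j : Fin n) : symp a (Pi.single j 1) = (a j).im / 2 := by
  rw [symp_apply, Finset.sum_eq_single j] <;> simp +contextual

theorem symp_single_I (a : Fin n → ℂ) (j : Fin n) :
    symp a (Pi.single j Complex.I) = -((a j).re / 2) := by
  rw [symp_apply, Finset.sum_eq_single j] <;> simp +contextual

/-- Left translation. -/
def ltr (a p : Heis n) : Heis n := (a.1 + p.1, a.2 + p.2 + symp a.1 p.1)

theorem contDiff_ltr (a : Heis n) : ContDiff ℝ ∞ (ltr a) := by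
  unfold ltr; fun_prop

/-- Composition with a left translation. -/
def ltrS (a : Heis n) : Module.End ℂ (Smooth n) := pull (ltr a) (contDiff_ltr a)

theorem fderiv_ltr (a p w : Heis n) : fderiv ℝ (ltr a) p w = (w.1, w.2 + symp a.1 w.1) := by
  have h : HasFDerivAt (ltr a) ((ContinuousLinearMap.fst ℝ (Fin n → ℂ) ℝ).prod
      (ContinuousLinearMap.snd ℝ (Fin n → ℂ) ℝ + symp a.1 ∘L ContinuousLinearMap.fst ℝ _ ℝ)) p := by
    refine HasFDerivAt.prodMk ?_ ?_
    · exact (ContinuousLinearMap.fst ℝ (Fin n → ℂ) ℝ).hasFDerivAt.const_add _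
    · exact ((ContinuousLinearMap.snd ℝ (Fin n → ℂ) ℝ).hasFDerivAt.const_add _).add
        (symp a.1 ∘L ContinuousLinearMap.fst ℝ _ ℝ).hasFDerivAt
  rw [h.fderiv]
  rfl

theorem V_ltrS (i : Fin n ⊕ Fin n) (a : Heis n) (f : Smooth n) :
    V i (ltrS a f) = ltrS a (V i f) := by
  ext p
  rw [V_eq_fieldOp, ltrS, fieldOp_pull_apply, fderiv_ltr]
  simp only [pull_apply, fieldOp_apply]
  congr 1
  cases i with
  | inl j => ext <;> simp [hvec, ltr, symp_single_one]; ring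
  | inr j => ext <;> simp [hvec, ltr, symp_single_I]; ring

theorem sublaplacian_ltrS (a : Heis n) (f : Smooth n) :
    sublaplacian n (ltrS a f) = ltrS a (sublaplacian n f) := by
  simp only [sublaplacian_apply, V_ltrS, map_neg, map_sum]

instance : (volume : Measure (Heis n)).IsAddHaarMeasure :=
  haveI : (volume : Measure (Fin n → ℂ)).IsAddHaarMeasure :=
    Measure.pi.isAddHaarMeasure _
  Measure.prod.instIsAddHaarMeasure (volume : Measure (Fin n → ℂ)) (volume : Measure ℝ)

/-! ### Test functions -/

/-- The smooth functions with compact support. -/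
def Test (n : ℕ) : Submodule ℂ (Smooth n) where
  carrier := {f | HasCompactSupport (f : Heis n → ℂ)}
  add_mem' hf hg := HasCompactSupport.add hf hg
  zero_mem' := HasCompactSupport.zero
  smul_mem' c _ hf := HasCompactSupport.smul_left (f := fun _ => c) hf

theorem mem_Test {f : Smooth n} : f ∈ Test n ↔ HasCompactSupport (f : Heis n → ℂ) := Iff.rfl

theorem tsupport_fieldOp_subset (v : Heis n → Heis n) (hv : ContDiff ℝ ∞ v) (f : Smooth n) :
    tsupport (fieldOp v hv f : Heis n → ℂ) ⊆ tsupport (f : Heis n → ℂ) := by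
  refine closure_minimal (fun p hp => ?_) (isClosed_tsupport _)
  refine (support_fderiv_subset ℝ (f := (f : Heis n → ℂ))) fun h0 => hp ?_
  rw [fieldOp_apply, h0]
  rfl

theorem fieldOp_mem_Test (v : Heis n → Heis n) (hv : ContDiff ℝ ∞ v) {f : Smooth n}
    (hf : f ∈ Test n) : fieldOp v hv f ∈ Test n :=
  IsCompact.of_isClosed_subset hf (isClosed_tsupport _) (tsupport_fieldOp_subset v hv f)

theorem V_mem_Test (i : Fin n ⊕ Fin n) {f : Smooth n} (hf : f ∈ Test n) : V i f ∈ Test n := by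
  rw [V_eq_fieldOp]; exact fieldOp_mem_Test _ _ hf

theorem T_mem_Test {f : Smooth n} (hf : f ∈ Test n) : T n f ∈ Test n := fieldOp_mem_Test _ _ hf

theorem sublaplacian_mem_Test {f : Smooth n} (hf : f ∈ Test n) : sublaplacian n f ∈ Test n := by
  rw [sublaplacian_apply]
  exact neg_mem (sum_mem fun i _ => V_mem_Test i (V_mem_Test i hf))

theorem mulS_mem_Test_left {c : Smooth n} (f : Smooth n) (hc : c ∈ Test n) : mulS c f ∈ Test n :=
  HasCompactSupport.mul_right (f := (c : Heis n → ℂ)) hc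

theorem mulS_mem_Test_right (c : Smooth n) {f : Smooth n} (hf : f ∈ Test n) : mulS c f ∈ Test n :=
  HasCompactSupport.mul_left (f' := (f : Heis n → ℂ)) hf

theorem memLp_of_mem_Test {f : Smooth n} (hf : f ∈ Test n) :
    MemLp (f : Heis n → ℂ) 2 volume :=
  (contDiff_coe f).continuous.memLp_of_hasCompactSupport hf

theorem integrable_of_mem_Test {f : Smooth n} (hf : f ∈ Test n) :
    Integrable (f : Heis n → ℂ) volume :=
  (contDiff_coe f).continuous.integrable_of_hasCompactSupport hf

/-- The complex conjugate of a smooth function. -/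
def conjS (f : Smooth n) : Smooth n :=
  ⟨fun p => (starRingEnd ℂ) ((f : Heis n → ℂ) p),
    show ContDiff ℝ ∞ _ from Complex.conjCLE.contDiff.comp (contDiff_coe f)⟩

@[simp] theorem conjS_apply (f : Smooth n) (p : Heis n) :
    (conjS f : Heis n → ℂ) p = (starRingEnd ℂ) ((f : Heis n → ℂ) p) := rfl

theorem conjS_mem_Test {f : Smooth n} (hf : f ∈ Test n) : conjS f ∈ Test n :=
  HasCompactSupport.comp_left (f := (f : Heis n → ℂ)) hf (map_zero _)

theorem V_conjS (i : Fin n ⊕ Fin n) (f : Smooth n) : V i (conjS f) = conjS (V i f) := by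
  ext p
  rw [V_apply, conjS_apply, V_apply]
  have : HasFDerivAt (conjS f : Heis n → ℂ) ((Complex.conjCLE : ℂ →L[ℝ] ℂ) ∘L
      fderiv ℝ (f : Heis n → ℂ) p) p :=
    (Complex.conjCLE : ℂ →L[ℝ] ℂ).hasFDerivAt.comp p (differentiableAt_coe f p).hasFDerivAt
  rw [this.fderiv]
  rfl

/-- The constant vector fields, as differential operators. -/
def D (w : Heis n) : Module.End ℂ (Smooth n) := fieldOp (fun _ => w) contDiff_const

theorem D_apply (w : Heis n) (f : Smooth n) (p : Heis n) :
    (D w f : Heis n → ℂ) p = fderiv ℝ (f : Heis n → ℂ) p w := rfl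

/-! ### Integration by parts -/

theorem integral_D_eq_zero (w : Heis n) {h : Smooth n} (hh : h ∈ Test n) :
    ∫ p, (D w h : Heis n → ℂ) p = 0 := by
  have h1 : Integrable (fun p => fderiv ℝ (h : Heis n → ℂ) p w) volume :=
    integrable_of_mem_Test (fieldOp_mem_Test (fun _ => w) contDiff_const hh)
  -- Integration by parts against the constant 1.
  have := integral_mul_fderiv_eq_neg_fderiv_mul_of_integrable (μ := (volume : Measure (Heis n)))
    (f := fun _ : Heis n => (1 : ℂ)) (g := (h : Heis n → ℂ)) (v := w) (𝕜 := ℂ)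
    (by simp) (by simpa using h1) (by simpa using integrable_of_mem_Test hh)
    (fun p _ => by fun_prop) (fun p _ => differentiableAt_coe h p)
  change ∫ p, fderiv ℝ (h : Heis n → ℂ) p w = 0
  simpa using this

/-- A real linear form in `z`, as a smooth function. -/
def linS (k : (Fin n → ℂ) →L[ℝ] ℝ) : Smooth n :=
  ⟨Complex.ofRealCLM ∘L k ∘L ContinuousLinearMap.fst ℝ (Fin n → ℂ) ℝ,
    show ContDiff ℝ ∞ _ from ContinuousLinearMap.contDiff _⟩

@[simp] theorem linS_apply (k : (Fin n → ℂ) →L[ℝ] ℝ) (p : Heis n) :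
    (linS k : Heis n → ℂ) p = (k p.1 : ℂ) := rfl

theorem fderiv_linS (k : (Fin n → ℂ) →L[ℝ] ℝ) (p w : Heis n) :
    fderiv ℝ (linS k : Heis n → ℂ) p w = (k w.1 : ℂ) := by
  change fderiv ℝ (Complex.ofRealCLM ∘L k ∘L ContinuousLinearMap.fst ℝ (Fin n → ℂ) ℝ) p w = _
  rw [ContinuousLinearMap.fderiv]
  rfl

/-- The coefficient of `∂/∂t` in a horizontal field. -/
def tcoeff (i : Fin n ⊕ Fin n) : (Fin n → ℂ) →L[ℝ] ℝ :=
  Sum.elim (fun j => (1 / 2 : ℝ) • (Complex.imCLM ∘L ContinuousLinearMap.proj j))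
    (fun j => (-1 / 2 : ℝ) • (Complex.reCLM ∘L ContinuousLinearMap.proj j)) i

theorem hvec_eq (i : Fin n ⊕ Fin n) (p : Heis n) :
    hvec i p = hvec i 0 + tcoeff i p.1 • (0, 1) := by
  cases i <;> ext <;> simp [hvec, tcoeff] <;> ring

theorem V_eq_D (i : Fin n ⊕ Fin n) (f : Smooth n) :
    V i f = D (hvec i 0) f + mulS (linS (tcoeff i)) (T n f) := by
  ext p
  change (V i f : Heis n → ℂ) p = (D (hvec i 0) f : Heis n → ℂ) p +
    (tcoeff i p.1 : ℂ) * (T n f : Heis n → ℂ) p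
  rw [V_apply, hvec_eq, map_add, map_smul, Complex.real_smul]
  rfl

/-- The coefficient of ∂/∂t in `V i` does not depend on t, so it may be moved under `T`; both
summands are then integrals of constant fields applied to test functions. -/
theorem integral_V_eq_zero (i : Fin n ⊕ Fin n) {h : Smooth n} (hh : h ∈ Test n) :
    ∫ p, (V i h : Heis n → ℂ) p = 0 := by
  set w := hvec i (0 : Heis n)
  set c := linS (tcoeff i)
  have hc : T n c = 0 := by
    ext p
    rw [T_apply, fderiv_linS]
    simp
  have h1 : mulS c (T n h) = T n (mulS c h) := by
    rw [T, fieldOp_mulS]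
    change _ = mulS (T n c) h + _
    rw [hc]
    ext p; simp
  have h2 : ∀ p, (V i h : Heis n → ℂ) p = (D w h : Heis n → ℂ) p +
      (D (0, 1) (mulS c h) : Heis n → ℂ) p := fun p => by
    rw [V_eq_D, h1]; rfl
  simp only [h2]
  have hm : mulS c h ∈ Test n := mulS_mem_Test_right c hh
  have i1 : Integrable (D w h : Heis n → ℂ) := integrable_of_mem_Test (fieldOp_mem_Test _ _ hh)
  have i2 : Integrable (D (0, 1) (mulS c h) : Heis n → ℂ) :=
    integrable_of_mem_Test (fieldOp_mem_Test _ _ hm)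
  rw [integral_add i1 i2, integral_D_eq_zero w hh, integral_D_eq_zero _ hm, add_zero]

theorem integral_V_mul (i : Fin n ⊕ Fin n) {f : Smooth n} (hf : f ∈ Test n) (g : Smooth n) :
    ∫ p, (V i f : Heis n → ℂ) p * (g : Heis n → ℂ) p =
      -∫ p, (f : Heis n → ℂ) p * (V i g : Heis n → ℂ) p := by
  have h := integral_V_eq_zero i (mulS_mem_Test_left g hf)
  rw [V_mulS] at h
  have h' : ∫ p, ((V i f : Heis n → ℂ) p * (g : Heis n → ℂ) p +
      (f : Heis n → ℂ) p * (V i g : Heis n → ℂ) p) = 0 := h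
  have i1 := integrable_of_mem_Test (mulS_mem_Test_left g (V_mem_Test i hf))
  have i2 := integrable_of_mem_Test (mulS_mem_Test_left (V i g) hf)
  have i1 : Integrable fun p => (V i f : Heis n → ℂ) p * (g : Heis n → ℂ) p := i1
  have i2 : Integrable fun p => (f : Heis n → ℂ) p * (V i g : Heis n → ℂ) p := i2
  rw [integral_add i1 i2] at h'
  exact eq_neg_of_add_eq_zero_left h'

theorem integral_sublaplacian_mul {f : Smooth n} (hf : f ∈ Test n) (g : Smooth n) :
    ∫ p, (sublaplacian n f : Heis n → ℂ) p * (g : Heis n → ℂ) p =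
      ∫ p, (f : Heis n → ℂ) p * (sublaplacian n g : Heis n → ℂ) p := by
  have h1 : ∀ p, (sublaplacian n f : Heis n → ℂ) p * (g : Heis n → ℂ) p =
      -∑ i, (V i (V i f) : Heis n → ℂ) p * (g : Heis n → ℂ) p := fun p => by
    rw [sublaplacian_apply, ← Finset.sum_mul, ← neg_mul]
    congr 1
    simp only [NegMemClass.coe_neg, Pi.neg_apply, AddSubmonoidClass.coe_finsetSum, Finset.sum_apply]
  have h2 : ∀ p, (f : Heis n → ℂ) p * (sublaplacian n g : Heis n → ℂ) p =
      -∑ i, (f : Heis n → ℂ) p * (V i (V i g) : Heis n → ℂ) p := fun p => by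
    rw [sublaplacian_apply, ← Finset.mul_sum, ← mul_neg]
    congr 1
    simp only [NegMemClass.coe_neg, Pi.neg_apply, AddSubmonoidClass.coe_finsetSum, Finset.sum_apply]
  simp only [h1, h2]
  rw [integral_neg, integral_neg, integral_finsetSum, integral_finsetSum]
  · congr 1
    refine Finset.sum_congr rfl fun i _ => ?_
    rw [integral_V_mul i (V_mem_Test i hf), integral_V_mul i hf, neg_neg]
  · exact fun i _ => integrable_of_mem_Test (mulS_mem_Test_left (V i (V i g)) hf)
  · exact fun i _ => integrable_of_mem_Test (mulS_mem_Test_left g (V_mem_Test i (V_mem_Test i hf)))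

/-! ### Smooth functions with square integrable derivatives -/

/-- The compositions of horizontal fields. -/
def wordOp (l : List (Fin n ⊕ Fin n)) : Module.End ℂ (Smooth n) := (l.map V).prod

@[simp] theorem wordOp_nil : wordOp (n := n) [] = 1 := rfl

@[simp] theorem wordOp_cons (i : Fin n ⊕ Fin n) (l : List (Fin n ⊕ Fin n)) :
    wordOp (i :: l) = V i * wordOp l := by simp [wordOp]

theorem wordOp_append (l l' : List (Fin n ⊕ Fin n)) :
    wordOp (l ++ l') = wordOp l * wordOp l' := by simp [wordOp]

/-- The smooth functions all of whose horizontal derivatives are square integrable. -/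
def Sch (n : ℕ) : Submodule ℂ (Smooth n) where
  carrier := {f | ∀ l, MemLp (wordOp l f : Heis n → ℂ) 2 volume}
  add_mem' hf hg l := by rw [map_add]; exact (hf l).add (hg l)
  zero_mem' l := by rw [map_zero]; exact MemLp.zero
  smul_mem' c f hf l := by rw [map_smul]; exact (hf l).const_smul c

theorem memLp_of_mem_Sch {f : Smooth n} (hf : f ∈ Sch n) : MemLp (f : Heis n → ℂ) 2 volume :=
  hf []

theorem V_mem_Sch (i : Fin n ⊕ Fin n) {f : Smooth n} (hf : f ∈ Sch n) : V i f ∈ Sch n := fun l => by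
  have := hf (l ++ [i])
  rwa [wordOp_append, wordOp_cons, wordOp_nil, mul_one, Module.End.mul_apply] at this

theorem sublaplacian_mem_Sch {f : Smooth n} (hf : f ∈ Sch n) : sublaplacian n f ∈ Sch n := by
  rw [sublaplacian_apply]
  exact neg_mem (sum_mem fun i _ => V_mem_Sch i (V_mem_Sch i hf))

theorem Test_le_Sch : Test n ≤ Sch n := by
  intro f hf l
  refine memLp_of_mem_Test ?_
  induction l with
  | nil => exact hf
  | cons i l ih =>
    rw [wordOp_cons, Module.End.mul_apply]
    exact V_mem_Test i ih

open Classical in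
/-- The class in `L²` of a smooth function (zero if it is not square integrable). -/
def cls (f : Smooth n) : L2 n :=
  if h : MemLp (f : Heis n → ℂ) 2 volume then h.toLp _ else 0

theorem cls_eq {f : Smooth n} (h : MemLp (f : Heis n → ℂ) 2 volume) : cls f = h.toLp _ :=
  dif_pos h

theorem coeFn_cls {f : Smooth n} (h : MemLp (f : Heis n → ℂ) 2 volume) :
    cls f =ᵐ[volume] (f : Heis n → ℂ) := by
  rw [cls_eq h]; exact h.coeFn_toLp

theorem cls_add {f g : Smooth n} (hf : f ∈ Sch n) (hg : g ∈ Sch n) :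
    cls (f + g) = cls f + cls g := by
  rw [cls_eq (memLp_of_mem_Sch hf), cls_eq (memLp_of_mem_Sch hg),
    cls_eq (memLp_of_mem_Sch (add_mem hf hg)), ← MemLp.toLp_add]
  rfl

theorem cls_smul (c : ℂ) {f : Smooth n} (hf : f ∈ Sch n) : cls (c • f) = c • cls f := by
  rw [cls_eq (memLp_of_mem_Sch hf), cls_eq (memLp_of_mem_Sch (Submodule.smul_mem _ c hf)),
    ← MemLp.toLp_const_smul]
  rfl

/-- The inclusion of the smooth functions with square integrable derivatives in `L²`. -/
def schL2 (n : ℕ) : Sch n →ₗ[ℂ] L2 n where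
  toFun f := cls f
  map_add' f g := cls_add f.2 g.2
  map_smul' c f := cls_smul c f.2

theorem cls_sub {f g : Smooth n} (hf : f ∈ Sch n) (hg : g ∈ Sch n) :
    cls (f - g) = cls f - cls g := (schL2 n).map_sub (⟨f, hf⟩ : Sch n) (⟨g, hg⟩ : Sch n)

theorem cls_neg {f : Smooth n} (hf : f ∈ Sch n) : cls (-f) = -cls f :=
  (schL2 n).map_neg (⟨f, hf⟩ : Sch n)

theorem cls_sum {ι : Type*} (s : Finset ι) (f : ι → Smooth n) (hf : ∀ i, f i ∈ Sch n) :
    cls (∑ i ∈ s, f i) = ∑ i ∈ s, cls (f i) := by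
  have := map_sum (schL2 n) (fun i => (⟨f i, hf i⟩ : Sch n)) s
  simpa only [schL2, LinearMap.coe_mk, AddHom.coe_mk, AddSubmonoidClass.coe_finsetSum] using this

theorem inner_cls {f g : Smooth n} (hf : MemLp (f : Heis n → ℂ) 2 volume)
    (hg : MemLp (g : Heis n → ℂ) 2 volume) :
    ⟪cls f, cls g⟫_ℂ = ∫ p, (conjS f : Heis n → ℂ) p * (g : Heis n → ℂ) p := by
  rw [L2.inner_def]
  refine integral_congr_ae ?_
  filter_upwards [coeFn_cls hf, coeFn_cls hg] with p h1 h2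
  rw [h1, h2, conjS_apply, RCLike.inner_apply, mul_comm]

theorem norm_cls_sq {f : Smooth n} (hf : MemLp (f : Heis n → ℂ) 2 volume) :
    ‖cls f‖ ^ 2 = ∫ p, ‖(f : Heis n → ℂ) p‖ ^ 2 := by
  have h := inner_cls hf hf
  rw [inner_self_eq_norm_sq_to_K] at h
  have h2 : ∀ p, (conjS f : Heis n → ℂ) p * (f : Heis n → ℂ) p =
      ((‖(f : Heis n → ℂ) p‖ ^ 2 : ℝ) : ℂ) := fun p => by
    rw [conjS_apply, mul_comm, Complex.mul_conj, Complex.normSq_eq_norm_sq]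
  simp only [h2] at h
  rw [integral_complex_ofReal] at h
  exact Complex.ofReal_injective (by rw [← h]; push_cast; rfl)

theorem inner_cls_V (i : Fin n ⊕ Fin n) {f g : Smooth n} (hf : f ∈ Test n) (hg : g ∈ Sch n) :
    ⟪cls f, cls (V i g)⟫_ℂ = -⟪cls (V i f), cls g⟫_ℂ := by
  rw [inner_cls (memLp_of_mem_Test hf) (memLp_of_mem_Sch (V_mem_Sch i hg)),
    inner_cls (memLp_of_mem_Test (V_mem_Test i hf)) (memLp_of_mem_Sch hg), ← V_conjS,
    integral_V_mul i (conjS_mem_Test hf), neg_neg]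

theorem inner_cls_sublaplacian {f g : Smooth n} (hf : f ∈ Test n) (hg : g ∈ Sch n) :
    ⟪cls f, cls (sublaplacian n g)⟫_ℂ = ∑ i, ⟪cls (V i f), cls (V i g)⟫_ℂ := by
  rw [sublaplacian_apply, cls_neg (sum_mem fun i _ => V_mem_Sch i (V_mem_Sch i hg)),
    cls_sum _ _ fun i => V_mem_Sch i (V_mem_Sch i hg), inner_neg_right, inner_sum,
    ← Finset.sum_neg_distrib]
  exact Finset.sum_congr rfl fun i _ => by rw [inner_cls_V i hf (V_mem_Sch i hg), neg_neg]

/-! ### Dilations -/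

theorem map_dil {r : ℝ} (hr : 0 < r) : Measure.map (dil r) (volume : Measure (Heis n)) =
    ENNReal.ofReal ((r ^ (2 * n + 2))⁻¹) • volume := by
  -- The 2n real directions of z scale by r and t scales by r²: the exponent is the homogeneous
  -- dimension 2n + 2.
  have hdet : LinearMap.det (dil (n := n) r : Heis n →ₗ[ℝ] Heis n) = r ^ (2 * n + 2) := by
    have : (dil (n := n) r : Heis n →ₗ[ℝ] Heis n) =
        (r • (LinearMap.id : (Fin n → ℂ) →ₗ[ℝ] (Fin n → ℂ))).prodMap
          (r ^ 2 • (LinearMap.id : ℝ →ₗ[ℝ] ℝ)) := rfl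
    rw [this, LinearMap.det_prodMap, LinearMap.det_smul, LinearMap.det_smul]
    simp [Module.finrank_pi_fintype, mul_comm]
    ring
  have h := Measure.map_linearMap_addHaar_eq_smul_addHaar (volume : Measure (Heis n))
    (f := (dil (n := n) r : Heis n →ₗ[ℝ] Heis n)) (by rw [hdet]; positivity)
  rw [hdet, abs_of_pos (by positivity)] at h
  exact h

theorem dil_dil (r s : ℝ) (p : Heis n) : dil r (dil s p) = dil (r * s) p := by
  simp only [dil_apply, smul_smul]
  ext <;> simp; ring

@[simp] theorem dil_one (p : Heis n) : dil 1 p = p := by simp [dil_apply]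

@[simp] theorem dil_zero_left (p : Heis n) : dil 0 p = 0 := by simp [dil_apply]

theorem dilS_mem_Test {r : ℝ} (hr : r ≠ 0) {f : Smooth n} (hf : f ∈ Test n) :
    dilS r f ∈ Test n := by
  let e : Heis n ≃ₜ Heis n :=
    { toFun := dil r, invFun := dil r⁻¹,
      left_inv := fun p => by rw [dil_dil, inv_mul_cancel₀ hr, dil_one]
      right_inv := fun p => by rw [dil_dil, mul_inv_cancel₀ hr, dil_one]
      continuous_toFun := (dil r).continuous
      continuous_invFun := (dil r⁻¹).continuous }
  exact HasCompactSupport.comp_homeomorph (f := (f : Heis n → ℂ)) hf e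

theorem norm_cls_dilS {r : ℝ} (hr : 0 < r) {f : Smooth n} (hf : f ∈ Test n) :
    ‖cls (dilS r f)‖ = (r ^ (n + 1))⁻¹ * ‖cls f‖ := by
  refine (sq_eq_sq₀ (norm_nonneg _) (by positivity)).1 ?_
  rw [mul_pow, norm_cls_sq (memLp_of_mem_Test hf),
    norm_cls_sq (memLp_of_mem_Test (dilS_mem_Test hr.ne' hf))]
  have h := integral_map (μ := (volume : Measure (Heis n))) (φ := dil r)
    (f := fun p => ‖(f : Heis n → ℂ) p‖ ^ 2) (dil r).continuous.aemeasurable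
    (((contDiff_coe f).continuous.norm.pow 2).aestronglyMeasurable)
  simp only [dilS_apply]
  rw [← h, map_dil hr, integral_smul_measure, ENNReal.toReal_ofReal (by positivity), smul_eq_mul]
  congr 1
  rw [inv_pow, ← pow_mul]
  ring_nf

/-! ### Cutoffs -/

theorem exists_bound {χ : Smooth n} (hχ : χ ∈ Test n) :
    ∃ C, 0 ≤ C ∧ ∀ p, ‖(χ : Heis n → ℂ) p‖ ≤ C := by
  obtain ⟨C, hC⟩ := (mem_Test.1 hχ).exists_bound_of_continuous (contDiff_coe χ).continuous
  exact ⟨C, (norm_nonneg _).trans (hC 0), hC⟩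

/-- Dominated convergence, since `dil ε p` tends to the origin. The value of χ there is left
arbitrary because derivatives of cutoffs, such as `V i χ`, occur later in the place of χ. -/
theorem tendsto_cls_cutoff {χ f : Smooth n} (hχ : χ ∈ Test n) (hf : f ∈ Sch n) :
    Tendsto (fun ε : ℝ => cls (mulS (dilS ε χ) f)) (𝓝[>] 0)
      (𝓝 ((χ : Heis n → ℂ) 0 • cls f)) := by
  obtain ⟨C, hC0, hC⟩ := exists_bound hχ
  rw [tendsto_iff_norm_sub_tendsto_zero]
  have h1 : ∀ᶠ ε : ℝ in 𝓝[>] 0, (∫ p, ‖((χ : Heis n → ℂ) (dil ε p) - (χ : Heis n → ℂ) 0) *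
      (f : Heis n → ℂ) p‖ ^ 2) =
      ‖cls (mulS (dilS ε χ) f) - (χ : Heis n → ℂ) 0 • cls f‖ ^ 2 := by
    filter_upwards [self_mem_nhdsWithin] with ε hε
    have h2 : mulS (dilS ε χ) f ∈ Sch n :=
      Test_le_Sch (mulS_mem_Test_left f (dilS_mem_Test (ne_of_gt hε) hχ))
    have h3 := Submodule.smul_mem _ ((χ : Heis n → ℂ) 0) hf
    rw [← cls_smul _ hf, ← cls_sub h2 h3, norm_cls_sq (memLp_of_mem_Sch (sub_mem h2 h3))]
    refine integral_congr_ae (.of_forall fun p => ?_)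
    simp [sub_mul]
  have h2 : Tendsto (fun ε : ℝ => ∫ p, ‖((χ : Heis n → ℂ) (dil ε p) - (χ : Heis n → ℂ) 0) *
      (f : Heis n → ℂ) p‖ ^ 2) (𝓝[>] 0) (𝓝 (∫ _ : Heis n, (0 : ℝ))) := by
    refine tendsto_integral_filter_of_dominated_convergence
      (fun p => (2 * C) ^ 2 * ‖(f : Heis n → ℂ) p‖ ^ 2) ?_ ?_ ?_ ?_
    · refine .of_forall fun ε => Continuous.aestronglyMeasurable ?_
      exact ((((contDiff_coe χ).continuous.comp (dil ε).continuous).sub continuous_const).mul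
        (contDiff_coe f).continuous).norm.pow 2
    · refine .of_forall fun ε => .of_forall fun p => ?_
      rw [norm_pow, norm_norm, norm_mul, mul_pow]
      gcongr
      exact (norm_sub_le _ _).trans (by linarith [hC (dil ε p), hC 0])
    · exact ((memLp_of_mem_Sch hf).integrable_norm_pow two_ne_zero).const_mul _
    · refine .of_forall fun p => ?_
      have hc : Continuous fun ε : ℝ => ‖((χ : Heis n → ℂ) (dil ε p) - (χ : Heis n → ℂ) 0) *
          (f : Heis n → ℂ) p‖ ^ 2 := by
        have : Continuous fun ε : ℝ => dil ε p := by simp only [dil_apply]; fun_prop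
        exact ((((contDiff_coe χ).continuous.comp this).sub continuous_const).mul
          continuous_const).norm.pow 2
      have := hc.tendsto 0
      simp only [dil_zero_left, sub_self, zero_mul, norm_zero] at this
      rw [zero_pow two_ne_zero] at this
      exact this.mono_left nhdsWithin_le_nhds
  rw [integral_zero] at h2
  have h3 := (h2.congr' h1).sqrt
  simpa using h3

/-- The differential operators which commute with cutoffs in the limit. -/
structure IsCutoffOp (P : Module.End ℂ (Smooth n)) : Prop where
  mem_Sch : ∀ f ∈ Sch n, P f ∈ Sch n
  tendsto : ∀ χ ∈ Test n, ∀ f ∈ Sch n,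
    Tendsto (fun ε : ℝ => cls (P (mulS (dilS ε χ) f))) (𝓝[>] 0)
      (𝓝 ((χ : Heis n → ℂ) 0 • cls (P f)))

theorem IsCutoffOp.one : IsCutoffOp (1 : Module.End ℂ (Smooth n)) :=
  ⟨fun _ hf => hf, fun _ hχ _ hf => tendsto_cls_cutoff hχ hf⟩

theorem IsCutoffOp.add {P P' : Module.End ℂ (Smooth n)} (h : IsCutoffOp P) (h' : IsCutoffOp P') :
    IsCutoffOp (P + P') := by
  refine ⟨fun f hf => add_mem (h.mem_Sch f hf) (h'.mem_Sch f hf), fun χ hχ f hf => ?_⟩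
  rw [LinearMap.add_apply, cls_add (h.mem_Sch f hf) (h'.mem_Sch f hf), smul_add]
  refine ((h.tendsto χ hχ f hf).add (h'.tendsto χ hχ f hf)).congr' ?_
  filter_upwards [self_mem_nhdsWithin] with ε hε
  have h2 : mulS (dilS ε χ) f ∈ Sch n :=
    Test_le_Sch (mulS_mem_Test_left f (dilS_mem_Test (ne_of_gt hε) hχ))
  rw [LinearMap.add_apply, cls_add (h.mem_Sch _ h2) (h'.mem_Sch _ h2)]

theorem IsCutoffOp.smul (c : ℂ) {P : Module.End ℂ (Smooth n)} (h : IsCutoffOp P) :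
    IsCutoffOp (c • P) := by
  refine ⟨fun f hf => Submodule.smul_mem _ c (h.mem_Sch f hf), fun χ hχ f hf => ?_⟩
  rw [LinearMap.smul_apply, cls_smul _ (h.mem_Sch f hf), smul_comm]
  refine ((h.tendsto χ hχ f hf).const_smul c).congr' ?_
  filter_upwards [self_mem_nhdsWithin] with ε hε
  have h2 : mulS (dilS ε χ) f ∈ Sch n :=
    Test_le_Sch (mulS_mem_Test_left f (dilS_mem_Test (ne_of_gt hε) hχ))
  rw [LinearMap.smul_apply, cls_smul _ (h.mem_Sch _ h2)]

/-- In the Leibniz rule the derivative of the cutoff is ε times the dilate of `V i χ`, again a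
dilated test function; the factor ε removes this term in the limit. -/
theorem IsCutoffOp.mul_V {P : Module.End ℂ (Smooth n)} (h : IsCutoffOp P) (i : Fin n ⊕ Fin n) :
    IsCutoffOp (P * V i) := by
  refine ⟨fun f hf => h.mem_Sch _ (V_mem_Sch i hf), fun χ hχ f hf => ?_⟩
  have h1 := h.tendsto χ hχ _ (V_mem_Sch i hf)
  have h2 := h.tendsto _ (V_mem_Test i hχ) f hf
  have h3 : Tendsto (fun ε : ℝ => (ε : ℂ)) (𝓝[>] 0) (𝓝 0) :=
    (Complex.continuous_ofReal.tendsto' 0 0 (by simp)).mono_left nhdsWithin_le_nhds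
  have h4 := (h3.smul h2).add h1
  rw [zero_smul, zero_add] at h4
  refine h4.congr' ?_
  filter_upwards [self_mem_nhdsWithin] with ε hε
  have m1 : mulS (dilS ε (V i χ)) f ∈ Sch n :=
    Test_le_Sch (mulS_mem_Test_left f (dilS_mem_Test (ne_of_gt hε) (V_mem_Test i hχ)))
  have m2 : mulS (dilS ε χ) (V i f) ∈ Sch n :=
    Test_le_Sch (mulS_mem_Test_left _ (dilS_mem_Test (ne_of_gt hε) hχ))
  have e : mulS ((ε : ℂ) • dilS ε (V i χ)) f = (ε : ℂ) • mulS (dilS ε (V i χ)) f := by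
    ext p; simp [mul_assoc]
  rw [Module.End.mul_apply, V_mulS, V_dilS, e, map_add, map_smul, cls_add
    (Submodule.smul_mem _ _ (h.mem_Sch _ m1)) (h.mem_Sch _ m2), cls_smul _ (h.mem_Sch _ m1)]

theorem IsCutoffOp.sum {ι : Type*} (s : Finset ι) {P : ι → Module.End ℂ (Smooth n)}
    (h : ∀ i, IsCutoffOp (P i)) : IsCutoffOp (∑ i ∈ s, P i) := by
  classical
  induction s using Finset.induction_on with
  | empty =>
    have := IsCutoffOp.smul 0 (IsCutoffOp.one (n := n))
    rw [zero_smul] at this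
    simpa using this
  | insert a s ha ih => rw [Finset.sum_insert ha]; exact (h a).add ih

theorem IsCutoffOp.mul_sublaplacian {P : Module.End ℂ (Smooth n)} (h : IsCutoffOp P) :
    IsCutoffOp (P * sublaplacian n) := by
  have : P * sublaplacian n = (-1 : ℂ) • ∑ i, P * V i * V i := by
    ext1 f
    rw [LinearMap.smul_apply, LinearMap.sum_apply, neg_one_smul, Module.End.mul_apply,
      sublaplacian_apply, map_neg, map_sum]
    rfl
  rw [this]
  exact (IsCutoffOp.sum _ fun i => (h.mul_V i).mul_V i).smul _

/-- The operator `I + ℒ` on smooth functions. -/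
def shifted (n : ℕ) : Module.End ℂ (Smooth n) := 1 + sublaplacian n

theorem shifted_apply (f : Smooth n) : shifted n f = f + sublaplacian n f := rfl

theorem shifted_pow_succ_apply (m : ℕ) (f : Smooth n) :
    (shifted n ^ (m + 1)) f = (shifted n ^ m) (shifted n f) := by
  rw [pow_succ]; rfl

theorem shifted_mem_Test {f : Smooth n} (hf : f ∈ Test n) : shifted n f ∈ Test n :=
  add_mem hf (sublaplacian_mem_Test hf)

theorem shifted_mem_Sch {f : Smooth n} (hf : f ∈ Sch n) : shifted n f ∈ Sch n :=
  add_mem hf (sublaplacian_mem_Sch hf)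

theorem shifted_pow_mem_Test (m : ℕ) {f : Smooth n} (hf : f ∈ Test n) :
    (shifted n ^ m) f ∈ Test n := by
  induction m generalizing f with
  | zero => exact hf
  | succ m ih => rw [shifted_pow_succ_apply]; exact ih (shifted_mem_Test hf)

theorem shifted_pow_mem_Sch (m : ℕ) {f : Smooth n} (hf : f ∈ Sch n) :
    (shifted n ^ m) f ∈ Sch n := by
  induction m generalizing f with
  | zero => exact hf
  | succ m ih => rw [shifted_pow_succ_apply]; exact ih (shifted_mem_Sch hf)

theorem isCutoffOp_shifted_pow (m : ℕ) : IsCutoffOp (shifted n ^ m) := by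
  induction m with
  | zero => exact IsCutoffOp.one
  | succ m ih =>
    rw [pow_succ, shifted, mul_add, mul_one]
    exact ih.add ih.mul_sublaplacian

/-- Equality with 1 on a neighbourhood, and not merely at the origin, is what later makes φ - η(δ_r
·)φ vanish to infinite order there. -/
theorem exists_cutoff (n : ℕ) : ∃ χ ∈ Test n, (χ : Heis n → ℂ) =ᶠ[𝓝 0] 1 := by
  let b : ContDiffBump (0 : Heis n) := ⟨1, 2, one_pos, one_lt_two⟩
  refine ⟨⟨fun p => (b p : ℂ), Complex.ofRealCLM.contDiff.comp b.contDiff⟩,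
    b.hasCompactSupport.comp_left (g := fun x : ℝ => (x : ℂ)) Complex.ofReal_zero, ?_⟩
  filter_upwards [b.eventuallyEq_one] with p hp
  simp [hp]

/-! ### The resolvent on smooth functions -/

/-- The horizontal jet of a smooth function. -/
def jet (f : Smooth n) : JetSpace n :=
  WithLp.toLp 2 fun i => i.elim (cls f) fun k => cls (V k f)

theorem jet_mem_testJets {f : Smooth n} (hf : f ∈ Test n) : jet f ∈ testJets n :=
  ⟨f, hf, coeFn_cls (memLp_of_mem_Test hf),
    fun j => coeFn_cls (memLp_of_mem_Test (V_mem_Test (Sum.inl j) hf)),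
    fun j => coeFn_cls (memLp_of_mem_Test (V_mem_Test (Sum.inr j) hf))⟩

theorem eq_jet_of_mem_testJets {u : JetSpace n} (hu : u ∈ testJets n) :
    ∃ f ∈ Test n, u = jet f := by
  obtain ⟨f, hf, h0, hX, hY⟩ := hu
  refine ⟨f, hf, ?_⟩
  ext1 i
  rcases i with _ | j | j
  · exact Lp.ext (h0.trans (coeFn_cls (memLp_of_mem_Test hf)).symm)
  · exact Lp.ext ((hX j).trans
      (coeFn_cls (memLp_of_mem_Test (V_mem_Test (Sum.inl j) hf))).symm)
  · exact Lp.ext ((hY j).trans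
      (coeFn_cls (memLp_of_mem_Test (V_mem_Test (Sum.inr j) hf))).symm)

/-- Cutoffs with ε → 0 approximate every component of the jet, so compact support is not needed for
membership in the closure. -/
theorem jet_mem_formDomain {f : Smooth n} (hf : f ∈ Sch n) : jet f ∈ formDomain n := by
  obtain ⟨χ, hχ, hχ1⟩ := exists_cutoff n
  have h1 : (χ : Heis n → ℂ) 0 = 1 := hχ1.self_of_nhds
  have h : Tendsto (fun ε : ℝ => jet (mulS (dilS ε χ) f)) (𝓝[>] 0) (𝓝 (jet f)) := by
    refine ((PiLp.continuous_toLp 2 _).tendsto _).comp (tendsto_pi_nhds.2 fun i => ?_)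
    cases i with
    | none => simpa [h1] using tendsto_cls_cutoff hχ hf
    | some i =>
      have := (IsCutoffOp.one.mul_V i).tendsto χ hχ f hf
      simpa [h1] using this
  refine mem_closure_of_tendsto h ?_
  filter_upwards [self_mem_nhdsWithin] with ε hε
  exact jet_mem_testJets (mulS_mem_Test_left f (dilS_mem_Test (ne_of_gt hε) hχ))

/-- Integration by parts against a test function says that `jet f` differs from the adjoint image of
`cls (shifted n f)` by a vector orthogonal to the test jets; hence `jet f` is the projection that
defines the resolvent. -/
theorem resolvent_shifted {f : Smooth n} (hf : f ∈ Sch n) :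
    resolvent n (cls (shifted n f)) = cls f := by
  have key : (formDomain n).starProjection
      (ContinuousLinearMap.adjoint (jetProj n) (cls (shifted n f))) = jet f := by
    refine Submodule.eq_starProjection_of_mem_orthogonal (jet_mem_formDomain hf) ?_
    rw [formDomain, Submodule.orthogonal_closure]
    intro u hu
    obtain ⟨φ, hφ, rfl⟩ := eq_jet_of_mem_testJets hu
    rw [inner_sub_right, ContinuousLinearMap.adjoint_inner_right, sub_eq_zero, shifted_apply,
      cls_add hf (sublaplacian_mem_Sch hf), inner_add_right, PiLp.inner_apply,
      Fintype.sum_option]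
    change ⟪cls φ, cls f⟫_ℂ + ⟪cls φ, cls (sublaplacian n f)⟫_ℂ = _
    rw [inner_cls_sublaplacian hφ hf]
    rfl
  simp only [resolvent, ContinuousLinearMap.comp_apply]
  rw [key]
  rfl

theorem resolvent_pow_shifted_pow (m : ℕ) {f : Smooth n} (hf : f ∈ Sch n) :
    (resolvent n ^ m) (cls ((shifted n ^ m) f)) = cls f := by
  induction m generalizing f with
  | zero => rfl
  | succ m ih =>
    rw [shifted_pow_succ_apply, pow_succ', mul_apply_eq_comp,
      ih (shifted_mem_Sch hf), resolvent_shifted hf]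

/-! ### Bounds for the derivatives of test functions -/

theorem norm_jetProj_apply_le (u : JetSpace n) : ‖jetProj n u‖ ≤ ‖u‖ :=
  PiLp.norm_apply_le u none

theorem norm_resolvent_apply_le (f : L2 n) : ‖resolvent n f‖ ≤ ‖f‖ := by
  have h1 : ‖jetProj n‖ ≤ 1 :=
    ContinuousLinearMap.opNorm_le_bound _ zero_le_one fun u => by
      rw [one_mul]; exact norm_jetProj_apply_le u
  have h2 : ‖ContinuousLinearMap.adjoint (jetProj n) f‖ ≤ ‖f‖ := by
    refine (ContinuousLinearMap.le_opNorm _ _).trans ?_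
    rw [LinearIsometryEquiv.norm_map]
    exact mul_le_of_le_one_left (norm_nonneg _) h1
  exact (norm_jetProj_apply_le _).trans
    (((formDomain n).norm_starProjection_apply_le _).trans h2)

theorem norm_cls_le_shifted {f : Smooth n} (hf : f ∈ Sch n) : ‖cls f‖ ≤ ‖cls (shifted n f)‖ := by
  conv_lhs => rw [← resolvent_shifted hf]
  exact norm_resolvent_apply_le _

theorem norm_cls_sublaplacian_le {f : Smooth n} (hf : f ∈ Sch n) :
    ‖cls (sublaplacian n f)‖ ≤ 2 * ‖cls (shifted n f)‖ := by
  have h : sublaplacian n f = shifted n f - f := by rw [shifted_apply]; abel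
  rw [h, cls_sub (shifted_mem_Sch hf) hf]
  exact (norm_sub_le _ _).trans (by linarith [norm_cls_le_shifted hf])

theorem norm_cls_shifted_pow_mono {f : Smooth n} (hf : f ∈ Sch n) {m k : ℕ} (h : m ≤ k) :
    ‖cls ((shifted n ^ m) f)‖ ≤ ‖cls ((shifted n ^ k) f)‖ := by
  induction h with
  | refl => exact le_rfl
  | @step k _ ih =>
    refine ih.trans ?_
    rw [Nat.succ_eq_add_one, pow_succ']
    exact norm_cls_le_shifted (shifted_pow_mem_Sch k hf)

/-- The square root of the quadratic form of the sublaplacian. -/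
def hnorm (f : Smooth n) : ℝ := √(∑ i, ‖cls (V i f)‖ ^ 2)

theorem hnorm_nonneg (f : Smooth n) : 0 ≤ hnorm f := Real.sqrt_nonneg _

theorem norm_cls_V_le_hnorm (i : Fin n ⊕ Fin n) (f : Smooth n) : ‖cls (V i f)‖ ≤ hnorm f := by
  refine Real.le_sqrt_of_sq_le ?_
  exact Finset.single_le_sum (f := fun i => ‖cls (V i f)‖ ^ 2) (fun i _ => by positivity)
    (Finset.mem_univ i)

theorem hnorm_sq {f : Smooth n} (hf : f ∈ Test n) :
    ((hnorm f ^ 2 : ℝ) : ℂ) = ⟪cls f, cls (sublaplacian n f)⟫_ℂ := by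
  rw [inner_cls_sublaplacian hf (Test_le_Sch hf), hnorm, Real.sq_sqrt (by positivity)]
  push_cast
  exact Finset.sum_congr rfl fun i _ => (inner_self_eq_norm_sq_to_K (𝕜 := ℂ) (cls (V i f))).symm

theorem hnorm_sq_le {f : Smooth n} (hf : f ∈ Test n) :
    hnorm f ^ 2 ≤ ‖cls f‖ * ‖cls (sublaplacian n f)‖ := by
  have h := norm_inner_le_norm (𝕜 := ℂ) (cls f) (cls (sublaplacian n f))
  rwa [← hnorm_sq hf, Complex.norm_real, Real.norm_of_nonneg (by positivity)] at h

theorem hnorm_le {f : Smooth n} (hf : f ∈ Test n) : hnorm f ≤ 2 * ‖cls (shifted n f)‖ := by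
  refine le_of_sq_le_sq ?_ (by positivity)
  have h1 := norm_cls_le_shifted (Test_le_Sch hf)
  have h2 := norm_cls_sublaplacian_le (Test_le_Sch hf)
  calc hnorm f ^ 2 ≤ ‖cls f‖ * ‖cls (sublaplacian n f)‖ := hnorm_sq_le hf
    _ ≤ ‖cls (shifted n f)‖ * (2 * ‖cls (shifted n f)‖) := by gcongr
    _ ≤ _ := by nlinarith [norm_nonneg (cls (shifted n f))]

/-- `T` is a commutator of two horizontal fields; in each of the two products one field is moved to
`g` by parts. -/
theorem norm_inner_T_le (hn : 1 ≤ n) {f g : Smooth n} (hf : f ∈ Test n) (hg : g ∈ Test n) :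
    ‖⟪cls g, cls (T n f)⟫_ℂ‖ ≤ 2 * (hnorm g * hnorm f) := by
  let j : Fin n := ⟨0, hn⟩
  have hf' := Test_le_Sch hf
  rw [T_eq j, ← V_inl, ← V_inr, cls_sub (V_mem_Sch (.inr j) (V_mem_Sch (.inl j) hf'))
    (V_mem_Sch (.inl j) (V_mem_Sch (.inr j) hf')), inner_sub_right]
  have h1 := inner_cls_V (.inr j) hg (V_mem_Sch (.inl j) hf')
  have h2 := inner_cls_V (.inl j) hg (V_mem_Sch (.inr j) hf')
  rw [h1, h2]
  have b : ∀ i k : Fin n ⊕ Fin n, ‖⟪cls (V i g), cls (V k f)⟫_ℂ‖ ≤ hnorm g * hnorm f := fun i k =>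
    (norm_inner_le_norm _ _).trans (mul_le_mul (norm_cls_V_le_hnorm i g)
      (norm_cls_V_le_hnorm k f) (norm_nonneg _) (hnorm_nonneg _))
  refine (norm_sub_le _ _).trans ?_
  rw [norm_neg, norm_neg]
  linarith [b (.inr j) (.inl j), b (.inl j) (.inr j)]

/-- Since `T` commutes with ℒ, `norm_inner_T_le` for the pair ℒf, Tf bounds the square of `hnorm (T
n f)` by twice its product with `hnorm (sublaplacian n f)`; one factor cancels. -/
theorem hnorm_T_le (hn : 1 ≤ n) {f : Smooth n} (hf : f ∈ Test n) :
    hnorm (T n f) ≤ 2 * hnorm (sublaplacian n f) := by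
  have h := norm_inner_T_le hn (sublaplacian_mem_Test hf) (T_mem_Test hf)
  rw [← sublaplacian_T, ← hnorm_sq (T_mem_Test hf), Complex.norm_real,
    Real.norm_of_nonneg (by positivity)] at h
  by_contra! hc
  have := hnorm_nonneg (sublaplacian n f)
  nlinarith [hnorm_nonneg (T n f)]

theorem norm_cls_T_le (hn : 1 ≤ n) {f : Smooth n} (hf : f ∈ Test n) :
    ‖cls (T n f)‖ ≤ 6 * ‖cls ((shifted n ^ 2) f)‖ := by
  have h := norm_inner_T_le hn hf (T_mem_Test hf)
  rw [inner_self_eq_norm_sq_to_K, norm_pow, RCLike.norm_ofReal, abs_of_nonneg (norm_nonneg _)] at h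
  have h1 := hnorm_T_le hn hf
  have h2 := hnorm_le hf
  have h3 := hnorm_le (sublaplacian_mem_Test hf)
  have h4 : shifted n (sublaplacian n f) = sublaplacian n (shifted n f) := by
    rw [shifted_apply, shifted_apply, map_add]
  rw [h4] at h3
  have h5 := norm_cls_sublaplacian_le (shifted_mem_Sch (Test_le_Sch hf))
  have h6 := norm_cls_le_shifted (shifted_mem_Sch (Test_le_Sch hf))
  have e : (shifted n ^ 2) f = shifted n (shifted n f) := by rw [pow_two]; rfl
  rw [e]
  set A := ‖cls (shifted n (shifted n f))‖
  have hA : 0 ≤ A := norm_nonneg _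
  refine le_of_sq_le_sq ?_ (by positivity)
  -- The factors are bounded by 8A and 2A; the resulting 32 A² is rounded up to (6A)².
  calc ‖cls (T n f)‖ ^ 2 ≤ 2 * (hnorm (T n f) * hnorm f) := h
    _ ≤ 2 * ((8 * A) * (2 * A)) := by
      gcongr
      · exact hnorm_nonneg _
      · linarith
      · linarith
    _ ≤ _ := by nlinarith

/-- The operators which are bounded, on test functions, by a power of `I + ℒ`. -/
structure IsBdd (P : Module.End ℂ (Smooth n)) : Prop where
  mem_Test : ∀ f ∈ Test n, P f ∈ Test n
  bound : ∃ (m : ℕ) (C : ℝ), 0 ≤ C ∧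
    ∀ f ∈ Test n, ‖cls (P f)‖ ≤ C * ‖cls ((shifted n ^ m) f)‖

namespace IsBdd

variable {P P' : Module.End ℂ (Smooth n)}

theorem one : IsBdd (1 : Module.End ℂ (Smooth n)) :=
  ⟨fun _ hf => hf, 0, 1, zero_le_one, fun f _ => by simp⟩

theorem add (h : IsBdd P) (h' : IsBdd P') : IsBdd (P + P') := by
  refine ⟨fun f hf => add_mem (h.mem_Test f hf) (h'.mem_Test f hf), ?_⟩
  obtain ⟨m, C, hC, hb⟩ := h.bound
  obtain ⟨m', C', hC', hb'⟩ := h'.bound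
  refine ⟨max m m', C + C', by positivity, fun f hf => ?_⟩
  rw [LinearMap.add_apply, cls_add (Test_le_Sch (h.mem_Test f hf)) (Test_le_Sch (h'.mem_Test f hf)),
    add_mul]
  refine (norm_add_le _ _).trans (add_le_add ((hb f hf).trans ?_) ((hb' f hf).trans ?_))
  · gcongr
    exact norm_cls_shifted_pow_mono (Test_le_Sch hf) (le_max_left _ _)
  · gcongr
    exact norm_cls_shifted_pow_mono (Test_le_Sch hf) (le_max_right _ _)

theorem smul (c : ℂ) (h : IsBdd P) : IsBdd (c • P) := by
  refine ⟨fun f hf => Submodule.smul_mem _ c (h.mem_Test f hf), ?_⟩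
  obtain ⟨m, C, hC, hb⟩ := h.bound
  refine ⟨m, ‖c‖ * C, by positivity, fun f hf => ?_⟩
  rw [LinearMap.smul_apply, cls_smul _ (Test_le_Sch (h.mem_Test f hf)), norm_smul, mul_assoc]
  gcongr
  exact hb f hf

theorem mul_sublaplacian (h : IsBdd P) : IsBdd (P * sublaplacian n) := by
  refine ⟨fun f hf => h.mem_Test _ (sublaplacian_mem_Test hf), ?_⟩
  obtain ⟨m, C, hC, hb⟩ := h.bound
  refine ⟨m + 1, C * 2, by positivity, fun f hf => ?_⟩
  refine (hb _ (sublaplacian_mem_Test hf)).trans ?_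
  have e : (shifted n ^ m) (sublaplacian n f) = sublaplacian n ((shifted n ^ m) f) := by
    have : Commute (shifted n) (sublaplacian n) := (Commute.one_left _).add_left (Commute.refl _)
    exact LinearMap.congr_fun (this.pow_left m).eq f
  rw [e, mul_assoc, pow_succ']
  gcongr
  exact norm_cls_sublaplacian_le (shifted_pow_mem_Sch m (Test_le_Sch hf))

theorem mul_T (hn : 1 ≤ n) (h : IsBdd P) : IsBdd (P * T n) := by
  refine ⟨fun f hf => h.mem_Test _ (T_mem_Test hf), ?_⟩
  obtain ⟨m, C, hC, hb⟩ := h.bound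
  refine ⟨2 + m, C * 6, by positivity, fun f hf => ?_⟩
  refine (hb _ (T_mem_Test hf)).trans ?_
  have e : (shifted n ^ m) (T n f) = T n ((shifted n ^ m) f) := by
    have h : Commute (sublaplacian n) (T n) := LinearMap.ext sublaplacian_T
    have : Commute (shifted n) (T n) := (Commute.one_left _).add_left h
    exact LinearMap.congr_fun (this.pow_left m).eq f
  rw [e, mul_assoc, pow_add]
  gcongr
  exact norm_cls_T_le hn (shifted_pow_mem_Test m hf)

/-- By the quadratic form, ‖V_i P f‖² ≤ ‖P f‖ ‖ℒ P f‖, so bounds for P and ℒP suffice. -/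
theorem V_mul (h : IsBdd P) (h' : IsBdd (sublaplacian n * P)) (i : Fin n ⊕ Fin n) :
    IsBdd (V i * P) := by
  refine ⟨fun f hf => V_mem_Test i (h.mem_Test f hf), ?_⟩
  obtain ⟨m, C, hC, hb⟩ := h.bound
  obtain ⟨m', C', hC', hb'⟩ := h'.bound
  refine ⟨max m m', max C C', by positivity, fun f hf => ?_⟩
  refine le_of_sq_le_sq ?_ (by positivity)
  have h1 := hnorm_sq_le (h.mem_Test f hf)
  have h2 := norm_cls_V_le_hnorm i (P f)
  have b1 : ‖cls (P f)‖ ≤ max C C' * ‖cls ((shifted n ^ max m m') f)‖ :=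
    (hb f hf).trans (mul_le_mul (le_max_left _ _)
      (norm_cls_shifted_pow_mono (Test_le_Sch hf) (le_max_left _ _)) (norm_nonneg _)
      (by positivity))
  have b2 : ‖cls (sublaplacian n (P f))‖ ≤ max C C' * ‖cls ((shifted n ^ max m m') f)‖ :=
    (hb' f hf).trans (mul_le_mul (le_max_right _ _)
      (norm_cls_shifted_pow_mono (Test_le_Sch hf) (le_max_right _ _)) (norm_nonneg _)
      (by positivity))
  calc ‖cls (V i (P f))‖ ^ 2 ≤ hnorm (P f) ^ 2 := by gcongr
    _ ≤ _ := h1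
    _ ≤ _ := by rw [pow_two]; gcongr

end IsBdd

/-- The span of the compositions of `k` horizontal fields. -/
def wordSpan (n k : ℕ) : Submodule ℂ (Module.End ℂ (Smooth n)) :=
  Submodule.span ℂ {P | ∃ l : List (Fin n ⊕ Fin n), l.length = k ∧ P = wordOp l}

theorem wordOp_mem_wordSpan (l : List (Fin n ⊕ Fin n)) : wordOp l ∈ wordSpan n l.length :=
  Submodule.subset_span ⟨l, rfl, rfl⟩

theorem V_mul_mem_wordSpan (i : Fin n ⊕ Fin n) {k : ℕ} {P : Module.End ℂ (Smooth n)}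
    (hP : P ∈ wordSpan n k) : V i * P ∈ wordSpan n (k + 1) := by
  induction hP using Submodule.span_induction with
  | mem P h =>
    obtain ⟨l, rfl, rfl⟩ := h
    rw [← wordOp_cons]
    exact wordOp_mem_wordSpan (i :: l)
  | zero => rw [mul_zero]; exact zero_mem _
  | add P P' _ _ h h' => rw [mul_add]; exact add_mem h h'
  | smul c P _ h => rw [mul_smul_comm]; exact Submodule.smul_mem _ c h

theorem wordOp_T_comm (l : List (Fin n ⊕ Fin n)) : wordOp l * T n = T n * wordOp l := by
  induction l with
  | nil => simp
  | cons i l ih => rw [wordOp_cons, mul_assoc, ih, ← mul_assoc, V_T_comm, mul_assoc]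

/-- Each commutator replaces one letter by its conjugate and gains a factor `T`. The words in the
error keep their length, as the induction on length in `isBdd_of_mem_wordSpan` requires. -/
theorem sublaplacian_mul_wordOp (l : List (Fin n ⊕ Fin n)) :
    ∃ P ∈ wordSpan n l.length,
      sublaplacian n * wordOp l = wordOp l * sublaplacian n + P * T n := by
  induction l with
  | nil => exact ⟨0, zero_mem _, by simp⟩
  | cons i l ih =>
    obtain ⟨P, hP, h⟩ := ih
    obtain ⟨c, hc⟩ := exists_sublaplacian_V i
    have hc' : sublaplacian n * V i = V i * sublaplacian n + c • (V i.swap * T n) :=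
      LinearMap.ext hc
    refine ⟨V i * P + c • (V i.swap * wordOp l), add_mem (V_mul_mem_wordSpan i hP)
      (Submodule.smul_mem _ c (V_mul_mem_wordSpan _ (wordOp_mem_wordSpan l))), ?_⟩
    rw [wordOp_cons, ← mul_assoc, hc', add_mul, mul_assoc, h, smul_mul_assoc, mul_assoc (V i.swap),
      ← wordOp_T_comm, mul_add, add_mul, smul_mul_assoc, mul_assoc, mul_assoc, mul_assoc, add_assoc]

/-- To prefix a letter to a word `l`, `IsBdd.V_mul` asks for a bound on ℒ `wordOp l`. Commuting ℒ to
the right leaves `wordOp l` ℒ and P T, where P is a combination of words of the same length as `l`,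
covered by the induction hypothesis. -/
theorem isBdd_of_mem_wordSpan (hn : 1 ≤ n) (k : ℕ) {P : Module.End ℂ (Smooth n)}
    (hP : P ∈ wordSpan n k) : IsBdd P := by
  induction k generalizing P with
  | zero =>
    induction hP using Submodule.span_induction with
    | mem P h =>
      obtain ⟨l, hl, rfl⟩ := h
      rw [List.length_eq_zero_iff.1 hl]
      exact IsBdd.one
    | zero => simpa using IsBdd.one.smul (n := n) 0
    | add P P' _ _ h h' => exact h.add h'
    | smul c P _ h => exact h.smul c
  | succ k ih =>
    induction hP using Submodule.span_induction with
    | mem P h =>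
      obtain ⟨l, hl, rfl⟩ := h
      obtain ⟨i, l, rfl⟩ := List.exists_cons_of_length_eq_add_one hl
      have hl' : l.length = k := by simpa using hl
      rw [wordOp_cons]
      obtain ⟨P, hP, h⟩ := sublaplacian_mul_wordOp l
      have hw := ih (hl' ▸ wordOp_mem_wordSpan l)
      refine hw.V_mul ?_ i
      rw [h]
      exact hw.mul_sublaplacian.add ((ih (hl' ▸ hP)).mul_T hn)
    | zero => simpa using IsBdd.one.smul (n := n) 0
    | add P P' _ _ h h' => exact h.add h'
    | smul c P _ h => exact h.smul c

theorem isBdd_wordOp (hn : 1 ≤ n) (l : List (Fin n ⊕ Fin n)) : IsBdd (wordOp l) :=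
  isBdd_of_mem_wordSpan hn _ (wordOp_mem_wordSpan l)

end Heisenberg
end

noncomputable section

open Filter Topology in
/-- The fundamental theorem of calculus in several variables: a function with compact support is
bounded by the iterated integral of its mixed partial derivative. -/
theorem enorm_le_lmarginal_mixedDeriv {ι : Type*} [Fintype ι] [DecidableEq ι] (l : List ι)
    (hl : l.Nodup) (G : (ι → ℝ) → ℂ) (hG : ContDiff ℝ ∞ G) (hc : HasCompactSupport G) (x : ι → ℝ) :
    ‖G x‖ₑ ≤ (∫⋯∫⁻_l.toFinset, (fun y => ‖l.foldl (fun H i y => fderiv ℝ H y (Pi.single i 1)) G y‖ₑ)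
      ∂fun _ => volume) x := by
  induction l generalizing G x with
  | nil => simp
  | cons i l ih =>
    have hl' := List.nodup_cons.1 hl
    set H : (ι → ℝ) → ℂ := fun y => fderiv ℝ G y (Pi.single i 1)
    have hH : ContDiff ℝ ∞ H := (hG.fderiv_right (m := ∞) (by simp)).clm_apply contDiff_const
    have hHc : HasCompactSupport H := hc.fderiv_apply (𝕜 := ℝ) _
    have hmeas : ∀ (l : List ι) (K : (ι → ℝ) → ℂ), ContDiff ℝ ∞ K → ContDiff ℝ ∞
        (l.foldl (fun H i y => fderiv ℝ H y (Pi.single i 1)) K) := by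
      intro l
      induction l with
      | nil => exact fun K hK => hK
      | cons j l ih =>
        exact fun K hK => ih _ ((hK.fderiv_right (m := ∞) (by simp)).clm_apply contDiff_const)
    rw [List.toFinset_cons, lmarginal_insert _ _ (by simpa using hl'.1), List.foldl_cons]
    -- The fundamental theorem of calculus in the i-th variable alone; the other variables are left
    -- to the induction hypothesis for the partial derivative `H`.
    · calc ‖G x‖ₑ ≤ ∫⁻ t in Set.Iic (x i), ‖deriv (G ∘ Function.update x i) t‖ₑ := by
            refine le_trans (by simp) (HasCompactSupport.enorm_le_lintegral_Ici_deriv ?_ ?_ (x i))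
            · exact (hG.of_le (by simp)).comp (by convert! contDiff_update 1 x i)
            · exact hc.comp_isClosedEmbedding (isClosedEmbedding_update x i)
        _ ≤ ∫⁻ t, ‖deriv (G ∘ Function.update x i) t‖ₑ := setLIntegral_le_lintegral _ _
        _ = ∫⁻ t, ‖H (Function.update x i t)‖ₑ := by
            refine lintegral_congr fun t => ?_
            rw [fderiv_comp_deriv _ (hG.differentiable (by simp)).differentiableAt
              (hasDerivAt_update x i t).differentiableAt, deriv_update]
        _ ≤ _ := lintegral_mono fun t => ih hl'.2 H hH hHc _
    · exact (hmeas l _ hH).continuous.enorm.measurable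

namespace Heisenberg

open Filter Topology

variable {n : ℕ}

/-! ### The Sobolev inequality at the origin -/

theorem foldl_D_mem_Test (ws : List (Heis n)) {f : Smooth n} (hf : f ∈ Test n) :
    ws.foldl (fun g w => D w g) f ∈ Test n := by
  induction ws generalizing f with
  | nil => exact hf
  | cons w ws ih => exact ih (fieldOp_mem_Test _ _ hf)

/-- The inequality on ℝ^d is carried over by linear coordinates: `ws` lists the coordinate
directions once each, and the constant compares the transported Lebesgue measure with `volume`. -/
theorem exists_norm_le_integral_mixedDeriv (n : ℕ) :
    ∃ (ws : List (Heis n)) (C : ℝ), 0 ≤ C ∧ ∀ f ∈ Test n, ‖(f : Heis n → ℂ) 0‖ ≤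
      C * ∫ p, ‖(ws.foldl (fun g w => D w g) f : Smooth n).1 p‖ := by
  let d := Module.finrank ℝ (Heis n)
  let e : (Fin d → ℝ) ≃L[ℝ] Heis n :=
    (Module.finBasis ℝ (Heis n)).equivFunL.symm
  let ws : List (Heis n) := (List.finRange d).map fun i => e (Pi.single i 1)
  let μ : Measure (Heis n) := Measure.map e volume
  have hμ : μ = μ.addHaarScalarFactor volume • (volume : Measure (Heis n)) :=
    Measure.isAddLeftInvariant_eq_smul μ volume
  refine ⟨ws, μ.addHaarScalarFactor volume, NNReal.coe_nonneg _, fun f hf => ?_⟩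
  have key : ∀ (l : List (Fin d)) (f : Smooth n),
      l.foldl (fun H i y => fderiv ℝ H y (Pi.single i 1)) ((f : Heis n → ℂ) ∘ e) =
      ((l.map fun i => e (Pi.single i 1)).foldl (fun g w => D w g) f : Smooth n).1 ∘ e := by
    intro l
    induction l with
    | nil => exact fun f => rfl
    | cons i l ih =>
      intro f
      rw [List.foldl_cons, List.map_cons, List.foldl_cons, ← ih]
      congr 1
      ext y
      rw [fderiv_comp y (differentiableAt_coe f _) e.differentiableAt, e.fderiv]
      rfl
  have h1 := enorm_le_lmarginal_mixedDeriv (List.finRange d) (List.nodup_finRange d)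
    ((f : Heis n → ℂ) ∘ e) ((contDiff_coe f).comp e.contDiff)
    (HasCompactSupport.comp_homeomorph (f := (f : Heis n → ℂ)) hf e.toHomeomorph) 0
  have hu : (List.finRange d).toFinset = Finset.univ := by ext; simp
  rw [hu, lmarginal_univ, key] at h1
  set g : Smooth n := ws.foldl (fun g w => D w g) f
  have hg : g ∈ Test n := foldl_D_mem_Test ws hf
  have h2 : ‖(f : Heis n → ℂ) 0‖ₑ ≤ ∫⁻ p, ‖(g : Heis n → ℂ) p‖ₑ ∂μ := by
    rw [lintegral_map ((contDiff_coe g).continuous.enorm.measurable) e.continuous.measurable]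
    simpa [volume_pi] using h1
  have hi := integrable_of_mem_Test hg
  rw [hμ, lintegral_smul_measure, ← ofReal_integral_norm_eq_lintegral_enorm hi,
    ← ofReal_norm, ENNReal.smul_def, smul_eq_mul, ← ENNReal.ofReal_coe_nnreal,
    ← ENNReal.ofReal_mul (NNReal.coe_nonneg _)] at h2
  exact (ENNReal.ofReal_le_ofReal_iff (by positivity)).1 h2

/-- A constant field expanded in the left invariant frame. The coefficient of `T` contains the
unbounded linear function `symp w.1`, which is harmless once it multiplies a compactly supported
coefficient, as in `locSpan`. -/
theorem D_eq (w : Heis n) (g : Smooth n) :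
    D w g = (∑ j, ((w.1 j).re : ℂ) • X j g) + (∑ j, ((w.1 j).im : ℂ) • Y j g) +
      (w.2 : ℂ) • T n g + mulS (linS (symp w.1)) (T n g) := by
  ext p
  have hw : w = (∑ j, (w.1 j).re • hvec (Sum.inl j) p) + (∑ j, (w.1 j).im • hvec (Sum.inr j) p) +
      w.2 • (0, 1) + symp w.1 p.1 • (0, 1) := by
    ext k
    · simp [hvec, Prod.fst_sum, Finset.sum_apply, Pi.single_apply]
    · simp only [hvec, Sum.elim_inl, Sum.elim_inr, Prod.snd_add, Prod.snd_sum, Prod.smul_snd,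
        smul_eq_mul, symp_apply, mul_one]
      rw [add_right_comm, ← Finset.sum_add_distrib, ← Finset.sum_add_distrib,
        Finset.sum_eq_zero fun j _ => by ring, zero_add]
  have e1 : ∀ j, (((w.1 j).re : ℂ) • X j g : Smooth n).1 p =
      (w.1 j).re • fderiv ℝ (g : Heis n → ℂ) p (hvec (Sum.inl j) p) := fun j => by
    rw [Complex.real_smul]; rfl
  have e2 : ∀ j, (((w.1 j).im : ℂ) • Y j g : Smooth n).1 p =
      (w.1 j).im • fderiv ℝ (g : Heis n → ℂ) p (hvec (Sum.inr j) p) := fun j => by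
    rw [Complex.real_smul]; rfl
  rw [D_apply]
  conv_lhs => rw [hw]
  simp only [map_add, map_sum, map_smul]
  simp only [Submodule.coe_add, Pi.add_apply, AddSubmonoidClass.coe_finsetSum, Finset.sum_apply,
    mulS_apply, linS_apply, e1, e2, Complex.real_smul]
  rfl

theorem mulS_mulS (c b : Smooth n) : mulS c * mulS b = mulS (mulS c b) := by
  ext f p
  simp [mul_assoc]

/-- The differential operators with compactly supported coefficients. -/
def locSpan (n : ℕ) : Submodule ℂ (Module.End ℂ (Smooth n)) :=
  Submodule.span ℂ {P | ∃ c ∈ Test n, ∃ l, P = mulS c * wordOp l}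

theorem mulS_mul_wordOp_mem_locSpan {c : Smooth n} (hc : c ∈ Test n) (l : List (Fin n ⊕ Fin n)) :
    mulS c * wordOp l ∈ locSpan n := Submodule.subset_span ⟨c, hc, l, rfl⟩

theorem mulS_T_mul_wordOp_mem_locSpan (hn : 1 ≤ n) {c : Smooth n} (hc : c ∈ Test n)
    (l : List (Fin n ⊕ Fin n)) : mulS c * (T n * wordOp l) ∈ locSpan n := by
  let j : Fin n := ⟨0, hn⟩
  have h : mulS c * (T n * wordOp l) = mulS c * wordOp (Sum.inr j :: Sum.inl j :: l) +
      (-1 : ℂ) • (mulS c * wordOp (Sum.inl j :: Sum.inr j :: l)) := by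
    ext1 f
    simp only [Module.End.mul_apply, LinearMap.add_apply, LinearMap.smul_apply, wordOp_cons,
      T_eq j, V_inl, V_inr, map_sub]
    module
  rw [h]
  exact add_mem (mulS_mul_wordOp_mem_locSpan hc _)
    (Submodule.smul_mem _ _ (mulS_mul_wordOp_mem_locSpan hc _))

theorem D_mul_mem_locSpan (hn : 1 ≤ n) (w : Heis n) {P : Module.End ℂ (Smooth n)}
    (hP : P ∈ locSpan n) : D w * P ∈ locSpan n := by
  induction hP using Submodule.span_induction with
  | mem P h =>
    obtain ⟨c, hc, l, rfl⟩ := h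
    have e : D w * (mulS c * wordOp l) = mulS (D w c) * wordOp l +
        ((∑ j, ((w.1 j).re : ℂ) • (mulS c * wordOp (Sum.inl j :: l))) +
        (∑ j, ((w.1 j).im : ℂ) • (mulS c * wordOp (Sum.inr j :: l))) +
        (w.2 : ℂ) • (mulS c * (T n * wordOp l)) +
        mulS (mulS c (linS (symp w.1))) * (T n * wordOp l)) := by
      ext1 f
      have h1 := fieldOp_mulS (fun _ => w) contDiff_const c (wordOp l f)
      change D w (mulS c (wordOp l f)) = mulS (D w c) (wordOp l f) + mulS c (D w (wordOp l f)) at h1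
      simp only [Module.End.mul_apply, LinearMap.add_apply, LinearMap.smul_apply, wordOp_cons,
        LinearMap.sum_apply, V_inl, V_inr, h1, ← mulS_mulS]
      rw [D_eq w (wordOp l f)]
      simp only [map_add, map_sum, map_smul]
    rw [e]
    refine add_mem (mulS_mul_wordOp_mem_locSpan (fieldOp_mem_Test _ _ hc) l) (add_mem (add_mem
      (add_mem (sum_mem fun j _ => ?_) (sum_mem fun j _ => ?_)) ?_) ?_)
    · exact Submodule.smul_mem _ _ (mulS_mul_wordOp_mem_locSpan hc _)
    · exact Submodule.smul_mem _ _ (mulS_mul_wordOp_mem_locSpan hc _)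
    · exact Submodule.smul_mem _ _ (mulS_T_mul_wordOp_mem_locSpan hn hc l)
    · exact mulS_T_mul_wordOp_mem_locSpan hn (mulS_mem_Test_left _ hc) l
  | zero => rw [mul_zero]; exact zero_mem _
  | add P P' _ _ h h' => rw [mul_add]; exact add_mem h h'
  | smul c P _ h => rw [mul_smul_comm]; exact Submodule.smul_mem _ c h

theorem integral_norm_mulS_le {c g : Smooth n} (hc : c ∈ Test n) (hg : g ∈ Test n) :
    ∫ p, ‖(mulS c g : Heis n → ℂ) p‖ ≤ ‖cls c‖ * ‖cls g‖ := by
  have h := integral_mul_norm_le_Lp_mul_Lq (μ := (volume : Measure (Heis n)))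
    (p := 2) (q := 2) (f := (c : Heis n → ℂ)) (g := (g : Heis n → ℂ))
    (by constructor <;> norm_num) (by simpa using memLp_of_mem_Test hc)
    (by simpa using memLp_of_mem_Test hg)
  have e : ∀ f ∈ Test n, (∫ p, ‖(f : Heis n → ℂ) p‖ ^ (2 : ℝ)) ^ (1 / 2 : ℝ) = ‖cls f‖ := by
    intro f hf
    simp only [Real.rpow_two]
    rw [← norm_cls_sq (memLp_of_mem_Test hf), ← Real.sqrt_eq_rpow, Real.sqrt_sq (norm_nonneg _)]
  rw [e c hc, e g hg] at h
  simpa only [mulS_apply, norm_mul] using h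

theorem exists_bound_of_mem_locSpan (hn : 1 ≤ n) {P : Module.End ℂ (Smooth n)}
    (hP : P ∈ locSpan n) : (∀ f ∈ Test n, P f ∈ Test n) ∧ ∃ (m : ℕ) (C : ℝ), 0 ≤ C ∧
      ∀ f ∈ Test n, ∫ p, ‖(P f : Heis n → ℂ) p‖ ≤ C * ‖cls ((shifted n ^ m) f)‖ := by
  induction hP using Submodule.span_induction with
  | mem P h =>
    obtain ⟨c, hc, l, rfl⟩ := h
    have hw := isBdd_wordOp hn l
    refine ⟨fun f hf => mulS_mem_Test_left _ hc, ?_⟩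
    obtain ⟨m, C, hC, hb⟩ := hw.bound
    refine ⟨m, ‖cls c‖ * C, by positivity, fun f hf => ?_⟩
    refine (integral_norm_mulS_le hc (hw.mem_Test f hf)).trans ?_
    rw [mul_assoc]
    gcongr
    exact hb f hf
  | zero => exact ⟨fun f _ => zero_mem _, 0, 0, le_rfl, fun f _ => by simp⟩
  | add P P' _ _ h h' =>
    obtain ⟨h, m, C, hC, hb⟩ := h
    obtain ⟨h', m', C', hC', hb'⟩ := h'
    refine ⟨fun f hf => add_mem (h f hf) (h' f hf), max m m', C + C', by positivity,
      fun f hf => ?_⟩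
    have i1 := (integrable_of_mem_Test (h f hf)).norm
    have i2 := (integrable_of_mem_Test (h' f hf)).norm
    calc ∫ p, ‖((P + P') f : Smooth n).1 p‖
        ≤ ∫ p, (‖(P f : Heis n → ℂ) p‖ + ‖(P' f : Heis n → ℂ) p‖) :=
          integral_mono (integrable_of_mem_Test (add_mem (h f hf) (h' f hf))).norm (i1.add i2)
            fun p => norm_add_le _ _
      _ = (∫ p, ‖(P f : Heis n → ℂ) p‖) + ∫ p, ‖(P' f : Heis n → ℂ) p‖ := integral_add i1 i2
      _ ≤ _ := by
        rw [add_mul]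
        refine add_le_add ((hb f hf).trans ?_) ((hb' f hf).trans ?_)
        · gcongr
          exact norm_cls_shifted_pow_mono (Test_le_Sch hf) (le_max_left _ _)
        · gcongr
          exact norm_cls_shifted_pow_mono (Test_le_Sch hf) (le_max_right _ _)
  | smul c P _ h =>
    obtain ⟨h, m, C, hC, hb⟩ := h
    refine ⟨fun f hf => Submodule.smul_mem _ c (h f hf), m, ‖c‖ * C, by positivity, fun f hf => ?_⟩
    have e : ∀ p, ‖((c • P) f : Smooth n).1 p‖ = ‖c‖ * ‖(P f : Heis n → ℂ) p‖ := fun p =>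
      norm_smul c ((P f : Heis n → ℂ) p)
    simp only [e]
    rw [integral_const_mul, mul_assoc]
    gcongr
    exact hb f hf

/-- After multiplication by a cutoff, the mixed derivative is a sum of horizontal words with
compactly supported coefficients. Cauchy–Schwarz passes from L¹ to L², and each word is bounded by a
power of I + ℒ. The power is far from optimal; scaling recovers the sharp order. -/
theorem exists_norm_apply_zero_le (hn : 1 ≤ n) : ∃ (m : ℕ) (C : ℝ), 0 ≤ C ∧
    ∀ f ∈ Test n, ‖(f : Heis n → ℂ) 0‖ ≤ C * ‖cls ((shifted n ^ m) f)‖ := by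
  obtain ⟨χ, hχ, hχ1⟩ := exists_cutoff n
  have h1 : (χ : Heis n → ℂ) 0 = 1 := hχ1.self_of_nhds
  obtain ⟨ws, C, hC, hb⟩ := exists_norm_le_integral_mixedDeriv n
  have key : ∀ (ws : List (Heis n)) (P : Module.End ℂ (Smooth n)), P ∈ locSpan n →
      ∃ P' ∈ locSpan n, ∀ f, ws.foldl (fun g w => D w g) (P f) = P' f := by
    intro ws
    induction ws with
    | nil => exact fun P hP => ⟨P, hP, fun f => rfl⟩
    | cons w ws ih => exact fun P hP => ih (D w * P) (D_mul_mem_locSpan hn w hP)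
  obtain ⟨P, hP, hPf⟩ := key ws _ (mulS_mul_wordOp_mem_locSpan hχ [])
  obtain ⟨-, m, C', hC', hb'⟩ := exists_bound_of_mem_locSpan hn hP
  refine ⟨m, C * C', by positivity, fun f hf => ?_⟩
  have h2 := hb (mulS χ f) (mulS_mem_Test_left f hχ)
  have h3 := hPf f
  rw [wordOp_nil, mul_one] at h3
  rw [h3, mulS_apply, h1, one_mul] at h2
  refine h2.trans ?_
  rw [mul_assoc]
  gcongr
  exact hb' f hf

/-- The operator `I + a ℒ` on smooth functions. -/
def shiftedBy (n : ℕ) (a : ℝ) : Module.End ℂ (Smooth n) := 1 + (a : ℂ) • sublaplacian n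

theorem shiftedBy_apply (a : ℝ) (f : Smooth n) :
    shiftedBy n a f = f + (a : ℂ) • sublaplacian n f := rfl

theorem shiftedBy_mem_Test (a : ℝ) {f : Smooth n} (hf : f ∈ Test n) : shiftedBy n a f ∈ Test n :=
  add_mem hf (Submodule.smul_mem _ _ (sublaplacian_mem_Test hf))

theorem shiftedBy_pow_mem_Test (a : ℝ) (m : ℕ) {f : Smooth n} (hf : f ∈ Test n) :
    (shiftedBy n a ^ m) f ∈ Test n := by
  induction m generalizing f with
  | zero => exact hf
  | succ m ih => rw [pow_succ]; exact ih (shiftedBy_mem_Test a hf)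

theorem shifted_pow_dilS (r : ℝ) (m : ℕ) (f : Smooth n) :
    (shifted n ^ m) (dilS r f) = dilS r ((shiftedBy n (r ^ 2) ^ m) f) := by
  induction m generalizing f with
  | zero => rfl
  | succ m ih =>
    rw [shifted_pow_succ_apply, pow_succ, Module.End.mul_apply, ← ih]
    congr 1
    rw [shifted_apply, sublaplacian_dilS, shiftedBy_apply, map_add, map_smul]
    push_cast
    rfl

/-- The crude inequality applied to f ∘ `dil r`, which has the same value at the origin; the factor
comes from the scaling of the L² norm. -/
theorem exists_norm_apply_zero_le_shiftedBy (hn : 1 ≤ n) : ∃ (m₀ : ℕ) (C : ℝ), 0 ≤ C ∧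
    ∀ m ≥ m₀, ∀ r : ℝ, 0 < r → ∀ f ∈ Test n,
      ‖(f : Heis n → ℂ) 0‖ ≤ C * (r ^ (n + 1))⁻¹ * ‖cls ((shiftedBy n (r ^ 2) ^ m) f)‖ := by
  obtain ⟨m₀, C, hC, hb⟩ := exists_norm_apply_zero_le hn
  refine ⟨m₀, C, hC, fun m hm r hr f hf => ?_⟩
  have h := (hb _ (dilS_mem_Test hr.ne' hf)).trans (mul_le_mul_of_nonneg_left
    (norm_cls_shifted_pow_mono (Test_le_Sch (dilS_mem_Test hr.ne' hf)) hm) hC)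
  rwa [shifted_pow_dilS, norm_cls_dilS hr (shiftedBy_pow_mem_Test _ m hf), dilS_apply, map_zero,
    ← mul_assoc] at h

/-! ### The maximum principle -/

/-- The field is constant along its own lines, so these are its integral curves and ordinary second
derivatives along them compute `V i (V i f)`. -/
theorem hvec_add_smul (i : Fin n ⊕ Fin n) (p : Heis n) (τ : ℝ) :
    hvec i (p + τ • hvec i p) = hvec i p := by
  rcases i with j | j <;> ext <;> simp [hvec]

theorem hasDerivAt_line (i : Fin n ⊕ Fin n) (f : Smooth n) (p : Heis n) (τ : ℝ) :
    HasDerivAt (fun τ : ℝ => (f : Heis n → ℂ) (p + τ • hvec i p))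
      ((V i f : Heis n → ℂ) (p + τ • hvec i p)) τ := by
  have h1 : HasDerivAt (fun τ : ℝ => p + τ • hvec i p) (hvec i p) τ := by
    simpa using ((hasDerivAt_id τ).smul_const (hvec i p)).const_add p
  have h2 := (differentiableAt_coe f (p + τ • hvec i p)).hasFDerivAt.comp_hasDerivAt τ h1
  rw [V_apply, hvec_add_smul]
  exact h2

theorem re_V_V_nonpos (i : Fin n ⊕ Fin n) (f : Smooth n) (p : Heis n)
    (hp : ∀ q, ((f : Heis n → ℂ) q).re ≤ ((f : Heis n → ℂ) p).re) :
    ((V i (V i f) : Heis n → ℂ) p).re ≤ 0 := by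
  by_contra! hpos
  set g : ℝ → ℝ := fun τ => ((f : Heis n → ℂ) (p + τ • hvec i p)).re with hg
  have d1 : deriv g = fun τ => ((V i f : Heis n → ℂ) (p + τ • hvec i p)).re := by
    ext τ
    exact (Complex.reCLM.hasFDerivAt.comp_hasDerivAt τ (hasDerivAt_line i f p τ)).deriv
  have d2 : deriv (deriv g) 0 = ((V i (V i f) : Heis n → ℂ) p).re := by
    rw [d1]
    have := (Complex.reCLM.hasFDerivAt.comp_hasDerivAt 0 (hasDerivAt_line i (V i f) p 0)).deriv
    rw [zero_smul, add_zero] at this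
    exact this
  have hmax : IsLocalMax g 0 := .of_forall fun τ => by simpa [hg] using hp _
  have hc : ContinuousAt g 0 := by
    have := (Complex.reCLM.hasFDerivAt.comp_hasDerivAt 0 (hasDerivAt_line i f p 0))
    exact this.continuousAt
  -- A positive second derivative makes the maximum also a local minimum; then `g` is locally
  -- constant, which contradicts the positivity.
  have hmin : IsLocalMin g 0 :=
    isLocalMin_of_deriv_deriv_pos (by rw [d2]; exact hpos) hmax.deriv_eq_zero hc
  have hconst : g =ᶠ[𝓝 0] fun _ => g 0 := by
    filter_upwards [hmax, hmin] with τ h1 h2 using le_antisymm h1 h2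
  have h0 : deriv (deriv g) 0 = 0 := by
    rw [hconst.deriv.deriv_eq]; simp
  rw [d2] at h0
  exact hpos.ne' h0

/-- A positive function of quadratic growth. -/
def gauge (p : Heis n) : ℝ := 1 + ∑ j, Complex.normSq (p.1 j) + p.2 ^ 2

theorem normSq_le_sum (z : Fin n → ℂ) (j : Fin n) :
    Complex.normSq (z j) ≤ ∑ j, Complex.normSq (z j) :=
  Finset.single_le_sum (f := fun j => Complex.normSq (z j)) (fun _ _ => Complex.normSq_nonneg _)
    (Finset.mem_univ j)

theorem sum_normSq_nonneg (z : Fin n → ℂ) : 0 ≤ ∑ j, Complex.normSq (z j) :=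
  Finset.sum_nonneg fun _ _ => Complex.normSq_nonneg _

theorem one_add_norm_sq_le_gauge (p : Heis n) : 1 + ‖p‖ ^ 2 ≤ gauge p := by
  have h1 : ‖p.1‖ ^ 2 ≤ ∑ j, Complex.normSq (p.1 j) := by
    have : ‖p.1‖ ≤ √(∑ j, Complex.normSq (p.1 j)) := by
      refine (pi_norm_le_iff_of_nonneg (Real.sqrt_nonneg _)).2 fun j => ?_
      refine Real.le_sqrt_of_sq_le ?_
      rw [← Complex.normSq_eq_norm_sq]
      exact normSq_le_sum p.1 j
    calc ‖p.1‖ ^ 2 ≤ √(∑ j, Complex.normSq (p.1 j)) ^ 2 := by gcongr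
      _ = _ := Real.sq_sqrt (sum_normSq_nonneg _)
  have h2 : ‖p.2‖ ^ 2 = p.2 ^ 2 := by simp
  have h3 := sum_normSq_nonneg p.1
  rw [gauge, Prod.norm_def]
  rcases max_choice ‖p.1‖ ‖p.2‖ with h | h <;> rw [h]
  · nlinarith [sq_nonneg p.2]
  · rw [h2]; linarith

theorem one_le_gauge (p : Heis n) : 1 ≤ gauge p := by
  have := one_add_norm_sq_le_gauge p
  nlinarith [sq_nonneg ‖p‖]

theorem contDiff_gauge : ContDiff ℝ ∞ (gauge (n := n)) := by
  have h : ∀ j : Fin n, ContDiff ℝ ∞ fun p : Heis n => Complex.normSq (p.1 j) := by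
    intro j
    have h1 : ContDiff ℝ ∞ fun p : Heis n => Complex.reCLM (p.1 j) := by fun_prop
    have h2 : ContDiff ℝ ∞ fun p : Heis n => Complex.imCLM (p.1 j) := by fun_prop
    exact (h1.mul h1).add (h2.mul h2)
  exact (contDiff_const.add (ContDiff.sum fun j _ => h j)).add (contDiff_snd.pow 2)

/-- On horizontal lines the gauge is a quadratic polynomial with coefficients controlled by the
gauge itself. Hence two horizontal derivatives do not raise the growth of its powers. -/
theorem gauge_line (i : Fin n ⊕ Fin n) (p : Heis n) : ∃ b c : ℝ, b ^ 2 ≤ gauge p ^ 2 ∧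
    c ≤ gauge p ∧ ∀ τ : ℝ, gauge (p + τ • hvec i p) = gauge p + b * τ + c * τ ^ 2 := by
  have key : ∀ (j : Fin n) (a : ℂ), Complex.normSq a = 1 → ∀ τ : ℝ,
      ∑ k, Complex.normSq (p.1 k + τ • (Pi.single j a : Fin n → ℂ) k) =
      (∑ k, Complex.normSq (p.1 k)) + 2 * (p.1 j * (starRingEnd ℂ) a).re * τ + τ ^ 2 := by
    intro j a ha τ
    rw [add_assoc, ← sub_eq_iff_eq_add', ← Finset.sum_sub_distrib, Finset.sum_eq_single j]
    · rw [Pi.single_eq_same, Complex.normSq_add, Complex.real_smul, Complex.normSq_mul,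
        Complex.normSq_ofReal, ha]
      simp
      ring
    · intro k _ hk
      simp [Pi.single_eq_of_ne hk]
    · simp
  have hg := one_le_gauge p
  rcases i with j | j
  · have hn := normSq_le_sum p.1 j
    rw [Complex.normSq_apply] at hn
    refine ⟨2 * (p.1 j).re + p.2 * (p.1 j).im, 1 + ((p.1 j).im / 2) ^ 2, ?_, ?_, fun τ => ?_⟩
    · rw [sq_le_sq, abs_of_nonneg (by linarith : 0 ≤ gauge p), abs_le]
      rw [gauge]
      constructor <;> nlinarith [sq_nonneg ((p.1 j).re - 1), sq_nonneg ((p.1 j).re + 1),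
        sq_nonneg (p.2 + (p.1 j).im), sq_nonneg (p.2 - (p.1 j).im)]
    · rw [gauge]; nlinarith [sq_nonneg (p.1 j).re, sq_nonneg (p.1 j).im, sq_nonneg p.2]
    · have := key j 1 (by simp) τ
      simp only [gauge, hvec, Sum.elim_inl, Prod.fst_add, Prod.smul_fst, Pi.add_apply,
        Pi.smul_apply, Prod.snd_add, Prod.smul_snd, smul_eq_mul]
      rw [this]
      simp
      ring
  · have hn := normSq_le_sum p.1 j
    rw [Complex.normSq_apply] at hn
    refine ⟨2 * (p.1 j).im - p.2 * (p.1 j).re, 1 + ((p.1 j).re / 2) ^ 2, ?_, ?_, fun τ => ?_⟩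
    · rw [sq_le_sq, abs_of_nonneg (by linarith : 0 ≤ gauge p), abs_le]
      rw [gauge]
      constructor <;> nlinarith [sq_nonneg ((p.1 j).im - 1), sq_nonneg ((p.1 j).im + 1),
        sq_nonneg (p.2 + (p.1 j).re), sq_nonneg (p.2 - (p.1 j).re)]
    · rw [gauge]; nlinarith [sq_nonneg (p.1 j).re, sq_nonneg (p.1 j).im, sq_nonneg p.2]
    · have := key j Complex.I (by simp) τ
      simp only [gauge, hvec, Sum.elim_inr, Prod.fst_add, Prod.smul_fst, Pi.add_apply,
        Pi.smul_apply, Prod.snd_add, Prod.smul_snd, smul_eq_mul]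
      rw [this]
      simp
      ring

/-- The powers of the gauge, as smooth functions. -/
def gaugeS (n N : ℕ) : Smooth n :=
  ⟨fun p => ((gauge p ^ N : ℝ) : ℂ), Complex.ofRealCLM.contDiff.comp (contDiff_gauge.pow N)⟩

theorem gaugeS_apply (N : ℕ) (p : Heis n) :
    (gaugeS n N : Heis n → ℂ) p = ((gauge p ^ N : ℝ) : ℂ) := rfl

theorem re_V_V_gaugeS_le (i : Fin n ⊕ Fin n) (k : ℕ) (p : Heis n) :
    ((V i (V i (gaugeS n (k + 2))) : Heis n → ℂ) p).re ≤
      ((k + 2) * (k + 3)) * gauge p ^ (k + 2) := by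
  obtain ⟨b, c, hb, hc, hτ⟩ := gauge_line i p
  have d0 : ∀ τ : ℝ, HasDerivAt (fun τ : ℝ => gauge p + b * τ + c * τ ^ 2) (b + 2 * c * τ) τ := by
    intro τ
    have := (((hasDerivAt_id τ).const_mul b).const_add (gauge p)).add
      (((hasDerivAt_id τ).pow 2).const_mul c)
    convert! this using 1
    simp; ring
  have d1 : ∀ τ : ℝ, ((V i (gaugeS n (k + 2)) : Heis n → ℂ) (p + τ • hvec i p)).re =
      (k + 2) * (gauge p + b * τ + c * τ ^ 2) ^ (k + 1) * (b + 2 * c * τ) := by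
    intro τ
    have h1 := Complex.reCLM.hasFDerivAt.comp_hasDerivAt τ
      (hasDerivAt_line i (gaugeS n (k + 2)) p τ)
    have h2 := (d0 τ).pow (k + 2)
    have e : (Complex.reCLM ∘ fun τ : ℝ => (gaugeS n (k + 2) : Heis n → ℂ) (p + τ • hvec i p)) =
        (fun τ : ℝ => gauge p + b * τ + c * τ ^ 2) ^ (k + 2) := by
      ext τ
      simp only [Function.comp_apply, gaugeS_apply, hτ, Pi.pow_apply, Complex.reCLM_apply]
      exact Complex.ofReal_re _
    rw [e] at h1
    have := h1.unique h2
    simpa using this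
  have d2 : ((V i (V i (gaugeS n (k + 2))) : Heis n → ℂ) p).re =
      (k + 2) * (k + 1) * gauge p ^ k * b ^ 2 + (k + 2) * gauge p ^ (k + 1) * (2 * c) := by
    have h1 := Complex.reCLM.hasFDerivAt.comp_hasDerivAt 0
      (hasDerivAt_line i (V i (gaugeS n (k + 2))) p 0)
    have h2 := (((d0 0).pow (k + 1)).const_mul ((k : ℝ) + 2)).mul
      (((hasDerivAt_id (0 : ℝ)).const_mul (2 * c)).const_add b)
    have e : (Complex.reCLM ∘ fun τ : ℝ => (V i (gaugeS n (k + 2)) : Heis n → ℂ) (p + τ • hvec i p)) =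
        (fun τ : ℝ => (k + 2 : ℝ) * ((fun τ : ℝ => gauge p + b * τ + c * τ ^ 2) ^ (k + 1)) τ) *
        (fun τ : ℝ => b + 2 * c * id τ) := by
      ext τ
      exact d1 τ
    rw [e] at h1
    have := h1.unique h2
    rw [zero_smul, add_zero] at this
    refine Eq.trans this ?_
    simp
    ring
  rw [d2]
  have hg := one_le_gauge p
  have e1 : gauge p ^ k * b ^ 2 ≤ gauge p ^ (k + 2) := by
    rw [pow_add]; gcongr
  have e2 : gauge p ^ (k + 1) * c ≤ gauge p ^ (k + 2) := by
    rw [pow_succ _ (k + 1)]; gcongr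
  calc ((k : ℝ) + 2) * (k + 1) * gauge p ^ k * b ^ 2 + (k + 2) * gauge p ^ (k + 1) * (2 * c)
      = ((k : ℝ) + 2) * (k + 1) * (gauge p ^ k * b ^ 2) +
          2 * (k + 2) * (gauge p ^ (k + 1) * c) := by ring
    _ ≤ ((k : ℝ) + 2) * (k + 1) * gauge p ^ (k + 2) + 2 * (k + 2) * gauge p ^ (k + 2) := by gcongr
    _ = _ := by ring

theorem re_sublaplacian (f : Smooth n) (p : Heis n) :
    ((sublaplacian n f : Heis n → ℂ) p).re = -∑ i, ((V i (V i f) : Heis n → ℂ) p).re := by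
  rw [sublaplacian_apply]
  simp only [NegMemClass.coe_neg, Pi.neg_apply, AddSubmonoidClass.coe_finsetSum, Finset.sum_apply,
    Complex.neg_re, Complex.re_sum]

/-- Functions of polynomial growth. -/
def PolyBdd (f : Heis n → ℂ) : Prop := ∃ (C : ℝ) (N : ℕ), ∀ p, ‖f p‖ ≤ C * (1 + ‖p‖) ^ N

/-- Two horizontal derivatives of a gauge power are at most a constant times that power; a dilation
by small ε multiplies ℒ by ε², so that I dominates. The lower bound combines ε⁴ gauge(p) ≤ gauge(δ_ε
p) with (1 + ‖p‖)² ≤ 2 gauge(p). The exponent N + 1 beats growth of order N. -/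
theorem exists_barrier (n N : ℕ) : ∃ (B : Smooth n) (c : ℝ), 0 < c ∧
    (∀ p, c * (1 + ‖p‖) ^ (N + 1) ≤ ((B : Heis n → ℂ) p).re) ∧
    ∀ p, 0 ≤ ((shifted n B : Heis n → ℂ) p).re := by
  let K : ℝ := (Fintype.card (Fin n ⊕ Fin n)) * ((N + 2) * (N + 3))
  have hK : 0 ≤ K := by positivity
  obtain ⟨ε, hε, hε1, hεK⟩ : ∃ ε : ℝ, 0 < ε ∧ ε ≤ 1 ∧ ε ^ 2 * K ≤ 1 := by
    refine ⟨(1 + K)⁻¹, by positivity, inv_le_one_of_one_le₀ (by linarith), ?_⟩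
    rw [inv_pow, inv_mul_le_iff₀ (by positivity)]
    nlinarith
  refine ⟨dilS ε (gaugeS n (N + 2)), (ε ^ 4 / 2) ^ (N + 2), by positivity, fun p => ?_, fun p => ?_⟩
  · rw [dilS_apply, gaugeS_apply, Complex.ofReal_re]
    have h1 : ε ^ 4 * gauge p ≤ gauge (dil ε p) := by
      simp only [gauge, dil_apply, Pi.smul_apply, Complex.real_smul, Complex.normSq_mul,
        Complex.normSq_ofReal, ← Finset.mul_sum]
      have h2 := sum_normSq_nonneg p.1
      have h3 : ε ^ 2 ≤ 1 := by nlinarith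
      have h4 : ε ^ 4 ≤ ε ^ 2 := by nlinarith [sq_nonneg ε]
      nlinarith [sq_nonneg p.2, mul_le_mul_of_nonneg_right h4 h2]
    have h2 := one_add_norm_sq_le_gauge p
    have h3 : (1 + ‖p‖) ^ 2 ≤ 2 * gauge p := by nlinarith [sq_nonneg (‖p‖ - 1)]
    have h4 : (1 : ℝ) ≤ 1 + ‖p‖ := by linarith [norm_nonneg p]
    calc (ε ^ 4 / 2) ^ (N + 2) * (1 + ‖p‖) ^ (N + 1)
        ≤ (ε ^ 4 / 2) ^ (N + 2) * (1 + ‖p‖) ^ (2 * (N + 2)) := by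
          gcongr
          omega
      _ = (ε ^ 4 / 2 * (1 + ‖p‖) ^ 2) ^ (N + 2) := by rw [mul_pow, pow_mul]
      _ ≤ (ε ^ 4 * gauge p) ^ (N + 2) := by
          refine pow_le_pow_left₀ (by positivity) ?_ _
          calc ε ^ 4 / 2 * (1 + ‖p‖) ^ 2 ≤ ε ^ 4 / 2 * (2 * gauge p) := by gcongr
            _ = _ := by ring
      _ ≤ _ := pow_le_pow_left₀ (by have := one_le_gauge p; positivity) h1 _
  · rw [shifted_apply, sublaplacian_dilS]
    have e : ((dilS ε (gaugeS n (N + 2)) + (ε : ℂ) ^ 2 • dilS ε (sublaplacian n (gaugeS n (N + 2))) :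
        Smooth n) : Heis n → ℂ) p = (gaugeS n (N + 2) : Heis n → ℂ) (dil ε p) +
        ((ε ^ 2 : ℝ) : ℂ) * (sublaplacian n (gaugeS n (N + 2)) : Heis n → ℂ) (dil ε p) := by
      push_cast
      rfl
    rw [e, Complex.add_re, Complex.re_ofReal_mul, re_sublaplacian, gaugeS_apply, Complex.ofReal_re]
    have h1 : ∑ i, ((V i (V i (gaugeS n (N + 2))) : Heis n → ℂ) (dil ε p)).re ≤
        K * gauge (dil ε p) ^ (N + 2) := by
      refine (Finset.sum_le_card_nsmul _ _ _
        fun i _ => re_V_V_gaugeS_le i N (dil ε p)).trans_eq ?_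
      rw [nsmul_eq_mul, ← mul_assoc, Finset.card_univ]
    have h2 : 0 ≤ gauge (dil ε p) ^ (N + 2) := by have := one_le_gauge (dil ε p); positivity
    nlinarith [mul_le_mul_of_nonneg_left h1 (sq_nonneg ε), mul_le_mul_of_nonneg_right hεK h2]

/-- The function F = v - ηB tends to -∞ in real part, so Re F has a maximum q. There Re ℒF ≥ 0,
whence Re F(q) ≤ Re (I + ℒ)F(q) = -η Re (I + ℒ)B(q) ≤ 0. Finally η → 0. -/
theorem re_nonpos_of_shifted_eq_zero {v : Smooth n} (hv : shifted n v = 0)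
    (hb : PolyBdd (v : Heis n → ℂ)) (p : Heis n) : ((v : Heis n → ℂ) p).re ≤ 0 := by
  obtain ⟨C, N, hC⟩ := hb
  obtain ⟨B, c, hc, hB, hSB⟩ := exists_barrier n N
  have hC0 : 0 ≤ C := by have := (norm_nonneg _).trans (hC 0); simpa using this
  have key : ∀ η : ℝ, 0 < η → ((v : Heis n → ℂ) p).re ≤ η * ((B : Heis n → ℂ) p).re := by
    intro η hη
    set F : Smooth n := v - (η : ℂ) • B with hF
    have hFre : ∀ q, ((F : Heis n → ℂ) q).re =
        ((v : Heis n → ℂ) q).re - η * ((B : Heis n → ℂ) q).re := fun q => by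
      simp [hF]
    have hbound : ∀ q, ((F : Heis n → ℂ) q).re ≤ (1 + ‖q‖) ^ N * (C - η * c * (1 + ‖q‖)) := by
      intro q
      rw [hFre]
      have h1 := (Complex.re_le_norm _).trans (hC q)
      have h2 := mul_le_mul_of_nonneg_left (hB q) hη.le
      calc _ ≤ C * (1 + ‖q‖) ^ N - η * (c * (1 + ‖q‖) ^ (N + 1)) := by linarith
        _ = _ := by ring
    have hev : ∀ᶠ q in cocompact (Heis n),
        ((F : Heis n → ℂ) q).re ≤ ((F : Heis n → ℂ) 0).re := by
      have := (tendsto_norm_cocompact_atTop (E := Heis n)).eventually_ge_atTop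
        ((C + |((F : Heis n → ℂ) 0).re|) / (η * c))
      filter_upwards [this] with q hq
      rw [div_le_iff₀ (by positivity)] at hq
      have h4 : (1 : ℝ) ≤ (1 + ‖q‖) ^ N := one_le_pow₀ (by linarith [norm_nonneg q])
      have h5 : C - η * c * (1 + ‖q‖) ≤ -|((F : Heis n → ℂ) 0).re| := by
        nlinarith [mul_pos hη hc]
      have h6 := hbound q
      have h7 := neg_abs_le ((F : Heis n → ℂ) 0).re
      have h8 := abs_nonneg ((F : Heis n → ℂ) 0).re
      nlinarith
    obtain ⟨q, hq⟩ := Continuous.exists_forall_ge'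
      (Complex.continuous_re.comp (contDiff_coe F).continuous) 0 hev
    have h1 : 0 ≤ ((sublaplacian n F : Heis n → ℂ) q).re := by
      rw [re_sublaplacian]
      have := Finset.sum_nonpos fun i (_ : i ∈ Finset.univ) => re_V_V_nonpos i F q hq
      linarith
    have h2 : shifted n F = -((η : ℂ) • shifted n B) := by
      rw [hF, map_sub, hv, map_smul, zero_sub]
    have h3 : ((F : Heis n → ℂ) q).re + ((sublaplacian n F : Heis n → ℂ) q).re =
        -(η * ((shifted n B : Heis n → ℂ) q).re) := by
      have := congrArg (fun g : Smooth n => ((g : Heis n → ℂ) q).re) h2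
      simp [shifted_apply] at this ⊢
      linarith
    have h4 := mul_nonneg hη.le (hSB q)
    have h5 := hq p
    simp only [Function.comp_apply] at h5
    rw [hFre p] at h5
    linarith
  refine le_of_tendsto_of_tendsto (b := 𝓝[>] (0 : ℝ)) tendsto_const_nhds
    (g := fun η : ℝ => η * ((B : Heis n → ℂ) p).re) ?_ ?_
  · have : Continuous fun η : ℝ => η * ((B : Heis n → ℂ) p).re := by fun_prop
    exact (this.tendsto' 0 0 (by simp)).mono_left nhdsWithin_le_nhds
  · filter_upwards [self_mem_nhdsWithin] with η hη using key η hη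

theorem eq_zero_of_shifted_eq_zero {v : Smooth n} (hv : shifted n v = 0)
    (hb : PolyBdd (v : Heis n → ℂ)) : v = 0 := by
  ext p
  -- Multiplication by the conjugate of v(p) turns the bound on real parts into |v(p)|² ≤ 0.
  set a : ℂ := (starRingEnd ℂ) ((v : Heis n → ℂ) p) with ha
  have h := re_nonpos_of_shifted_eq_zero (v := a • v) (by rw [map_smul, hv, smul_zero])
    (by
      obtain ⟨C, N, hC⟩ := hb
      refine ⟨‖a‖ * C, N, fun q => ?_⟩
      change ‖a • (v : Heis n → ℂ) q‖ ≤ _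
      rw [norm_smul, mul_assoc]
      gcongr
      exact hC q) p
  change (a * (v : Heis n → ℂ) p).re ≤ 0 at h
  rw [ha, mul_comm, Complex.mul_conj, Complex.ofReal_re] at h
  exact Complex.normSq_eq_zero.1 (le_antisymm h (Complex.normSq_nonneg _))

/-! ### Group convolution -/

theorem symp_self (a : Fin n → ℂ) : symp a a = 0 := by
  have := symp_comm a a
  linarith

theorem symp_add_left (a b z : Fin n → ℂ) : symp (a + b) z = symp a z + symp b z := by
  rw [symp_comm, map_add, neg_add, ← symp_comm, ← symp_comm]

theorem symp_neg_left (a z : Fin n → ℂ) : symp (-a) z = -symp a z := by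
  rw [symp_comm, map_neg, ← symp_comm]

theorem ltr_ltr_neg (r q : Heis n) : ltr (ltr r q) (-q) = r := by
  ext <;> simp [ltr, symp_add_left, symp_self]; ring

theorem ltr_neg_ltr (r q : Heis n) : ltr (-r) (ltr r q) = q := by
  ext <;> simp [ltr, symp_neg_left, symp_self]; ring

theorem contDiff_ltr_uncurry : ContDiff ℝ ∞ fun z : Heis n × Heis n => ltr z.1 z.2 := by
  simp only [ltr, symp_apply]
  have h1 : ∀ j, ContDiff ℝ ∞ fun z : Heis n × Heis n => (z.1.1 j).im := fun j =>
    (Complex.imCLM ∘L ContinuousLinearMap.proj j ∘L ContinuousLinearMap.fst ℝ _ _ ∘L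
      ContinuousLinearMap.fst ℝ (Heis n) (Heis n)).contDiff
  have h2 : ∀ j, ContDiff ℝ ∞ fun z : Heis n × Heis n => (z.1.1 j).re := fun j =>
    (Complex.reCLM ∘L ContinuousLinearMap.proj j ∘L ContinuousLinearMap.fst ℝ _ _ ∘L
      ContinuousLinearMap.fst ℝ (Heis n) (Heis n)).contDiff
  have h3 : ∀ j, ContDiff ℝ ∞ fun z : Heis n × Heis n => (z.2.1 j).im := fun j =>
    (Complex.imCLM ∘L ContinuousLinearMap.proj j ∘L ContinuousLinearMap.fst ℝ _ _ ∘L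
      ContinuousLinearMap.snd ℝ (Heis n) (Heis n)).contDiff
  have h4 : ∀ j, ContDiff ℝ ∞ fun z : Heis n × Heis n => (z.2.1 j).re := fun j =>
    (Complex.reCLM ∘L ContinuousLinearMap.proj j ∘L ContinuousLinearMap.fst ℝ _ _ ∘L
      ContinuousLinearMap.snd ℝ (Heis n) (Heis n)).contDiff
  refine ContDiff.prodMk (by fun_prop) (ContDiff.add (by fun_prop) (ContDiff.sum fun j _ => ?_))
  exact (((h1 j).div_const 2).mul (h4 j)).sub (((h2 j).div_const 2).mul (h3 j))

theorem measurePreserving_shear (a : Fin n → ℂ) (c : (Fin n → ℂ) → ℝ) (hc : Continuous c) :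
    MeasurePreserving (fun p : Heis n => (a + p.1, c p.1 + p.2)) volume volume := by
  have : (volume : Measure (Fin n → ℂ)).IsAddHaarMeasure := Measure.pi.isAddHaarMeasure _
  refine MeasurePreserving.skew_product (g := fun z t => c z + t)
    (measurePreserving_add_left volume a) ?_ ?_
  · exact (hc.comp continuous_fst |>.add continuous_snd).measurable
  · exact Eventually.of_forall fun z => (measurePreserving_add_left volume (c z)).map_eq

theorem measurePreserving_ltr (a : Heis n) : MeasurePreserving (ltr a) volume volume := by
  convert measurePreserving_shear a.1 (fun z => a.2 + symp a.1 z) (by fun_prop) using 2 with p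
  ext <;> simp [ltr]; ring

theorem measurePreserving_ltr_right (q : Heis n) :
    MeasurePreserving (fun r => ltr r q) volume volume := by
  convert measurePreserving_shear q.1 (fun z => q.2 - symp q.1 z) (by fun_prop) using 2 with p
  have := symp_comm p.1 q.1
  ext <;> simp [ltr, this] <;> ring

theorem hasCompactSupport_mul_ltr {φ ψ : Heis n → ℂ} (hφ : HasCompactSupport φ)
    (hψ : HasCompactSupport ψ) :
    HasCompactSupport fun z : Heis n × Heis n => φ z.1 * ψ (ltr z.1 z.2) := by
  have hc : Continuous fun z : Heis n × Heis n => (z.1, ltr (-z.1) z.2) :=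
    continuous_fst.prodMk (contDiff_ltr_uncurry.continuous.comp
      (continuous_fst.neg.prodMk continuous_snd))
  refine HasCompactSupport.intro ((IsCompact.prod hφ hψ).image hc) fun z hz => ?_
  by_contra h
  refine hz ⟨(z.1, ltr z.1 z.2), ⟨subset_tsupport _ (left_ne_zero_of_mul h),
    subset_tsupport _ (right_ne_zero_of_mul h)⟩, ?_⟩
  simp [ltr_neg_ltr]

theorem integrable_mul_snd {Φ : Heis n × Heis n → ℂ} (hΦ : Continuous Φ)
    (hs : HasCompactSupport Φ) {G : Heis n → ℂ} (hG : LocallyIntegrable G volume) :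
    Integrable (fun z => Φ z * G z.2) (volume.prod volume) := by
  have hK1 : IsCompact (Prod.fst '' tsupport Φ) := IsCompact.image hs continuous_fst
  have hK2 : IsCompact (Prod.snd '' tsupport Φ) := IsCompact.image hs continuous_snd
  have h1 : Integrable ((Prod.fst '' tsupport Φ).indicator fun _ => (1 : ℂ))
      (volume : Measure (Heis n)) :=
    (integrable_indicator_iff hK1.measurableSet).2
      (continuous_const.locallyIntegrable.integrableOn_isCompact hK1)
  have h2 : Integrable ((Prod.snd '' tsupport Φ).indicator G) (volume : Measure (Heis n)) :=
    (integrable_indicator_iff hK2.measurableSet).2 (hG.integrableOn_isCompact hK2)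
  obtain ⟨C, hC⟩ := hs.exists_bound_of_continuous hΦ
  refine ((h1.mul_prod h2).bdd_mul hΦ.aestronglyMeasurable (Eventually.of_forall hC)).congr
    (Eventually.of_forall fun z => ?_)
  by_cases hz : z ∈ tsupport Φ
  · have e1 : z.1 ∈ Prod.fst '' tsupport Φ := ⟨z, hz, rfl⟩
    have e2 : z.2 ∈ Prod.snd '' tsupport Φ := ⟨z, hz, rfl⟩
    simp [Set.indicator_of_mem e1, Set.indicator_of_mem e2]
  · simp [image_eq_zero_of_notMem_tsupport hz]

/-- The group convolution `∫ G(q) φ(p q⁻¹) dq`. -/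
def gconv (φ : Heis n → ℂ) (G : Heis n → ℂ) (p : Heis n) : ℂ := ∫ q, G q * φ (ltr p (-q))

section Convolution

variable {G : Heis n → ℂ}

/-- The group inverse is -q, so with p frozen as a parameter the group convolution is an additive
convolution at 0; the calculus of convolutions with parameters then applies. -/
theorem gconv_eq_convolution (φ : Heis n → ℂ) (G : Heis n → ℂ) (p : Heis n) :
    gconv φ G p = (convolution G (fun y => φ (ltr p y)) (ContinuousLinearMap.mul ℝ ℂ) volume) 0 := by
  simp [gconv, convolution]

theorem exists_isCompact_ltr {φ : Heis n → ℂ} (hφ : HasCompactSupport φ) (p₀ : Heis n) :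
    ∃ k : Set (Heis n), IsCompact k ∧ ∀ p y, p ∈ Metric.ball p₀ 1 → y ∉ k → φ (ltr p y) = 0 := by
  have hc : Continuous fun z : Heis n × Heis n => ltr (-z.1) z.2 :=
    contDiff_ltr_uncurry.continuous.comp (continuous_fst.neg.prodMk continuous_snd)
  refine ⟨_, ((isCompact_closedBall p₀ 1).prod hφ).image hc, fun p y hp hy => ?_⟩
  by_contra h
  exact hy ⟨(p, ltr p y), ⟨Metric.ball_subset_closedBall hp, subset_tsupport _ h⟩,
    ltr_neg_ltr p y⟩

theorem contDiff_gconv (hG : LocallyIntegrable G volume) {φ : Smooth n} (hφ : φ ∈ Test n) :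
    ContDiff ℝ ∞ (gconv φ G) := by
  rw [contDiff_iff_contDiffAt]
  intro p₀
  obtain ⟨k, hk, hk'⟩ := exists_isCompact_ltr hφ p₀
  have h := contDiffOn_convolution_right_with_param (𝕜 := ℝ) (n := (⊤ : ℕ∞)) (μ := volume)
    (ContinuousLinearMap.mul ℝ ℂ) (f := G) (g := fun p y => (φ : Heis n → ℂ) (ltr p y))
    Metric.isOpen_ball hk hk' hG
    ((contDiff_coe φ).comp contDiff_ltr_uncurry).contDiffOn
  have h2 := (h.contDiffAt (x := (p₀, 0)) ((Metric.isOpen_ball.prod isOpen_univ).mem_nhds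
    ⟨Metric.mem_ball_self one_pos, trivial⟩)).comp p₀
    (contDiffAt_id.prodMk contDiffAt_const : ContDiffAt ℝ ∞ (fun p : Heis n => (p, (0 : Heis n))) p₀)
  refine h2.congr_of_eventuallyEq (Eventually.of_forall fun p => ?_)
  exact gconv_eq_convolution φ G p

theorem fderiv_ltr_left (a p w : Heis n) (f : Smooth n) :
    fderiv ℝ (fun z : Heis n × Heis n => (f : Heis n → ℂ) (ltr z.1 z.2)) (a, p) (w, 0) =
      fderiv ℝ (f : Heis n → ℂ) (ltr a p) (w.1, w.2 + symp w.1 p.1) := by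
  have h1 : HasFDerivAt (fun z : Heis n × Heis n => ltr z.1 z.2) _ (a, p) :=
    ((contDiff_ltr_uncurry (n := n)).differentiable (by simp)).differentiableAt.hasFDerivAt
  have h2 := (differentiableAt_coe f (ltr a p)).hasFDerivAt.comp (a, p) h1
  have h3 : HasFDerivAt (fun b : Heis n => ltr b p)
      ((ContinuousLinearMap.fst ℝ (Fin n → ℂ) ℝ).prod
      (ContinuousLinearMap.snd ℝ (Fin n → ℂ) ℝ - symp p.1 ∘L ContinuousLinearMap.fst ℝ _ ℝ)) a := by
    have e : (fun b : Heis n => ltr b p) = fun b => (b.1 + p.1, (b.2 + p.2) - symp p.1 b.1) := by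
      ext b
      · rfl
      · simp [ltr, symp_comm b.1 p.1, sub_eq_add_neg]
    rw [e]
    refine HasFDerivAt.prodMk ?_ ?_
    · exact (ContinuousLinearMap.fst ℝ (Fin n → ℂ) ℝ).hasFDerivAt.add_const _
    · exact ((ContinuousLinearMap.snd ℝ (Fin n → ℂ) ℝ).hasFDerivAt.add_const _).sub
        (symp p.1 ∘L ContinuousLinearMap.fst ℝ _ ℝ).hasFDerivAt
  have h4 := HasFDerivAt.comp (f := fun b : Heis n => (b, p)) a h1
    ((hasFDerivAt_id a).prodMk (hasFDerivAt_const p a))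
  have h5 := congrArg (fun A : Heis n →L[ℝ] Heis n => A w) (h4.unique h3)
  have h6 : fderiv ℝ (fun z : Heis n × Heis n => (f : Heis n → ℂ) (ltr z.1 z.2)) (a, p) = _ :=
    h2.fderiv
  rw [h6, ContinuousLinearMap.comp_apply]
  congr 1
  refine h5.trans ?_
  simp [symp_comm w.1 p.1, sub_eq_add_neg]

/-- The derivative of a group convolution is a sum of such functions with linear coefficients. -/
def gconvDeriv (w : Heis n) (φ : Smooth n) : Smooth n := D w φ + mulS (linS (symp w.1)) (T n φ)

theorem gconvDeriv_mem_Test (w : Heis n) {φ : Smooth n} (hφ : φ ∈ Test n) :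
    gconvDeriv w φ ∈ Test n :=
  add_mem (fieldOp_mem_Test _ _ hφ) (mulS_mem_Test_right _ (T_mem_Test hφ))

/-- The coefficient linear in q is split as symp w (pq) - symp w p. The first part is a function of
pq and joins the test function; the second leaves the integral as a linear coefficient in p. This is
why `Growth` allows such coefficients. -/
theorem fderiv_ltr_eq (φ : Smooth n) (w p q : Heis n) :
    fderiv ℝ (φ : Heis n → ℂ) (ltr p q) (w.1, w.2 + symp w.1 q.1) =
      (gconvDeriv w φ : Heis n → ℂ) (ltr p q) - symp w.1 p.1 * (T n φ : Heis n → ℂ) (ltr p q) := by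
  have e : ((w.1, w.2 + symp w.1 q.1) : Heis n) = w + (symp w.1 q.1) • (0, 1) := by
    ext <;> simp
  change _ = fderiv ℝ (φ : Heis n → ℂ) (ltr p q) w + (symp w.1 (ltr p q).1 : ℂ) *
    fderiv ℝ (φ : Heis n → ℂ) (ltr p q) (0, 1) - _ * fderiv ℝ (φ : Heis n → ℂ) (ltr p q) (0, 1)
  rw [e, map_add, map_smul, Complex.real_smul]
  simp only [ltr, map_add]
  push_cast
  ring

theorem integrable_gconv (hG : LocallyIntegrable G volume) {φ : Smooth n} (hφ : φ ∈ Test n)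
    (p : Heis n) :
    Integrable fun q => G q * (φ : Heis n → ℂ) (ltr p (-q)) := by
  have hc : Continuous fun q => (φ : Heis n → ℂ) (ltr p (-q)) :=
    (contDiff_coe φ).continuous.comp ((contDiff_ltr p).continuous.comp continuous_neg)
  obtain ⟨k, hk, hk'⟩ := exists_isCompact_ltr hφ p
  have hs : HasCompactSupport fun q => (φ : Heis n → ℂ) (ltr p (-q)) := by
    refine HasCompactSupport.intro hk.neg fun q hq => hk' p _ (Metric.mem_ball_self one_pos) ?_
    simpa using hq
  exact (hG.integrable_smul_right_of_hasCompactSupport hc hs)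

theorem fderiv_gconv (hG : LocallyIntegrable G volume) {φ : Smooth n} (hφ : φ ∈ Test n)
    (p w : Heis n) :
    fderiv ℝ (gconv φ G) p w =
      gconv (gconvDeriv w φ) G p - symp w.1 p.1 * gconv (T n φ) G p := by
  obtain ⟨k, hk, hk'⟩ := exists_isCompact_ltr hφ p
  have h := hasFDerivAt_convolution_right_with_param (𝕜 := ℝ) (μ := volume)
    (ContinuousLinearMap.mul ℝ ℂ) (f := G) (g := fun p y => (φ : Heis n → ℂ) (ltr p y))
    Metric.isOpen_ball hk hk' hG
    (((contDiff_coe φ).comp contDiff_ltr_uncurry).contDiffOn.of_le (by simp)) (p, 0)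
    (Metric.mem_ball_self one_pos)
  have h2 := HasFDerivAt.comp (f := fun b : Heis n => (b, (0 : Heis n))) p h
    ((hasFDerivAt_id p).prodMk (hasFDerivAt_const (0 : Heis n) p))
  have h2 := h2.congr_of_eventuallyEq (f₁ := gconv φ G) (Eventually.of_forall fun x =>
    gconv_eq_convolution φ G x)
  have hcont : Continuous fun x : Heis n =>
      fderiv ℝ (fun z : Heis n × Heis n => (φ : Heis n → ℂ) (ltr z.1 z.2)) (p, x) :=
    (((contDiff_coe φ).comp contDiff_ltr_uncurry).continuous_fderiv (by simp)).comp
      (by fun_prop)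
  have hsupp : HasCompactSupport fun x : Heis n =>
      fderiv ℝ (fun z : Heis n × Heis n => (φ : Heis n → ℂ) (ltr z.1 z.2)) (p, x) := by
    refine HasCompactSupport.intro hk fun x hx => ?_
    have : (fun z : Heis n × Heis n => (φ : Heis n → ℂ) (ltr z.1 z.2)) =ᶠ[𝓝 (p, x)] 0 := by
      filter_upwards [(Metric.isOpen_ball.prod hk.isClosed.isOpen_compl).mem_nhds
        (x := (p, x)) ⟨Metric.mem_ball_self one_pos, hx⟩] with z hz using hk' _ _ hz.1 hz.2
    rw [this.fderiv_eq]
    simp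
  rw [h2.fderiv]
  have h3 := convolution_precompR_apply (ContinuousLinearMap.mul ℝ ℂ) hG hsupp hcont 0
    ((w, 0) : Heis n × Heis n)
  refine Eq.trans h3 ?_
  simp only [convolution, fderiv_ltr_left, fderiv_ltr_eq, ContinuousLinearMap.mul_apply', zero_sub]
  rw [gconv, gconv, ← integral_const_mul, ← integral_sub
    (integrable_gconv hG (gconvDeriv_mem_Test w hφ) p)
    ((integrable_gconv hG (T_mem_Test hφ) p).const_mul _)]
  refine integral_congr_ae (Eventually.of_forall fun q => ?_)
  simp only
  ring

end Convolution

theorem integral_comp_of_measurePreserving {α E : Type*} [MeasurableSpace α] {μ : Measure α}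
    [NormedAddCommGroup E] [NormedSpace ℝ E] {f : α → α} (hf : MeasurePreserving f μ μ)
    {g : α → E} (hg : AEStronglyMeasurable g μ) : ∫ x, g (f x) ∂μ = ∫ x, g x ∂μ := by
  conv_rhs => rw [← hf.map_eq]
  rw [integral_map hf.measurable.aemeasurable (by rwa [hf.map_eq])]

/-- From ab ≤ a² + b², since q ↦ p q⁻¹ preserves the measure; only uniformity in p matters. -/
theorem norm_gconv_le {φ : Smooth n} (hφ : φ ∈ Test n) {G : Heis n → ℂ}
    (hG : MemLp G 2 volume) (p : Heis n) :
    ‖gconv φ G p‖ ≤ ((∫ q, ‖G q‖ ^ 2) + ∫ q, ‖(φ : Heis n → ℂ) q‖ ^ 2) := by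
  have hmp : MeasurePreserving (fun q : Heis n => ltr p (-q)) volume volume :=
    (measurePreserving_ltr p).comp (Measure.measurePreserving_neg volume)
  have hc : Continuous fun q => ‖(φ : Heis n → ℂ) q‖ ^ 2 :=
    (contDiff_coe φ).continuous.norm.pow 2
  have i1 : Integrable fun q => ‖G q‖ ^ 2 := hG.integrable_norm_pow (by simp)
  have i2 : Integrable fun q => ‖(φ : Heis n → ℂ) q‖ ^ 2 :=
    (memLp_of_mem_Test hφ).integrable_norm_pow (by simp)
  have i3 : Integrable fun q => ‖(φ : Heis n → ℂ) (ltr p (-q))‖ ^ 2 :=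
    hmp.integrable_comp_of_integrable i2
  rw [← integral_comp_of_measurePreserving hmp hc.aestronglyMeasurable, ← integral_add i1 i3]
  refine norm_integral_le_of_norm_le (i1.add i3) (Eventually.of_forall fun q => ?_)
  rw [norm_mul]
  nlinarith [sq_nonneg (‖G q‖ - ‖(φ : Heis n → ℂ) (ltr p (-q))‖), sq_nonneg ‖G q‖,
    sq_nonneg ‖(φ : Heis n → ℂ) (ltr p (-q))‖]

/-- The span of the group convolutions of `G` with test functions, with polynomial coefficients. -/
inductive Growth (G : Heis n → ℂ) : Smooth n → Prop
  | gconv (φ u : Smooth n) (hφ : φ ∈ Test n) (hu : (u : Heis n → ℂ) = gconv φ G) : Growth G u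
  | add (u v : Smooth n) : Growth G u → Growth G v → Growth G (u + v)
  | smul (c : ℂ) (u : Smooth n) : Growth G u → Growth G (c • u)
  | lin (k : (Fin n → ℂ) →L[ℝ] ℝ) (u : Smooth n) : Growth G u → Growth G (mulS (linS k) u)

namespace Growth

variable {G : Heis n → ℂ} {u : Smooth n}

theorem polyBdd (hG : MemLp G 2 volume) (hu : Growth G u) : PolyBdd (u : Heis n → ℂ) := by
  induction hu with
  | gconv φ u hφ hu =>
    refine ⟨(∫ q, ‖G q‖ ^ 2) + ∫ q, ‖(φ : Heis n → ℂ) q‖ ^ 2, 0, fun p => ?_⟩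
    rw [hu, pow_zero, mul_one]
    exact norm_gconv_le hφ hG p
  | add u v _ _ hu hv =>
    obtain ⟨C, N, hC⟩ := hu
    obtain ⟨C', N', hC'⟩ := hv
    have h0 : 0 ≤ C := by have := (norm_nonneg _).trans (hC 0); simpa using this
    have h0' : 0 ≤ C' := by have := (norm_nonneg _).trans (hC' 0); simpa using this
    refine ⟨C + C', max N N', fun p => ?_⟩
    have h1 : (1 : ℝ) ≤ 1 + ‖p‖ := by linarith [norm_nonneg p]
    calc _ ≤ ‖(u : Heis n → ℂ) p‖ + ‖(v : Heis n → ℂ) p‖ := norm_add_le _ _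
      _ ≤ C * (1 + ‖p‖) ^ N + C' * (1 + ‖p‖) ^ N' := add_le_add (hC p) (hC' p)
      _ ≤ C * (1 + ‖p‖) ^ max N N' + C' * (1 + ‖p‖) ^ max N N' := by
        gcongr
        · exact le_max_left _ _
        · exact le_max_right _ _
      _ = _ := by ring
  | smul c u _ hu =>
    obtain ⟨C, N, hC⟩ := hu
    refine ⟨‖c‖ * C, N, fun p => ?_⟩
    calc _ = ‖c‖ * ‖(u : Heis n → ℂ) p‖ := norm_mul _ _
      _ ≤ ‖c‖ * (C * (1 + ‖p‖) ^ N) := by gcongr; exact hC p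
      _ = _ := by ring
  | lin k u _ hu =>
    obtain ⟨C, N, hC⟩ := hu
    refine ⟨‖k‖ * C, N + 1, fun p => ?_⟩
    have h1 : ‖k p.1‖ ≤ ‖k‖ * (1 + ‖p‖) := by
      refine (k.le_opNorm _).trans ?_
      gcongr
      linarith [norm_fst_le p]
    calc _ = ‖((k p.1 : ℝ) : ℂ)‖ * ‖(u : Heis n → ℂ) p‖ := norm_mul _ _
      _ ≤ (‖k‖ * (1 + ‖p‖)) * (C * (1 + ‖p‖) ^ N) := by
        rw [Complex.norm_real]
        gcongr
        exact hC p
      _ = _ := by ring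

theorem D (hG : LocallyIntegrable G volume) (w : Heis n) (hu : Growth G u) :
    Growth G (D w u) := by
  induction hu with
  | gconv φ u hφ hu =>
    have hψ := gconvDeriv_mem_Test w hφ
    have hT := T_mem_Test hφ
    have e : Heisenberg.D w u = ⟨Heisenberg.gconv (gconvDeriv w φ) G, contDiff_gconv hG hψ⟩ +
        (-1 : ℂ) • mulS (linS (symp w.1)) ⟨Heisenberg.gconv (T n φ) G, contDiff_gconv hG hT⟩ := by
      ext p
      rw [D_apply, hu, fderiv_gconv hG hφ]
      simp [sub_eq_add_neg]
    rw [e]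
    exact add _ _ (gconv _ _ hψ rfl) (smul _ _ (lin _ _ (gconv _ _ hT rfl)))
  | add u v _ _ hu hv => rw [map_add]; exact add _ _ hu hv
  | smul c u _ hu => rw [map_smul]; exact smul _ _ hu
  | lin k u hu hu' =>
    have e : Heisenberg.D w (mulS (linS k) u) =
        (k w.1 : ℂ) • u + mulS (linS k) (Heisenberg.D w u) := by
      rw [Heisenberg.D, fieldOp_mulS]
      congr 1
      ext p
      simp only [mulS_apply]
      change fderiv ℝ (linS k : Heis n → ℂ) p w * _ = _
      rw [fderiv_linS]
      rfl
    rw [e]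
    exact add _ _ (smul _ _ hu) (lin _ _ hu')

theorem V (hG : LocallyIntegrable G volume) (i : Fin n ⊕ Fin n) (hu : Growth G u) :
    Growth G (V i u) := by
  rw [V_eq_D]
  exact add _ _ (hu.D hG _) (lin _ _ (hu.D hG (0, 1)))

theorem zero (hu : Growth G u) : Growth G 0 := by
  simpa using smul 0 u hu

theorem shifted (hG : LocallyIntegrable G volume) (hu : Growth G u) : Growth G (shifted n u) := by
  rw [shifted_apply, sublaplacian_apply, ← neg_one_smul ℂ]
  exact add _ _ hu (smul _ _ (Finset.sum_induction _ (Growth G) add hu.zero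
    fun i _ => (hu.V hG i).V hG i))

end Growth

/-- `Growth G` is stable under I + ℒ and implies polynomial growth, so the uniqueness for I + ℒ can
be used m times. -/
theorem eq_zero_of_shifted_pow_eq_zero {G : Heis n → ℂ} (hG : MemLp G 2 volume) {u : Smooth n}
    (hu : Growth G u) (m : ℕ) (h : (shifted n ^ m) u = 0) : u = 0 := by
  induction m generalizing u with
  | zero => exact h
  | succ m ih =>
    rw [shifted_pow_succ_apply] at h
    exact eq_zero_of_shifted_eq_zero (ih (hu.shifted (hG.locallyIntegrable (by norm_num))) h)
      (hu.polyBdd hG)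

/-! ### Density of the powers of I + ℒ on test functions -/

theorem integral_shifted_mul {f : Smooth n} (hf : f ∈ Test n) (g : Smooth n) :
    ∫ p, (shifted n f : Heis n → ℂ) p * (g : Heis n → ℂ) p =
      ∫ p, (f : Heis n → ℂ) p * (shifted n g : Heis n → ℂ) p := by
  have i1 : Integrable fun p => (f : Heis n → ℂ) p * (g : Heis n → ℂ) p :=
    integrable_of_mem_Test (mulS_mem_Test_left g hf)
  have i2 : Integrable fun p => (sublaplacian n f : Heis n → ℂ) p * (g : Heis n → ℂ) p :=
    integrable_of_mem_Test (mulS_mem_Test_left g (sublaplacian_mem_Test hf))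
  have i3 : Integrable fun p => (f : Heis n → ℂ) p * (sublaplacian n g : Heis n → ℂ) p :=
    integrable_of_mem_Test (mulS_mem_Test_left (sublaplacian n g) hf)
  have e1 : ∀ p, (shifted n f : Heis n → ℂ) p * (g : Heis n → ℂ) p =
      (f : Heis n → ℂ) p * (g : Heis n → ℂ) p +
      (sublaplacian n f : Heis n → ℂ) p * (g : Heis n → ℂ) p := fun p => add_mul _ _ _
  have e2 : ∀ p, (f : Heis n → ℂ) p * (shifted n g : Heis n → ℂ) p =
      (f : Heis n → ℂ) p * (g : Heis n → ℂ) p +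
      (f : Heis n → ℂ) p * (sublaplacian n g : Heis n → ℂ) p := fun p => mul_add _ _ _
  simp only [e1, e2]
  rw [integral_add i1 i2, integral_add i1 i3, integral_sublaplacian_mul hf]

theorem integral_shifted_pow_mul (m : ℕ) {f : Smooth n} (hf : f ∈ Test n) (g : Smooth n) :
    ∫ p, ((shifted n ^ m) f : Heis n → ℂ) p * (g : Heis n → ℂ) p =
      ∫ p, (f : Heis n → ℂ) p * ((shifted n ^ m) g : Heis n → ℂ) p := by
  induction m generalizing f g with
  | zero => rfl
  | succ m ih =>
    rw [shifted_pow_succ_apply, ih (shifted_mem_Test hf), integral_shifted_mul hf]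
    rw [pow_succ']
    rfl

theorem shifted_pow_ltrS (m : ℕ) (a : Heis n) (f : Smooth n) :
    (shifted n ^ m) (ltrS a f) = ltrS a ((shifted n ^ m) f) := by
  induction m generalizing f with
  | zero => rfl
  | succ m ih =>
    rw [shifted_pow_succ_apply, shifted_pow_succ_apply, ← ih, shifted_apply, sublaplacian_ltrS,
      shifted_apply, map_add, map_add (ltrS a), map_add]

theorem ltrS_mem_Test (a : Heis n) {f : Smooth n} (hf : f ∈ Test n) : ltrS a f ∈ Test n := by
  obtain ⟨k, hk, hk'⟩ := exists_isCompact_ltr hf a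
  exact HasCompactSupport.intro hk fun x hx => hk' a x (Metric.mem_ball_self one_pos) hx

/-- Left translations and convolution from the left commute. -/
theorem integral_gconv_mul {φ ψ : Smooth n} (hφ : φ ∈ Test n) (hψ : ψ ∈ Test n) {G : Heis n → ℂ}
    (hG : LocallyIntegrable G volume) :
    ∫ p, gconv φ G p * (ψ : Heis n → ℂ) p =
      ∫ r, (φ : Heis n → ℂ) r * ∫ q, (ltrS r ψ : Heis n → ℂ) q * G q := by
  have cφ := (contDiff_coe φ).continuous
  have cψ := (contDiff_coe ψ).continuous
  have cl := (contDiff_ltr_uncurry (n := n)).continuous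
  have h1 := integrable_mul_snd
    (Φ := fun z => (φ : Heis n → ℂ) z.1 * (ψ : Heis n → ℂ) (ltr z.1 z.2))
    ((cφ.comp continuous_fst).mul (cψ.comp cl)) (hasCompactSupport_mul_ltr hφ hψ) hG
  have h2 := integrable_mul_snd
    (Φ := fun z => (ψ : Heis n → ℂ) z.1 * (φ : Heis n → ℂ) (ltr z.1 (-z.2)))
    ((cψ.comp continuous_fst).mul (cφ.comp (cl.comp (continuous_fst.prodMk continuous_snd.neg))))
    ((hasCompactSupport_mul_ltr hψ hφ).comp_homeomorph
      ((Homeomorph.refl (Heis n)).prodCongr (Homeomorph.neg (Heis n)))) hG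
  have e1 : ∀ p, gconv φ G p * (ψ : Heis n → ℂ) p =
      ∫ q, (ψ : Heis n → ℂ) p * (φ : Heis n → ℂ) (ltr p (-q)) * G q := fun p => by
    rw [gconv, ← integral_mul_const]
    exact integral_congr_ae (Eventually.of_forall fun q => by ring)
  have e2 : ∀ r, (φ : Heis n → ℂ) r * ∫ q, (ltrS r ψ : Heis n → ℂ) q * G q =
      ∫ q, (φ : Heis n → ℂ) r * (ψ : Heis n → ℂ) (ltr r q) * G q := fun r => by
    rw [← integral_const_mul]
    exact integral_congr_ae (Eventually.of_forall fun q => (mul_assoc _ _ _).symm)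
  simp only [e1, e2]
  refine (integral_integral_swap h2).trans (Eq.trans ?_ (integral_integral_swap h1).symm)
  refine integral_congr_ae (Eventually.of_forall fun q => ?_)
  simp only
  -- Substitution p = r q, with right translation preserving the measure.
  rw [← integral_comp_of_measurePreserving (measurePreserving_ltr_right q)]
  · refine integral_congr_ae (Eventually.of_forall fun r => ?_)
    simp only [ltr_ltr_neg]
    ring
  · have : Continuous fun p => (ψ : Heis n → ℂ) p * (φ : Heis n → ℂ) (ltr p (-q)) * G q := by
      refine (cψ.mul (cφ.comp (cl.comp (continuous_id.prodMk continuous_const)))).mul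
        continuous_const
    exact this.aestronglyMeasurable

theorem Smooth.eq_zero_of_integral {u : Smooth n}
    (h : ∀ ψ ∈ Test n, ∫ p, (ψ : Heis n → ℂ) p * (u : Heis n → ℂ) p = 0) : u = 0 := by
  have hc := (contDiff_coe u).continuous
  have h1 : ∀ᵐ p, (u : Heis n → ℂ) p = 0 := by
    refine ae_eq_zero_of_integral_contDiff_smul_eq_zero hc.locallyIntegrable fun g hg hgs => ?_
    refine (integral_congr_ae (Eventually.of_forall fun p => ?_)).trans
      (h ⟨fun p => (g p : ℂ), Complex.ofRealCLM.contDiff.comp hg⟩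
        (hgs.comp_left (g := fun x : ℝ => (x : ℂ)) Complex.ofReal_zero))
    simp
  have := (Continuous.ae_eq_iff_eq volume hc continuous_zero).1 h1
  ext p
  exact congrFun this p

/-- The image of the test functions under `(I + ℒ)^m` is total in `L²`. -/
theorem eq_zero_of_inner_shifted_pow_eq_zero (m : ℕ) (g : L2 n)
    (h : ∀ f ∈ Test n, ⟪g, cls ((shifted n ^ m) f)⟫_ℂ = 0) : g = 0 := by
  set G : Heis n → ℂ := fun q => (starRingEnd ℂ) (g q) with hGdef
  have hG2 : MemLp G 2 volume :=
    (Lp.memLp g).star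
  have hG : LocallyIntegrable G volume := hG2.locallyIntegrable (by norm_num)
  have h1 : ∀ f ∈ Test n, ∫ q, ((shifted n ^ m) f : Heis n → ℂ) q * G q = 0 := fun f hf => by
    rw [← h f hf, L2.inner_def]
    refine integral_congr_ae ?_
    filter_upwards [coeFn_cls (memLp_of_mem_Test (shifted_pow_mem_Test m hf))] with q hq
    rw [hq]
    simp [hGdef]
  -- By left invariance of ℒ, the equation (I + ℒ)^m G = 0, known only weakly, passes to the smooth
  -- function `gconv φ G`, where uniqueness applies.
  have h2 : ∀ φ ∈ Test n, gconv φ G = 0 := fun φ hφ => by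
    set u : Smooth n := ⟨gconv φ G, contDiff_gconv hG hφ⟩ with hu
    have hz : (shifted n ^ m) u = 0 := by
      refine Smooth.eq_zero_of_integral fun ψ hψ => ?_
      rw [← integral_shifted_pow_mul m hψ]
      have := integral_gconv_mul hφ (shifted_pow_mem_Test m hψ) hG
      simp only [← shifted_pow_ltrS, h1 _ (ltrS_mem_Test _ hψ), mul_zero, integral_zero] at this
      rw [← this]
      exact integral_congr_ae (Eventually.of_forall fun p => mul_comm _ _)
    have := eq_zero_of_shifted_pow_eq_zero hG2 (.gconv φ u hφ rfl) m hz
    exact congrArg (fun v : Smooth n => (v : Heis n → ℂ)) this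
  rw [Lp.eq_zero_iff_ae_eq_zero]
  have h3 : ∀ᵐ q, G q = 0 := by
    -- The value at the origin of the convolution with ρ(-p) is the integral of ρG.
    refine ae_eq_zero_of_integral_contDiff_smul_eq_zero hG fun ρ hρ hρs => ?_
    have hs : HasCompactSupport fun p : Heis n => (ρ (-p) : ℂ) :=
      (hρs.comp_left (g := fun x : ℝ => (x : ℂ)) Complex.ofReal_zero).comp_homeomorph
        (Homeomorph.neg (Heis n))
    have := congrFun (h2 ⟨fun p => (ρ (-p) : ℂ),
      Complex.ofRealCLM.contDiff.comp (hρ.comp contDiff_neg)⟩ hs) 0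
    refine Eq.trans (integral_congr_ae (Eventually.of_forall fun q => ?_)) this
    simp [ltr, symp, mul_comm]
  filter_upwards [h3] with q hq
  simpa [hGdef] using hq

/-! ### Powers of a positive contraction -/

section Abstract

variable {H : Type*} [NormedAddCommGroup H] [InnerProductSpace ℂ H] [CompleteSpace H]
  {a : H →L[ℂ] H}

theorem opPow_eq_cfc (ha : 0 ≤ a) (y : ℝ) : opPow a y = cfc (fun x : ℝ => x ^ y) a :=
  CFC.rpow_eq_cfc_real ha

theorem opPow_add (ha : 0 ≤ a) {x y : ℝ} (hx : 0 ≤ x) (hy : 0 ≤ y) :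
    opPow a (x + y) = opPow a x * opPow a y := by
  have hc : ∀ r : ℝ, 0 ≤ r → ContinuousOn (fun x : ℝ => x ^ r) (spectrum ℝ a) :=
    fun r hr => (Real.continuous_rpow_const hr).continuousOn
  rw [opPow_eq_cfc ha, opPow_eq_cfc ha, opPow_eq_cfc ha, ← cfc_mul _ _ a (hc _ hx) (hc _ hy)]
  exact cfc_congr fun z hz => Real.rpow_add_of_nonneg (spectrum_nonneg_of_nonneg ha hz) hx hy

theorem opPow_natCast (ha : 0 ≤ a) (m : ℕ) : opPow a m = a ^ m := CFC.rpow_natCast a m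

theorem isSelfAdjoint_opPow (ha : 0 ≤ a) (y : ℝ) : IsSelfAdjoint (opPow a y) := by
  rw [opPow_eq_cfc ha]
  exact cfc_predicate _ _

theorem inner_opPow_left (ha : 0 ≤ a) (y : ℝ) (u v : H) :
    ⟪opPow a y u, v⟫_ℂ = ⟪u, opPow a y v⟫_ℂ := by
  rw [← ContinuousLinearMap.adjoint_inner_right, (isSelfAdjoint_opPow ha y).adjoint_eq]

/-- The functional calculus preserves the order f² ≤ (Kg)² on the spectrum; testing the operator
inequality on u gives the norms, without spectral measures. -/
theorem norm_cfc_apply_le {f g : ℝ → ℝ} {K : ℝ} (hK : 0 ≤ K) (hf : Continuous f)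
    (hg : ContinuousOn g (spectrum ℝ a)) (h : ∀ x ∈ spectrum ℝ a, |f x| ≤ K * |g x|) (u : H) :
    ‖cfc f a u‖ ≤ K * ‖cfc g a u‖ := by
  have hsq : ∀ k : ℝ → ℝ, ContinuousOn k (spectrum ℝ a) →
      ‖cfc k a u‖ ^ 2 = (⟪cfc (fun x => k x * k x) a u, u⟫_ℂ).re := fun k hk => by
    have hsa : IsSelfAdjoint (cfc k a) := cfc_predicate _ _
    rw [cfc_mul k k a hk hk, mul_apply_eq_comp,
      ← ContinuousLinearMap.adjoint_inner_right, hsa.adjoint_eq]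
    exact norm_sq_eq_re_inner (𝕜 := ℂ) _
  have hle : cfc (fun x => f x * f x) a ≤ cfc (fun x => K * g x * (K * g x)) a := by
    refine cfc_mono (fun x hx => ?_) (by fun_prop) (by fun_prop)
    rw [← pow_two, ← pow_two, ← sq_abs (f x), ← sq_abs (K * g x), abs_mul, abs_of_nonneg hK]
    gcongr
    exact h x hx
  have h1 := ((ContinuousLinearMap.le_def _ _).1 hle).re_inner_nonneg_left u
  rw [sub_apply, inner_sub_left, map_sub] at h1
  have h2 := hsq f hf.continuousOn
  have h3 := hsq (fun x => K * g x) (by fun_prop)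
  rw [cfc_const_mul K g a hg, smul_apply, norm_smul, Real.norm_of_nonneg hK] at h3
  refine le_of_sq_le_sq ?_ (by positivity)
  rw [h2, h3]
  simpa using h1

theorem spectrum_le_one (ha1 : ‖a‖ ≤ 1) {x : ℝ} (hx : x ∈ spectrum ℝ a) : x ≤ 1 := by
  have h := spectrum.norm_le_norm_mul_of_mem hx
  have h1 : ‖(1 : H →L[ℂ] H)‖ ≤ 1 := ContinuousLinearMap.norm_id_le
  calc x ≤ ‖x‖ := le_abs_self x
    _ ≤ _ := h
    _ ≤ 1 * 1 := by gcongr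
    _ = 1 := one_mul 1

theorem norm_opPow_apply_le (ha : 0 ≤ a) (ha1 : ‖a‖ ≤ 1) {y : ℝ} (hy : 0 ≤ y) (u : H) :
    ‖opPow a y u‖ ≤ ‖u‖ := by
  have := norm_cfc_apply_le (a := a) (f := fun x => x ^ y) (g := fun _ => 1) zero_le_one
    (Real.continuous_rpow_const hy) continuousOn_const (fun x hx => by
      have h0 := spectrum_nonneg_of_nonneg ha hx
      rw [abs_of_nonneg (Real.rpow_nonneg h0 _), abs_one, mul_one]
      exact Real.rpow_le_one h0 (spectrum_le_one ha1 hx) hy) u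
  rw [opPow_eq_cfc ha]
  simpa [cfc_const_one ℝ a (IsSelfAdjoint.of_nonneg ha)] using this

/-- A continuous function which is `1` on `[0, ε]` and `0` on `[2 ε, ∞)`. -/
def lowPass (ε x : ℝ) : ℝ := max 0 (min 1 (2 - x / ε))

theorem continuous_lowPass (ε : ℝ) : Continuous (lowPass ε) := by
  unfold lowPass; fun_prop

theorem lowPass_nonneg (ε x : ℝ) : 0 ≤ lowPass ε x := le_max_left _ _

theorem lowPass_le_one (ε x : ℝ) : lowPass ε x ≤ 1 := max_le zero_le_one (min_le_left _ _)

theorem lowPass_eq_one {ε x : ℝ} (hε : 0 < ε) (hx : x ≤ ε) : lowPass ε x = 1 := by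
  have : x / ε ≤ 1 := (div_le_one hε).2 hx
  rw [lowPass, min_eq_left (by linarith), max_eq_right zero_le_one]

theorem lowPass_eq_zero {ε x : ℝ} (hε : 0 < ε) (hx : 2 * ε ≤ x) : lowPass ε x = 0 := by
  have : 2 ≤ x / ε := (le_div_iff₀ hε).2 hx
  exact max_eq_left ((min_le_right _ _).trans (by linarith))

/-- For a = (I + ℒ)⁻¹ the operator a + ε(1 - a) is (I + εℒ)(I + ℒ)⁻¹, the rescaled operator seen
from the resolvent. -/
theorem cfc_add_smul_pow (ha : IsSelfAdjoint a) (ε : ℝ) (m : ℕ) :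
    cfc (fun x : ℝ => (x + ε * (1 - x)) ^ m) a = (a + (ε : ℂ) • (1 - a)) ^ m := by
  rw [cfc_pow _ _ _ (by fun_prop) ha, cfc_add a (fun x => x) (fun x => ε * (1 - x)),
    cfc_const_mul ε (fun x => 1 - x), cfc_sub (fun _ => 1) (fun x => x), cfc_id' ℝ _ ha,
    cfc_const_one ℝ _ ha, Complex.coe_smul]

/-- A form of the Sobolev embedding: a functional which is controlled on every scale is controlled
by a power of the operator. -/
theorem exists_norm_le_opPow (ha : 0 ≤ a) (ha1 : ‖a‖ ≤ 1) (ℓ : H →ₗ[ℂ] ℂ) (m d : ℕ) {C : ℝ}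
    (hC : 0 ≤ C) (hscale : ∀ r : ℝ, 0 < r → ∀ u,
      ‖ℓ u‖ ≤ C * (r ^ d)⁻¹ * ‖((a + ((r ^ 2 : ℝ) : ℂ) • (1 - a)) ^ m) u‖)
    {b : ℝ} (hb : 0 ≤ b) (hd : d < 2 * (m - b)) :
    ∃ C' : ℝ, 0 ≤ C' ∧ ∀ u, ‖ℓ u‖ ≤ C' * ‖opPow a b u‖ := by
  have hsa : IsSelfAdjoint a := IsSelfAdjoint.of_nonneg ha
  have hℓ : ∀ r : ℝ, 0 < r → ∀ u,
      ‖ℓ u‖ ≤ C * (r ^ d)⁻¹ * ‖cfc (fun x : ℝ => (x + r ^ 2 * (1 - x)) ^ m) a u‖ :=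
    fun r hr u => by rw [cfc_add_smul_pow hsa]; exact hscale r hr u
  -- The gap in the hypothesis `hd`; along the scales 2^{-i} it yields a geometric series of ratio ρ
  -- = 2^{-δ} < 1.
  set δ : ℝ := 2 * (m - b) - d with hδ
  have hδ0 : 0 < δ := by rw [hδ]; linarith
  set r : ℕ → ℝ := fun i => (1 / 2) ^ i with hr
  have hr0 : ∀ i, 0 < r i := fun i => by positivity
  have hr1 : ∀ i, r i ≤ 1 := fun i => pow_le_one₀ (by norm_num) (by norm_num)
  set ρ : ℝ := (1 / 2 : ℝ) ^ δ with hρ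
  have hρ0 : 0 ≤ ρ := by positivity
  have hρ1 : ρ < 1 := Real.rpow_lt_one (by norm_num) (by norm_num) hδ0
  have hrδ : ∀ i, (r i) ^ δ = ρ ^ i := fun i => by
    simp only [hr, hρ]
    rw [← Real.rpow_natCast, ← Real.rpow_natCast, ← Real.rpow_mul (by norm_num),
      ← Real.rpow_mul (by norm_num), mul_comm]
  have hpow : ∀ i, (r i ^ d)⁻¹ * (r i ^ 2) ^ ((m : ℝ) - b) = ρ ^ i := fun i => by
    rw [← hrδ, hδ, ← Real.rpow_natCast, ← Real.rpow_natCast, ← Real.rpow_mul (hr0 i).le,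
      ← Real.rpow_neg (hr0 i).le, ← Real.rpow_add (hr0 i)]
    congr 1
    push_cast
    ring
  have hF : ∀ i, Continuous fun x : ℝ => (x + r i ^ 2 * (1 - x)) ^ m := fun i => by fun_prop
  have hFle : ∀ i x, 0 ≤ x → x ≤ 1 → x ≤ 2 * r i ^ 2 →
      |(x + r i ^ 2 * (1 - x)) ^ m| ≤ 3 ^ m * (r i ^ 2) ^ m := fun i x h0 h1 h2 => by
    have h3 : 0 ≤ x + r i ^ 2 * (1 - x) := by
      have := mul_nonneg (sq_nonneg (r i)) (sub_nonneg.2 h1)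
      linarith
    rw [abs_of_nonneg (by positivity), ← mul_pow]
    have h4 : r i ^ 2 * (1 - x) ≤ r i ^ 2 :=
      mul_le_of_le_one_right (by positivity) (by linarith)
    gcongr
    linarith
  set E : ℕ → H →L[ℂ] H := fun i => cfc (lowPass (r i ^ 2)) a with hE
  have hE0 : E 0 = 1 := by
    rw [hE, ← cfc_const_one ℝ a hsa]
    refine cfc_congr fun x hx => ?_
    exact lowPass_eq_one (by simp [hr]) (by simpa [hr] using spectrum_le_one ha1 hx)
  -- The block `E i - E (i + 1)` lives where r²/4 < x < 2r², with r = `r i`. There (x + r²(1 - x))^m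
  -- ≤ (3r²)^m and r^{2b} ≤ 4^b x^b, so the inequality at scale r costs r^{-d} r^{2(m-b)} = ρ^i.
  have hstep : ∀ i u, ‖ℓ (E i u)‖ ≤
      ‖ℓ (E (i + 1) u)‖ + C * (3 ^ m * 4 ^ b) * ‖opPow a b u‖ * ρ ^ i := by
    intro i u
    have e1 : E i u = E (i + 1) u +
        cfc (fun x => lowPass (r i ^ 2) x - lowPass (r (i + 1) ^ 2) x) a u := by
      rw [cfc_sub _ _ a (continuous_lowPass _).continuousOn (continuous_lowPass _).continuousOn,
        sub_apply]
      simp [hE]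
    have hψ : Continuous fun x => lowPass (r i ^ 2) x - lowPass (r (i + 1) ^ 2) x :=
      (continuous_lowPass _).sub (continuous_lowPass _)
    have hrs : r (i + 1) ^ 2 = r i ^ 2 / 4 := by
      simp only [hr, pow_succ]; ring
    have h2 := hℓ (r i) (hr0 i)
      (cfc (fun x => lowPass (r i ^ 2) x - lowPass (r (i + 1) ^ 2) x) a u)
    rw [← mul_apply_eq_comp, ← cfc_mul _ _ a (hF i).continuousOn hψ.continuousOn] at h2
    have h3 := norm_cfc_apply_le (a := a) (K := 3 ^ m * 4 ^ b * (r i ^ 2) ^ ((m : ℝ) - b))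
      (f := fun x => (x + r i ^ 2 * (1 - x)) ^ m *
        (lowPass (r i ^ 2) x - lowPass (r (i + 1) ^ 2) x))
      (g := fun x => x ^ b) (by positivity) ((hF i).mul hψ)
      (Real.continuous_rpow_const hb).continuousOn (fun x hx => by
        have hx0 := spectrum_nonneg_of_nonneg ha hx
        have hx1 := spectrum_le_one ha1 hx
        have hε : 0 < r i ^ 2 := by have := hr0 i; positivity
        rw [abs_mul, abs_of_nonneg (Real.rpow_nonneg hx0 b)]
        rcases le_or_gt (2 * r i ^ 2) x with hx2 | hx2
        · rw [lowPass_eq_zero hε hx2,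
            lowPass_eq_zero (by rw [hrs]; linarith) (by rw [hrs]; linarith)]
          simp only [sub_zero, abs_zero, mul_zero]
          positivity
        rcases le_or_gt x (r i ^ 2 / 4) with hx3 | hx3
        · rw [lowPass_eq_one hε (by linarith),
            lowPass_eq_one (by rw [hrs]; linarith) (by rw [hrs]; linarith)]
          simp only [sub_self, abs_zero, mul_zero]
          positivity
        · have h4 : |lowPass (r i ^ 2) x - lowPass (r (i + 1) ^ 2) x| ≤ 1 := by
            rw [abs_le]
            constructor <;> linarith [lowPass_nonneg (r i ^ 2) x, lowPass_le_one (r i ^ 2) x,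
              lowPass_nonneg (r (i + 1) ^ 2) x, lowPass_le_one (r (i + 1) ^ 2) x]
          have h5 : (r i ^ 2) ^ b ≤ 4 ^ b * x ^ b := by
            rw [← Real.mul_rpow (by norm_num) hx0]
            exact Real.rpow_le_rpow hε.le (by linarith) hb
          have h6 : (r i ^ 2) ^ m = (r i ^ 2) ^ ((m : ℝ) - b) * (r i ^ 2) ^ b := by
            rw [← Real.rpow_add hε, sub_add_cancel, Real.rpow_natCast]
          calc _ ≤ 3 ^ m * (r i ^ 2) ^ m * 1 :=
                mul_le_mul (hFle i x hx0 hx1 hx2.le) h4 (abs_nonneg _) (by positivity)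
            _ = 3 ^ m * (r i ^ 2) ^ ((m : ℝ) - b) * (r i ^ 2) ^ b := by rw [h6]; ring
            _ ≤ 3 ^ m * (r i ^ 2) ^ ((m : ℝ) - b) * (4 ^ b * x ^ b) := by gcongr
            _ = _ := by ring) u
    rw [← opPow_eq_cfc ha] at h3
    calc ‖ℓ (E i u)‖ ≤ ‖ℓ (E (i + 1) u)‖ + _ := by
          rw [e1, map_add]; exact norm_add_le _ _
      _ ≤ ‖ℓ (E (i + 1) u)‖ + C * (r i ^ d)⁻¹ *
          (3 ^ m * 4 ^ b * (r i ^ 2) ^ ((m : ℝ) - b) * ‖opPow a b u‖) := by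
          refine add_le_add le_rfl (h2.trans ?_)
          have := hr0 i
          gcongr
      _ = ‖ℓ (E (i + 1) u)‖ + C * (3 ^ m * 4 ^ b) * ‖opPow a b u‖ *
          ((r i ^ d)⁻¹ * (r i ^ 2) ^ ((m : ℝ) - b)) := by ring
      _ = _ := by rw [hpow]
  -- The remainder lives where x < 2r²; the same bound with ‖u‖ in place of ‖a^b u‖ suffices, as r ≤
  -- 1 and b ≥ 0.
  have hend : ∀ u, Tendsto (fun N => ‖ℓ (E N u)‖) atTop (𝓝 0) := by
    intro u
    have hle : ∀ N, ‖ℓ (E N u)‖ ≤ C * 3 ^ m * ‖u‖ * ρ ^ N := by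
      intro N
      have h2 := hℓ (r N) (hr0 N) (E N u)
      rw [← mul_apply_eq_comp, ← cfc_mul _ _ a (hF N).continuousOn
        (continuous_lowPass _).continuousOn] at h2
      have hε : 0 < r N ^ 2 := by have := hr0 N; positivity
      have h3 := norm_cfc_apply_le (a := a) (K := 3 ^ m * (r N ^ 2) ^ m)
        (f := fun x => (x + r N ^ 2 * (1 - x)) ^ m * lowPass (r N ^ 2) x)
        (g := fun _ => 1) (by positivity) ((hF N).mul (continuous_lowPass (r N ^ 2)))
        continuousOn_const (fun x hx => by
          have hx0 := spectrum_nonneg_of_nonneg ha hx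
          have hx1 := spectrum_le_one ha1 hx
          rw [abs_mul, abs_one]
          rcases le_or_gt (2 * r N ^ 2) x with hx2 | hx2
          · rw [lowPass_eq_zero hε hx2]
            simp only [abs_zero, mul_zero]
            positivity
          · refine mul_le_mul (hFle N x hx0 hx1 hx2.le) ?_ (abs_nonneg _) (by positivity)
            rw [abs_of_nonneg (lowPass_nonneg _ _)]
            exact lowPass_le_one _ _) u
      rw [cfc_const_one ℝ a hsa, one_apply_eq_self] at h3
      have h4 : (r N ^ 2) ^ m ≤ (r N ^ 2) ^ ((m : ℝ) - b) := by
        rw [← Real.rpow_natCast _ m]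
        exact Real.rpow_le_rpow_of_exponent_ge hε (pow_le_one₀ (hr0 N).le (hr1 N)) (by linarith)
      calc ‖ℓ (E N u)‖ ≤ C * (r N ^ d)⁻¹ * (3 ^ m * (r N ^ 2) ^ ((m : ℝ) - b) * ‖u‖) := by
            refine h2.trans ?_
            have := hr0 N
            gcongr
            refine h3.trans ?_
            gcongr
        _ = C * 3 ^ m * ‖u‖ * ((r N ^ d)⁻¹ * (r N ^ 2) ^ ((m : ℝ) - b)) := by ring
        _ = _ := by rw [hpow]
    refine squeeze_zero (fun _ => norm_nonneg _) hle ?_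
    simpa using (tendsto_pow_atTop_nhds_zero_of_lt_one hρ0 hρ1).const_mul (C * 3 ^ m * ‖u‖)
  refine ⟨C * (3 ^ m * 4 ^ b) * (1 - ρ)⁻¹, by have := sub_pos.2 hρ1; positivity, fun u => ?_⟩
  have hsum : ∀ N, ‖ℓ u‖ ≤ ‖ℓ (E N u)‖ +
      C * (3 ^ m * 4 ^ b) * ‖opPow a b u‖ * ∑ i ∈ Finset.range N, ρ ^ i := by
    intro N
    induction N with
    | zero => simp [hE0]
    | succ N ih =>
      rw [Finset.sum_range_succ, mul_add]
      linarith [hstep N u]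
  have hlim := (hend u).add_const
    (C * (3 ^ m * 4 ^ b) * ‖opPow a b u‖ * (1 - ρ)⁻¹)
  rw [zero_add] at hlim
  refine le_of_le_of_eq (ge_of_tendsto' hlim fun N => (hsum N).trans ?_) (by ring)
  gcongr
  rw [← tsum_geometric_of_lt_one hρ0 hρ1]
  exact (summable_geometric_of_lt_one hρ0 hρ1).sum_le_tsum _ fun i _ => by positivity

end Abstract

theorem exists_extension {E H : Type*} [NormedAddCommGroup H] [InnerProductSpace ℂ H]
    [AddCommGroup E] [Module ℂ E] {e : E →ₗ[ℂ] H}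
    (he : DenseRange e) {f : E →ₗ[ℂ] ℂ} {C : ℝ} (hf : ∀ x, ‖f x‖ ≤ C * ‖e x‖) :
    ∃ ℓ : H →L[ℂ] ℂ, ∀ x, ℓ (e x) = f x :=
  ⟨f.extendOfNorm e, LinearMap.extendOfNorm_eq he ⟨C, hf⟩⟩

/-! ### Evaluation at the origin in Sobolev spaces -/

theorem resolvent_nonneg (n : ℕ) : 0 ≤ resolvent n :=
  (ContinuousLinearMap.nonneg_iff_isPositive _).2 (resolvent_isPositive n)

theorem norm_resolvent_le (n : ℕ) : ‖resolvent n‖ ≤ 1 :=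
  ContinuousLinearMap.opNorm_le_bound _ zero_le_one fun f => by
    rw [one_mul]; exact norm_resolvent_apply_le f

theorem shifted_pow_shiftedBy (m : ℕ) (ε : ℝ) (f : Smooth n) :
    (shifted n ^ m) (shiftedBy n ε f) = shiftedBy n ε ((shifted n ^ m) f) := by
  have h : Commute (shifted n ^ m) (shiftedBy n ε) := by
    refine Commute.pow_left ?_ m
    refine (Commute.one_right _).add_right (Commute.smul_right ?_ _)
    exact (Commute.one_left _).add_left (Commute.refl _)
  exact congrArg (fun P : Module.End ℂ (Smooth n) => P f) h.eq

theorem resolvent_pow_shiftedBy (ε : ℝ) (m : ℕ) {f : Smooth n} (hf : f ∈ Test n) :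
    ((resolvent n + (ε : ℂ) • (1 - resolvent n)) ^ m) (cls ((shifted n ^ m) f)) =
      cls ((shiftedBy n ε ^ m) f) := by
  have hstep : ∀ g ∈ Test n, (resolvent n + (ε : ℂ) • (1 - resolvent n)) (cls (shifted n g)) =
      cls (shiftedBy n ε g) := fun g hg => by
    have hS := Test_le_Sch hg
    have hL := sublaplacian_mem_Sch hS
    rw [add_apply, smul_apply, sub_apply, one_apply_eq_self, resolvent_shifted hS, shifted_apply,
      shiftedBy_apply, cls_add hS hL, cls_add hS (Submodule.smul_mem _ _ hL), cls_smul _ hL,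
      add_sub_cancel_left]
  induction m generalizing f with
  | zero => rfl
  | succ m ih =>
    rw [pow_succ, mul_apply_eq_comp, pow_succ', Module.End.mul_apply,
      hstep _ (shifted_pow_mem_Test m hf), ← shifted_pow_shiftedBy, ih (shiftedBy_mem_Test ε hf),
      pow_succ]
    rfl

/-- The operator `(I + ℒ)^m` on test functions, with values in `L²`. -/
def testShift (n m : ℕ) : Test n →ₗ[ℂ] L2 n where
  toFun f := cls ((shifted n ^ m) (f : Smooth n))
  map_add' f g := by
    rw [Submodule.coe_add, map_add, cls_add (Test_le_Sch (shifted_pow_mem_Test m f.2))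
      (Test_le_Sch (shifted_pow_mem_Test m g.2))]
  map_smul' c f := by
    rw [Submodule.coe_smul, map_smul, cls_smul _ (Test_le_Sch (shifted_pow_mem_Test m f.2))]
    rfl

theorem denseRange_testShift (n m : ℕ) : DenseRange (testShift n m) := by
  have h : (LinearMap.range (testShift n m))ᗮ = ⊥ := by
    rw [Submodule.eq_bot_iff]
    intro g hg
    exact eq_zero_of_inner_shifted_pow_eq_zero m g fun f hf =>
      (Submodule.mem_orthogonal' _ _).1 hg _ ⟨⟨f, hf⟩, rfl⟩
  exact (Submodule.dense_iff_topologicalClosure_eq_top.2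
    ((Submodule.topologicalClosure_eq_top_iff).2 h))

/-- Evaluation at the origin. -/
def evalZero (n : ℕ) : Test n →ₗ[ℂ] ℂ where
  toFun f := ((f : Smooth n) : Heis n → ℂ) 0
  map_add' _ _ := rfl
  map_smul' _ _ := rfl

theorem exists_extension_Test {e : Test n →ₗ[ℂ] L2 n} (he : DenseRange e) {f : Test n →ₗ[ℂ] ℂ}
    {C : ℝ} (hf : ∀ x, ‖f x‖ ≤ C * ‖e x‖) : ∃ ℓ : L2 n →L[ℂ] ℂ, ∀ x, ℓ (e x) = f x := by
  have h := @exists_extension (Test n) (L2 n) _ _ _ _ e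
  exact @h he f C hf

/-- The crude inequality makes f(0) a bounded functional of (I + ℒ)^m f. It extends to L² by
density, and the rescaled inequalities pass to the limit. -/
theorem exists_evalZero (hn : 1 ≤ n) : ∃ (m₀ : ℕ) (C : ℝ), 0 ≤ C ∧ ∀ m ≥ m₀,
    ∃ ℓ : L2 n →L[ℂ] ℂ, (∀ f ∈ Test n, ℓ (cls ((shifted n ^ m) f)) = (f : Heis n → ℂ) 0) ∧
      ∀ r : ℝ, 0 < r → ∀ u : L2 n, ‖ℓ u‖ ≤ C * (r ^ (n + 1))⁻¹ *
        ‖((resolvent n + ((r ^ 2 : ℝ) : ℂ) • (1 - resolvent n)) ^ m) u‖ := by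
  obtain ⟨m₀, C, hC, hb⟩ := exists_norm_apply_zero_le_shiftedBy hn
  refine ⟨m₀, C, hC, fun m hm => ?_⟩
  have hd := denseRange_testShift n m
  have hnorm : ∀ f : Test n, ‖evalZero n f‖ ≤ C * ‖testShift n m f‖ := fun f => by
    have h := hb m hm 1 one_pos f f.2
    rw [one_pow, inv_one, mul_one, one_pow] at h
    have e : shiftedBy n 1 = shifted n := by simp [shiftedBy, shifted]
    rwa [e] at h
  obtain ⟨ℓ, hℓ⟩ := exists_extension_Test hd hnorm
  refine ⟨ℓ, fun f hf => hℓ ⟨f, hf⟩, fun r hr u => ?_⟩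
  refine hd.induction_on (p := fun u => ‖ℓ u‖ ≤ C * (r ^ (n + 1))⁻¹ *
    ‖((resolvent n + ((r ^ 2 : ℝ) : ℂ) • (1 - resolvent n)) ^ m) u‖) u
    (isClosed_le ℓ.continuous.norm (continuous_const.mul
      (ContinuousLinearMap.continuous _).norm)) fun f => ?_
  rw [hℓ]
  have e : testShift n m f = cls ((shifted n ^ m) (f : Smooth n)) := rfl
  rw [e, resolvent_pow_shiftedBy _ _ f.2]
  exact hb m hm r hr f f.2

/-- The norm on the right is that of (I + ℒ)f in W^{s,2}. With b = m - 1 - s/2 and d = n + 1, the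
condition d < 2(m - b) = s + 2 is exactly n - 1 < s. -/
theorem exists_norm_apply_zero_le_opPow (hn : 1 ≤ n) {s : ℝ} (hs : (n : ℝ) - 1 < s) :
    ∃ (m : ℕ) (C : ℝ), 0 ≤ C ∧ 1 + s / 2 ≤ m ∧ ∀ f ∈ Sch n,
      ‖(f : Heis n → ℂ) 0‖ ≤
        C * ‖opPow (resolvent n) (m - 1 - s / 2) (cls ((shifted n ^ m) f))‖ := by
  obtain ⟨m₀, C, hC, hb⟩ := exists_evalZero hn
  obtain ⟨m₁, hm₁⟩ := exists_nat_ge (1 + s / 2)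
  set m := max m₀ m₁ with hm
  have hms : 1 + s / 2 ≤ (m : ℝ) := hm₁.trans (by exact_mod_cast le_max_right _ _)
  obtain ⟨ℓ, hℓ, hscale⟩ := hb m (le_max_left _ _)
  obtain ⟨C', hC', hle⟩ := exists_norm_le_opPow (resolvent_nonneg n) (norm_resolvent_le n)
    ℓ.toLinearMap m (n + 1) hC hscale (b := m - 1 - s / 2) (by linarith) (by push_cast; linarith)
  refine ⟨m, C', hC', hms, fun f hf => ?_⟩
  obtain ⟨χ, hχ, hχ1⟩ := exists_cutoff n
  have h1 : (χ : Heis n → ℂ) 0 = 1 := hχ1.self_of_nhds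
  -- Cutoffs carry the identity for `ℓ` from test functions to `f`; they keep the value at the
  -- origin, which dilations fix.
  have hlim := (isCutoffOp_shifted_pow m).tendsto χ hχ f hf
  rw [h1, one_smul] at hlim
  have h2 := (ℓ.continuous.tendsto _).comp hlim
  have h3 : ∀ᶠ ε : ℝ in 𝓝[>] 0, (ℓ ∘ fun ε : ℝ => cls ((shifted n ^ m) (mulS (dilS ε χ) f))) ε =
      (f : Heis n → ℂ) 0 := by
    filter_upwards [self_mem_nhdsWithin] with ε hε
    have hT := mulS_mem_Test_left f (dilS_mem_Test (ne_of_gt hε) hχ)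
    refine (hℓ _ hT).trans ?_
    rw [mulS_apply, dilS_apply, map_zero, h1, one_mul]
  have h4 : ℓ (cls ((shifted n ^ m) f)) = (f : Heis n → ℂ) 0 :=
    tendsto_nhds_unique h2 (tendsto_const_nhds.congr' (h3.mono fun _ h => h.symm))
  rw [← h4]
  exact hle _

namespace Sobolev

variable {s : ℝ≥0}

theorem toL2_ofL2 (f : L2 n) : (ofL2 n s f).toL2 = besselPotential n s f := rfl

theorem toL2_eq (u : Sobolev n s) : u.toL2 = besselPotential n s ((ofL2 n s).symm u) := by
  rw [← toL2_ofL2, LinearEquiv.apply_symm_apply]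

theorem toL2_injective : Function.Injective (toL2 : Sobolev n s → L2 n) :=
  Submodule.subtype_injective _

theorem inner_eq (u v : Sobolev n s) : ⟪u, v⟫_ℂ = ⟪(ofL2 n s).symm u, (ofL2 n s).symm v⟫_ℂ := rfl

theorem norm_eq (u : Sobolev n s) : ‖u‖ = ‖(ofL2 n s).symm u‖ := rfl

/-- This represents (I + ℒ)^{s/2} f as R^{k - s/2} (I + ℒ)^k f, so that no unbounded fractional
power is needed. -/
theorem besselPotential_opPow {k : ℕ} (hk : (s : ℝ) / 2 ≤ k) {f : Smooth n} (hf : f ∈ Sch n) :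
    besselPotential n s (opPow (resolvent n) (k - s / 2) (cls ((shifted n ^ k) f))) = cls f := by
  rw [besselPotential, ← mul_apply_eq_comp, ← opPow_add (resolvent_nonneg n) (by positivity)
    (by linarith), add_sub_cancel, opPow_natCast (resolvent_nonneg n),
    resolvent_pow_shifted_pow k hf]

/-- A smooth function with square integrable derivatives, as an element of a Sobolev space. -/
theorem exists_toL2_eq_cls (s : ℝ≥0) {f : Smooth n} (hf : f ∈ Sch n) :
    ∃ u : Sobolev n s, u.toL2 = cls f := by
  obtain ⟨k, hk⟩ := exists_nat_ge ((s : ℝ) / 2)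
  exact ⟨ofL2 n s _, besselPotential_opPow hk hf⟩

theorem ofL2_symm_eq {u : Sobolev n s} {f : Smooth n} (hf : f ∈ Sch n) (hu : u.toL2 = cls f)
    {k : ℕ} (hk : (s : ℝ) / 2 ≤ k) :
    (ofL2 n s).symm u = opPow (resolvent n) (k - s / 2) (cls ((shifted n ^ k) f)) := by
  apply besselPotential_injective n s
  rw [besselPotential_opPow hk hf, ← toL2_eq, hu]

end Sobolev

/-! ### Flat functions -/

theorem mul_prod_ofFn_pow {M : Type*} [Monoid M] {k : ℕ} (x : Fin k → M)
    (hx : ∀ i j, x i * x j = x j * x i) (α : Fin k → ℕ) (j : Fin k) :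
    x j * (List.ofFn fun i => x i ^ α i).prod =
      (List.ofFn fun i => x i ^ (α i + (Pi.single j 1 : Fin k → ℕ) i)).prod := by
  induction k with
  | zero => exact j.elim0
  | succ k ih =>
    rw [List.ofFn_succ, List.ofFn_succ, List.prod_cons, List.prod_cons]
    cases j using Fin.cases with
    | zero =>
      rw [← mul_assoc, ← pow_succ']
      simp
    | succ j =>
      have hc : Commute (x j.succ) (x 0 ^ α 0) := Commute.pow_right (hx _ _) _
      rw [← mul_assoc, hc.eq, mul_assoc,
        ih (fun i => x i.succ) (fun _ _ => hx _ _) (fun i => α i.succ) j]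
      have e : ∀ i : Fin k, (Pi.single j.succ 1 : Fin (k + 1) → ℕ) i.succ =
          (Pi.single j 1 : Fin k → ℕ) i := fun i => by
        simp [Pi.single_apply, Fin.succ_inj]
      simp [e]

theorem exists_prod_map_eq {M : Type*} [Monoid M] {k : ℕ} (x : Fin k → M)
    (hx : ∀ i j, x i * x j = x j * x i) (l : List (Fin k)) :
    ∃ α : Fin k → ℕ, (l.map x).prod = (List.ofFn fun i => x i ^ α i).prod := by
  induction l with
  | nil => exact ⟨0, by simp⟩
  | cons j l ih =>
    obtain ⟨α, hα⟩ := ih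
    exact ⟨fun i => α i + (Pi.single j 1 : Fin k → ℕ) i, by
      rw [List.map_cons, List.prod_cons, hα, mul_prod_ofFn_pow x hx]⟩

theorem X_X_comm (i j : Fin n) : (X i * X j : Module.End ℂ (Smooth n)) = X j * X i :=
  V_comm_of_ne (i := Sum.inl i) (k := Sum.inl j) (by simp)

theorem Y_Y_comm (i j : Fin n) : (Y i * Y j : Module.End ℂ (Smooth n)) = Y j * Y i :=
  V_comm_of_ne (i := Sum.inr i) (k := Sum.inr j) (by simp)

theorem T_wordOp (l : List (Fin n ⊕ Fin n)) (f : Smooth n) :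
    T n (wordOp l f) = wordOp l (T n f) := by
  induction l with
  | nil => rfl
  | cons i l ih => rw [wordOp_cons, Module.End.mul_apply, Module.End.mul_apply, ← ih, ← V_T_apply]

/-- The span of the derivatives `X_{j_1} ⋯ X_{j_k} f`. -/
def xSpan (f : Smooth n) : Submodule ℂ (Smooth n) :=
  Submodule.span ℂ (Set.range fun l : List (Fin n) => wordOp (l.map Sum.inl) f)

theorem X_mem_xSpan (i : Fin n) {f g : Smooth n} (hg : g ∈ xSpan f) : X i g ∈ xSpan f := by
  induction hg using Submodule.span_induction with
  | mem g hg =>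
    obtain ⟨l, rfl⟩ := hg
    exact Submodule.subset_span ⟨i :: l, by simp⟩
  | zero => rw [map_zero]; exact zero_mem _
  | add g h _ _ hg hh => rw [map_add]; exact add_mem hg hh
  | smul c g _ hg => rw [map_smul]; exact Submodule.smul_mem _ c hg

/-- Moving `Y j` past a word in the X's meets a commutator only at the letters `X j`; each leaves
the central `T` and a shorter word. -/
theorem Y_wordOp_sub_mem (j : Fin n) (l : List (Fin n)) (f : Smooth n) :
    Y j (wordOp (l.map Sum.inl) f) - wordOp (l.map Sum.inl) (Y j f) ∈ xSpan (T n f) := by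
  induction l with
  | nil => simp
  | cons i l ih =>
    rw [List.map_cons, wordOp_cons, V_inl, Module.End.mul_apply, Module.End.mul_apply]
    set w := wordOp (l.map Sum.inl) f with hw
    have h1 := X_mem_xSpan i ih
    rw [map_sub] at h1
    by_cases hij : i = j
    · subst hij
      have e : Y i (X i w) = X i (Y i w) + T n w :=
        congrArg (fun P : Module.End ℂ (Smooth n) => P w) (Y_X_comm i)
      have h2 : T n w ∈ xSpan (T n f) := by
        rw [hw, T_wordOp]
        exact Submodule.subset_span ⟨l, rfl⟩
      rw [e, add_sub_right_comm]
      exact add_mem h1 h2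
    · have e : Y j (X i w) = X i (Y j w) :=
        congrArg (fun P : Module.End ℂ (Smooth n) => P w)
          (V_comm_of_ne (i := Sum.inr j) (k := Sum.inl i) (by simpa using hij))
      rw [e]
      exact h1

/-- The span of the derivatives `X^α Y^β T^k f`. -/
def orderedSpan (f : Smooth n) : Submodule ℂ (Smooth n) :=
  Submodule.span ℂ (Set.range fun a : List (Fin n) × List (Fin n) × ℕ =>
    wordOp (a.1.map Sum.inl) (wordOp (a.2.1.map Sum.inr) ((T n ^ a.2.2) f)))

theorem xSpan_le_orderedSpan (l : List (Fin n)) (k : ℕ) (f : Smooth n) :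
    xSpan (wordOp (l.map Sum.inr) ((T n ^ k) f)) ≤ orderedSpan f := by
  refine Submodule.span_le.2 ?_
  rintro _ ⟨l', rfl⟩
  exact Submodule.subset_span ⟨(l', l, k), rfl⟩

theorem V_mem_orderedSpan (i : Fin n ⊕ Fin n) {f g : Smooth n} (hg : g ∈ orderedSpan f) :
    V i g ∈ orderedSpan f := by
  induction hg using Submodule.span_induction with
  | mem g hg =>
    obtain ⟨⟨l, l', k⟩, rfl⟩ := hg
    cases i with
    | inl i => exact Submodule.subset_span ⟨(i :: l, l', k), by simp⟩
    | inr j =>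
      rw [V_inr]
      set g := wordOp (l'.map Sum.inr) ((T n ^ k) f) with hg
      have h1 := Y_wordOp_sub_mem j l g
      have h2 : T n g = wordOp (l'.map Sum.inr) ((T n ^ (k + 1)) f) := by
        rw [hg, T_wordOp, pow_succ']
        rfl
      rw [h2] at h1
      have h3 : wordOp (l.map Sum.inl) (Y j g) ∈ orderedSpan f :=
        Submodule.subset_span ⟨(l, j :: l', k), by simp [hg]⟩
      have := add_mem (xSpan_le_orderedSpan _ _ _ h1) h3
      rwa [sub_add_cancel] at this
  | zero => rw [map_zero]; exact zero_mem _
  | add g h _ _ hg hh => rw [map_add]; exact add_mem hg hh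
  | smul c g _ hg => rw [map_smul]; exact Submodule.smul_mem _ c hg

/-- The domain of A controls only the ordered derivatives X^α Y^β T^k. Reordering, as in the
Poincaré–Birkhoff–Witt theorem, writes every horizontal word through these. -/
theorem flatFunctions_le_Sch : flatFunctions n ≤ Sch n := by
  intro f hf
  have h1 : ∀ g ∈ orderedSpan f, MemLp (g : Heis n → ℂ) 2 volume := by
    intro g hg
    induction hg using Submodule.span_induction with
    | mem g hg =>
      obtain ⟨⟨l, l', k⟩, rfl⟩ := hg
      obtain ⟨α, hα⟩ := exists_prod_map_eq (X (n := n)) X_X_comm l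
      obtain ⟨β, hβ⟩ := exists_prod_map_eq (Y (n := n)) Y_Y_comm l'
      have e1 : wordOp (l.map Sum.inl) = Xpow α := by
        rw [Xpow, ← hα, wordOp, List.map_map]; rfl
      have e2 : wordOp (l'.map Sum.inr) = Ypow β := by
        rw [Ypow, ← hβ, wordOp, List.map_map]; rfl
      simp only [e1, e2]
      exact (hf α β k).1
    | zero => exact MemLp.zero
    | add g h _ _ hg hh => exact hg.add hh
    | smul c g _ hg => exact hg.const_smul c
  intro l
  refine h1 _ ?_
  induction l with
  | nil => exact Submodule.subset_span ⟨([], [], 0), rfl⟩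
  | cons i l ih => rw [wordOp_cons]; exact V_mem_orderedSpan i ih

theorem apply_zero_of_mem_flatFunctions {f : Smooth n} (hf : f ∈ flatFunctions n) :
    (f : Heis n → ℂ) 0 = 0 := by
  have h := (hf 0 0 0).2
  have e1 : Xpow (0 : Fin n → ℕ) = 1 := by simp [Xpow]
  have e2 : Ypow (0 : Fin n → ℕ) = 1 := by simp [Ypow]
  rw [e1, e2] at h
  exact h

theorem mem_flatFunctions_of_eventuallyEq {f : Smooth n} (hf : f ∈ Test n)
    (h0 : (f : Heis n → ℂ) =ᶠ[𝓝 0] 0) : f ∈ flatFunctions n := by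
  let S : Submonoid (Module.End ℂ (Smooth n)) :=
    { carrier := {P | ∀ f ∈ Test n, (f : Heis n → ℂ) =ᶠ[𝓝 0] 0 →
        P f ∈ Test n ∧ (P f : Heis n → ℂ) =ᶠ[𝓝 0] 0}
      mul_mem' := fun {P Q} hP hQ f hf h0 => hP _ (hQ f hf h0).1 (hQ f hf h0).2
      one_mem' := fun f hf h0 => ⟨hf, h0⟩ }
  have hfield : ∀ v hv, fieldOp v hv ∈ S := fun v hv f hf h0 => by
    refine ⟨fieldOp_mem_Test v hv hf, ?_⟩
    filter_upwards [h0.fderiv (𝕜 := ℝ)] with p hp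
    rw [fieldOp_apply, hp]
    simp
  intro α β k
  have hX : Xpow α ∈ S := S.list_prod_mem fun P hP => by
    obtain ⟨j, rfl⟩ := (List.mem_ofFn' _ _).1 hP
    exact S.pow_mem (hfield _ _) _
  have hY : Ypow β ∈ S := S.list_prod_mem fun P hP => by
    obtain ⟨j, rfl⟩ := (List.mem_ofFn' _ _).1 hP
    exact S.pow_mem (hfield _ _) _
  have h := (S.mul_mem hX (S.mul_mem hY (S.pow_mem (hfield _ _ : T n ∈ S) k))) f hf h0
  exact ⟨memLp_of_mem_Test h.1, h.2.self_of_nhds⟩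

/-! ### Concentrated functions -/

/-- The operators `P` for which the norm of `P (η ∘ δ_r · φ)` grows at most like
`r ^ (k - (n + 1))`. -/
structure IsConcentrated (P : Module.End ℂ (Smooth n)) (k : ℕ) : Prop where
  mem_Test : ∀ f ∈ Test n, P f ∈ Test n
  bound : ∀ η ∈ Test n, ∀ φ ∈ Test n, ∃ C : ℝ, 0 ≤ C ∧ ∀ r : ℝ, 1 ≤ r →
    ‖cls (P (mulS (dilS r η) φ))‖ ≤ C * r ^ k * (r ^ (n + 1))⁻¹

namespace IsConcentrated

variable {P P' : Module.End ℂ (Smooth n)} {k k' : ℕ}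

theorem one : IsConcentrated (1 : Module.End ℂ (Smooth n)) 0 := by
  refine ⟨fun f hf => hf, fun η hη φ hφ => ?_⟩
  obtain ⟨M, hM0, hM⟩ := exists_bound hφ
  refine ⟨M * ‖cls η‖, by positivity, fun r hr => ?_⟩
  have hr0 : 0 < r := by linarith
  have hd := dilS_mem_Test hr0.ne' hη
  have h1 : ‖cls (mulS (dilS r η) φ)‖ ≤ M * ‖cls (dilS r η)‖ := by
    refine Lp.norm_le_mul_norm_of_ae_le_mul ?_
    filter_upwards [coeFn_cls (memLp_of_mem_Test (mulS_mem_Test_left φ hd)),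
      coeFn_cls (memLp_of_mem_Test hd)] with p h1 h2
    rw [h1, h2, mulS_apply, norm_mul, mul_comm]
    gcongr
    exact hM p
  rw [norm_cls_dilS hr0 hη] at h1
  refine h1.trans_eq ?_
  rw [pow_zero]
  ring

theorem mono (h : IsConcentrated P k) (hk : k ≤ k') : IsConcentrated P k' := by
  refine ⟨h.mem_Test, fun η hη φ hφ => ?_⟩
  obtain ⟨C, hC, hb⟩ := h.bound η hη φ hφ
  refine ⟨C, hC, fun r hr => (hb r hr).trans ?_⟩
  gcongr

theorem add (h : IsConcentrated P k) (h' : IsConcentrated P' k) : IsConcentrated (P + P') k := by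
  refine ⟨fun f hf => add_mem (h.mem_Test f hf) (h'.mem_Test f hf), fun η hη φ hφ => ?_⟩
  obtain ⟨C, hC, hb⟩ := h.bound η hη φ hφ
  obtain ⟨C', hC', hb'⟩ := h'.bound η hη φ hφ
  refine ⟨C + C', by positivity, fun r hr => ?_⟩
  have hm := mulS_mem_Test_right (dilS r η) hφ
  rw [LinearMap.add_apply, cls_add (Test_le_Sch (h.mem_Test _ hm)) (Test_le_Sch (h'.mem_Test _ hm)),
    add_mul, add_mul]
  exact (norm_add_le _ _).trans (add_le_add (hb r hr) (hb' r hr))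

theorem smul (c : ℂ) (h : IsConcentrated P k) : IsConcentrated (c • P) k := by
  refine ⟨fun f hf => Submodule.smul_mem _ c (h.mem_Test f hf), fun η hη φ hφ => ?_⟩
  obtain ⟨C, hC, hb⟩ := h.bound η hη φ hφ
  refine ⟨‖c‖ * C, by positivity, fun r hr => ?_⟩
  have hm := mulS_mem_Test_right (dilS r η) hφ
  rw [LinearMap.smul_apply, cls_smul _ (Test_le_Sch (h.mem_Test _ hm)), norm_smul, mul_assoc,
    mul_assoc, ← mul_assoc C]
  gcongr
  exact hb r hr

/-- A derivative that falls on the dilated factor costs r; one that falls on φ costs nothing, and r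
≥ 1 absorbs the difference. -/
theorem mul_V (h : IsConcentrated P k) (i : Fin n ⊕ Fin n) : IsConcentrated (P * V i) (k + 1) := by
  refine ⟨fun f hf => h.mem_Test _ (V_mem_Test i hf), fun η hη φ hφ => ?_⟩
  obtain ⟨C, hC, hb⟩ := h.bound _ (V_mem_Test i hη) φ hφ
  obtain ⟨C', hC', hb'⟩ := h.bound η hη _ (V_mem_Test i hφ)
  refine ⟨C + C', by positivity, fun r hr => ?_⟩
  have hr0 : 0 < r := by linarith
  have m1 := h.mem_Test _ (mulS_mem_Test_right (dilS r (V i η)) hφ)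
  have m2 := h.mem_Test _ (mulS_mem_Test_right (dilS r η) (V_mem_Test i hφ))
  have e : mulS ((r : ℂ) • dilS r (V i η)) φ = (r : ℂ) • mulS (dilS r (V i η)) φ := by
    ext p; simp [mul_assoc]
  rw [Module.End.mul_apply, V_mulS, V_dilS, e, map_add, map_smul, cls_add
    (Test_le_Sch (Submodule.smul_mem _ _ m1)) (Test_le_Sch m2), cls_smul _ (Test_le_Sch m1)]
  refine (norm_add_le _ _).trans ?_
  rw [norm_smul, Complex.norm_real, Real.norm_of_nonneg hr0.le]
  have h1 := mul_le_mul_of_nonneg_left (hb r hr) hr0.le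
  have h2 : C' * r ^ k * (r ^ (n + 1))⁻¹ ≤ C' * r ^ (k + 1) * (r ^ (n + 1))⁻¹ := by
    gcongr
    omega
  calc _ ≤ r * (C * r ^ k * (r ^ (n + 1))⁻¹) + C' * r ^ (k + 1) * (r ^ (n + 1))⁻¹ :=
        add_le_add h1 ((hb' r hr).trans h2)
    _ = _ := by ring

theorem sum {ι : Type*} (s : Finset ι) {P : ι → Module.End ℂ (Smooth n)}
    (h : ∀ i, IsConcentrated (P i) k) : IsConcentrated (∑ i ∈ s, P i) k := by
  classical
  induction s using Finset.induction_on with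
  | empty =>
    have := (one (n := n)).smul 0
    rw [zero_smul] at this
    simpa using this.mono (Nat.zero_le k)
  | insert a s ha ih => rw [Finset.sum_insert ha]; exact (h a).add ih

theorem shifted_pow (m : ℕ) : IsConcentrated (shifted n ^ m) (2 * m) := by
  induction m with
  | zero => exact one
  | succ m ih =>
    have e : shifted n ^ m * sublaplacian n = (-1 : ℂ) • ∑ i, shifted n ^ m * V i * V i := by
      ext1 f
      rw [LinearMap.smul_apply, LinearMap.sum_apply, neg_one_smul, Module.End.mul_apply,
        sublaplacian_apply, map_neg, map_sum]
      rfl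
    have e' : shifted n ^ (m + 1) = shifted n ^ m + shifted n ^ m * sublaplacian n := by
      conv_lhs => rw [pow_succ]
      nth_rw 2 [shifted]
      rw [mul_add, mul_one]
    rw [e', e]
    exact (ih.mono (by omega)).add ((sum _ fun i => (ih.mul_V i).mul_V i).smul _)

end IsConcentrated

/-! ### Density -/

section Abstract

variable {H : Type*} [NormedAddCommGroup H] [InnerProductSpace ℂ H] [CompleteSpace H]
  {a : H →L[ℂ] H}

theorem opPow_apply_eq_zero (ha : 0 ≤ a) (hinj : Function.Injective a) {y : ℝ} (hy : 0 ≤ y) {u : H}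
    (h : opPow a y u = 0) : u = 0 :=
  opPow_injective ((ContinuousLinearMap.nonneg_iff_isPositive a).1 ha) hinj hy
    (h.trans (map_zero _).symm)

theorem denseRange_opPow (ha : 0 ≤ a) (hinj : Function.Injective a) {y : ℝ} (hy : 0 ≤ y) :
    DenseRange (opPow a y) := by
  have h : (LinearMap.range (opPow a y).toLinearMap)ᗮ = ⊥ := by
    rw [Submodule.eq_bot_iff]
    intro g hg
    refine opPow_apply_eq_zero ha hinj hy (ext_inner_right ℂ fun u => ?_)
    rw [inner_opPow_left ha, inner_zero_left]
    exact (Submodule.mem_orthogonal' _ _).1 hg _ ⟨u, rfl⟩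
  exact (Submodule.dense_iff_topologicalClosure_eq_top.2
    ((Submodule.topologicalClosure_eq_top_iff).2 h))

/-- A bounded family which converges to zero after application of a power of the operator converges
weakly to zero. -/
theorem tendsto_inner_of_tendsto_opPow {ι : Type*} {l : Filter ι} (ha : 0 ≤ a)
    (hinj : Function.Injective a) {y : ℝ} (hy : 0 ≤ y) {u : ι → H} {B : ℝ}
    (hB : ∀ᶠ i in l, ‖u i‖ ≤ B) (hu : Tendsto (fun i => opPow a y (u i)) l (𝓝 0)) (g : H) :
    Tendsto (fun i => ⟪g, u i⟫_ℂ) l (𝓝 0) := by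
  rw [Metric.tendsto_nhds]
  intro ε hε
  obtain ⟨_, hw, w, rfl⟩ := Metric.dense_iff.1 (denseRange_opPow ha hinj hy) g
    (ε / (2 * (|B| + 1))) (by positivity)
  have h1 : Tendsto (fun i => ⟪opPow a y w, u i⟫_ℂ) l (𝓝 0) := by
    simp only [inner_opPow_left ha]
    simpa using (tendsto_const_nhds (x := w)).inner hu
  filter_upwards [hB, Metric.tendsto_nhds.1 h1 (ε / 2) (by positivity)] with i hi h2
  rw [dist_zero_right] at h2 ⊢
  rw [Metric.mem_ball, dist_comm, dist_eq_norm] at hw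
  have e : ⟪g, u i⟫_ℂ = ⟪g - opPow a y w, u i⟫_ℂ + ⟪opPow a y w, u i⟫_ℂ := by
    rw [← inner_add_left, sub_add_cancel]
  have h3 : ‖⟪g - opPow a y w, u i⟫_ℂ‖ ≤ ε / 2 := by
    refine (norm_inner_le_norm _ _).trans ?_
    calc _ ≤ ε / (2 * (|B| + 1)) * (|B| + 1) :=
          mul_le_mul hw.le (hi.trans (by linarith [le_abs_self B])) (norm_nonneg _) (by positivity)
      _ = ε / 2 := by field_simp
  calc _ ≤ ‖⟪g - opPow a y w, u i⟫_ℂ‖ + ‖⟪opPow a y w, u i⟫_ℂ‖ := by rw [e]; exact norm_add_le _ _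
    _ < ε / 2 + ε / 2 := by linarith
    _ = ε := add_halves ε

/-- At y = k/2 this is ‖a^{k/2} u‖² = ⟪a^k u, u⟫ with Cauchy–Schwarz; larger powers of a positive
contraction only decrease the norm. -/
theorem norm_opPow_sq_le (ha : 0 ≤ a) (ha1 : ‖a‖ ≤ 1) {k : ℕ} {y : ℝ} (hy : (k : ℝ) / 2 ≤ y)
    (u : H) : ‖opPow a y u‖ ^ 2 ≤ ‖(a ^ k) u‖ * ‖u‖ := by
  have hk : (0 : ℝ) ≤ (k : ℝ) / 2 := by positivity
  have h1 : ‖opPow a y u‖ ≤ ‖opPow a ((k : ℝ) / 2) u‖ := by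
    have : y = (y - k / 2) + k / 2 := by ring
    rw [this, opPow_add ha (by linarith) hk, mul_apply_eq_comp]
    exact norm_opPow_apply_le ha ha1 (by linarith) _
  have h2 : ‖opPow a ((k : ℝ) / 2) u‖ ^ 2 ≤ ‖(a ^ k) u‖ * ‖u‖ := by
    have e : ((‖opPow a ((k : ℝ) / 2) u‖ ^ 2 : ℝ) : ℂ) = ⟪(a ^ k) u, u⟫_ℂ := by
      have := inner_self_eq_norm_sq_to_K (𝕜 := ℂ) (opPow a ((k : ℝ) / 2) u)
      rw [← inner_opPow_left ha, ← mul_apply_eq_comp, ← opPow_add ha hk hk, add_halves,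
        opPow_natCast ha] at this
      rw [this]
      push_cast
      rfl
    have := norm_inner_le_norm (𝕜 := ℂ) ((a ^ k) u) u
    rw [← e, Complex.norm_real, Real.norm_of_nonneg (by positivity)] at this
    exact this
  exact (pow_le_pow_left₀ (norm_nonneg _) h1 2).trans h2

/-- If `I + A` is bounded below and the closure of `A` is self-adjoint, then the range of `I + A` is
dense. -/
theorem dense_range_of_isSelfAdjoint_closure {A : H →ₗ.[ℂ] H}
    (hA : ∀ x : A.domain, ‖(x : H)‖ ≤ ‖(x : H) + A x‖) (hsa : IsSelfAdjoint A.closure) :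
    Dense (Set.range fun x : A.domain => (x : H) + A x) := by
  -- If A is not closable, its closure is A itself by convention, and the inclusion still holds.
  have hgraph : (A.closure.graph : Set (H × H)) ⊆ closure (A.graph : Set (H × H)) := by
    by_cases h : A.IsClosable
    · rw [← h.graph_closure_eq_closure_graph]
      exact subset_rfl
    · rw [LinearPMap.closure_def' h]
      exact subset_closure
  let K : Submodule ℂ H := LinearMap.range (A.domain.subtype + A.toFun)
  have hK : (K : Set H) = Set.range fun x : A.domain => (x : H) + A x := by
    ext; rfl
  rw [← hK, Submodule.dense_iff_topologicalClosure_eq_top, Submodule.topologicalClosure_eq_top_iff,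
    Submodule.eq_bot_iff]
  intro v hv
  have h1 : ∀ z ∈ closure (A.graph : Set (H × H)), ⟪v, z.1 + z.2⟫_ℂ = 0 := by
    refine fun z hz => closure_minimal (t := {z : H × H | ⟪v, z.1 + z.2⟫_ℂ = 0}) ?_ ?_ hz
    · rintro ⟨x, y⟩ hxy
      obtain ⟨x', hx, hy⟩ := (LinearPMap.mem_graph_iff A).1 hxy
      simp only at hx hy
      subst hx hy
      exact (Submodule.mem_orthogonal' _ _).1 hv _ ⟨x', rfl⟩
    · exact isClosed_eq (by fun_prop) continuous_const
  -- Orthogonality to the range says that the adjoint sends v to -v; by self-adjointness (v, -v)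
  -- lies in the closed graph, where the lower bound reads ‖v‖ ≤ ‖v - v‖.
  have h2 : ∀ x : A.closure.domain, ⟪-v, (x : H)⟫_ℂ = ⟪v, A.closure x⟫_ℂ := fun x => by
    have := h1 _ (hgraph (LinearPMap.mem_graph _ x))
    rw [inner_add_right] at this
    rw [inner_neg_left]
    exact neg_eq_of_add_eq_zero_right this
  have hd := hsa.dense_domain
  have hmem : v ∈ A.closure.adjoint.domain := LinearPMap.mem_adjoint_domain_of_exists v ⟨-v, h2⟩
  have hval : A.closure.adjoint ⟨v, hmem⟩ = -v := LinearPMap.adjoint_apply_eq hd _ h2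
  have h3 : (v, -v) ∈ A.closure.graph := by
    have : (v, -v) ∈ A.closure.adjoint.graph := by
      rw [← hval]
      exact LinearPMap.mem_graph A.closure.adjoint ⟨v, hmem⟩
    rwa [LinearPMap.isSelfAdjoint_def.1 hsa] at this
  have h4 : ∀ z ∈ closure (A.graph : Set (H × H)), ‖z.1‖ ≤ ‖z.1 + z.2‖ := by
    refine fun z hz => closure_minimal (t := {z : H × H | ‖z.1‖ ≤ ‖z.1 + z.2‖}) ?_ ?_ hz
    · rintro ⟨x, y⟩ hxy
      obtain ⟨x', hx, hy⟩ := (LinearPMap.mem_graph_iff A).1 hxy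
      simp only at hx hy
      subst hx hy
      exact hA x'
    · exact isClosed_le (by fun_prop) (by fun_prop)
  simpa using h4 _ (hgraph h3)

end Abstract

variable {n : ℕ} {s : ℝ≥0}

/-! ### The operator `A` -/

theorem ae_eq_iff_eq_cls {u : L2 n} {f : Smooth n} (hf : f ∈ Sch n) :
    u =ᵐ[volume] (f : Heis n → ℂ) ↔ u = cls f := by
  have h := coeFn_cls (memLp_of_mem_Sch hf)
  refine ⟨fun hu => Lp.ext (hu.trans h.symm), fun hu => by rw [hu]; exact h⟩

theorem mem_graphA {u : Sobolev n s × Sobolev n s} : u ∈ graphA n s ↔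
    ∃ f ∈ flatFunctions n, u.1.toL2 = cls f ∧ u.2.toL2 = cls (sublaplacian n f) := by
  refine exists_congr fun f => and_congr_right fun hf => ?_
  have hS := flatFunctions_le_Sch hf
  rw [ae_eq_iff_eq_cls hS, ae_eq_iff_eq_cls (sublaplacian_mem_Sch hS)]

theorem eq_zero_of_cls_eq_zero {f : Smooth n} (hf : f ∈ Sch n) (h : cls f = 0) : f = 0 := by
  have h1 := coeFn_cls (memLp_of_mem_Sch hf)
  rw [h] at h1
  have h2 : (f : Heis n → ℂ) =ᵐ[volume] 0 := h1.symm.trans (Lp.coeFn_zero _ _ _)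
  have h3 := (Continuous.ae_eq_iff_eq volume (contDiff_coe f).continuous continuous_zero).1 h2
  ext p
  exact congrFun h3 p

/-- `Submodule.toLinearPMap` has the prescribed graph only if that graph is single-valued; this
holds because a class in L² has at most one continuous representative. -/
theorem graph_opA (n : ℕ) (s : ℝ≥0) : (opA n s).graph = graphA n s := by
  refine Submodule.toLinearPMap_graph_eq _ fun u hu h0 => ?_
  obtain ⟨f, hf, h1, h2⟩ := mem_graphA.1 hu
  have hS := flatFunctions_le_Sch hf
  rw [h0, map_zero] at h1
  have hz := eq_zero_of_cls_eq_zero hS h1.symm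
  apply Sobolev.toL2_injective
  rw [h2, hz, map_zero, map_zero]
  simpa using cls_smul 0 (zero_mem (Sch n))

theorem exists_flat_of_mem_domain (x : (opA n s).domain) : ∃ f ∈ flatFunctions n,
    (x : Sobolev n s).toL2 = cls f ∧ (opA n s x).toL2 = cls (sublaplacian n f) := by
  have h := LinearPMap.mem_graph (opA n s) x
  rw [graph_opA] at h
  exact mem_graphA.1 h

theorem exists_mem_domain {f : Smooth n} (hf : f ∈ flatFunctions n) : ∃ x : (opA n s).domain,
    (x : Sobolev n s).toL2 = cls f ∧ (opA n s x).toL2 = cls (sublaplacian n f) := by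
  have hS := flatFunctions_le_Sch hf
  obtain ⟨u, hu⟩ := Sobolev.exists_toL2_eq_cls s hS
  obtain ⟨v, hv⟩ := Sobolev.exists_toL2_eq_cls s (sublaplacian_mem_Sch hS)
  have h : (u, v) ∈ (opA n s).graph := by
    rw [graph_opA]
    exact mem_graphA.2 ⟨f, hf, hu, hv⟩
  obtain ⟨x, hx, hy⟩ := (LinearPMap.mem_graph_iff _).1 h
  simp only at hx hy
  exact ⟨x, by rw [hx, hu], by rw [hy, hv]⟩

theorem besselPotential_resolvent (u : L2 n) :
    besselPotential n s (resolvent n u) = resolvent n (besselPotential n s u) := by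
  have h1 : opPow (resolvent n) 1 = resolvent n := by
    have := opPow_natCast (resolvent_nonneg n) 1
    rwa [Nat.cast_one, pow_one] at this
  have hs : (0 : ℝ) ≤ (s : ℝ) / 2 := by positivity
  have e1 := opPow_add (resolvent_nonneg n) hs zero_le_one
  have e2 := opPow_add (resolvent_nonneg n) zero_le_one hs
  rw [add_comm, e2, h1] at e1
  exact (congrArg (fun P : L2 n →L[ℂ] L2 n => P u) e1).symm

/-- The operator `(I + A)⁻¹` is the restriction of the resolvent. -/
theorem ofL2_symm_domain (x : (opA n s).domain) :
    (Sobolev.ofL2 n s).symm (x : Sobolev n s) =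
      resolvent n ((Sobolev.ofL2 n s).symm ((x : Sobolev n s) + opA n s x)) := by
  obtain ⟨f, hf, h1, h2⟩ := exists_flat_of_mem_domain x
  have hS := flatFunctions_le_Sch hf
  apply besselPotential_injective n s
  rw [besselPotential_resolvent, ← Sobolev.toL2_eq, ← Sobolev.toL2_eq, map_add, h1, h2,
    ← cls_add hS (sublaplacian_mem_Sch hS), ← shifted_apply, resolvent_shifted hS]

theorem norm_le_norm_add_opA (x : (opA n s).domain) :
    ‖(x : Sobolev n s)‖ ≤ ‖(x : Sobolev n s) + opA n s x‖ := by
  rw [Sobolev.norm_eq, Sobolev.norm_eq, ofL2_symm_domain]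
  exact norm_resolvent_apply_le _

theorem inner_resolvent_left (u v : L2 n) : ⟪resolvent n u, v⟫_ℂ = ⟪u, resolvent n v⟫_ℂ := by
  have := inner_opPow_left (resolvent_nonneg n) 1 u v
  have h1 := opPow_natCast (resolvent_nonneg n) 1
  rw [Nat.cast_one, pow_one] at h1
  rwa [h1] at this

/-- Symmetry of R on the vectors (I + A)x and (I + A)y gives ⟪x, (I + A)y⟫ = ⟪(I + A)x, y⟫ in
W^{s,2}; ⟪x, y⟫ cancels. -/
theorem isFormalAdjoint_opA (n : ℕ) (s : ℝ≥0) : (opA n s).IsFormalAdjoint (opA n s) := by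
  intro x y
  rw [Sobolev.inner_eq, Sobolev.inner_eq]
  have hx := ofL2_symm_domain x
  have hy := ofL2_symm_domain y
  rw [map_add] at hx hy
  set a := (Sobolev.ofL2 n s).symm (x : Sobolev n s)
  set b := (Sobolev.ofL2 n s).symm (y : Sobolev n s)
  set a' := (Sobolev.ofL2 n s).symm (opA n s x)
  set b' := (Sobolev.ofL2 n s).symm (opA n s y)
  have h := inner_resolvent_left (a + a') (b + b')
  rw [← hx, ← hy, inner_add_left, inner_add_right] at h
  exact (add_left_cancel h).symm

/-- The left side is the squared norm of f in W^{s,2}, so integer powers of I + ℒ suffice to bound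
it. -/
theorem norm_opPow_cls_sq_le {k : ℕ} (hs : (s : ℝ) ≤ k) {f : Smooth n} (hf : f ∈ Sch n) :
    ‖opPow (resolvent n) (k - s / 2) (cls ((shifted n ^ k) f))‖ ^ 2 ≤
      ‖cls f‖ * ‖cls ((shifted n ^ k) f)‖ := by
  have h := norm_opPow_sq_le (resolvent_nonneg n) (norm_resolvent_le n) (k := k)
    (y := k - s / 2) (by linarith) (cls ((shifted n ^ k) f))
  rwa [resolvent_pow_shifted_pow k hf] at h

/-- Multiples of a test function concentrated at the origin are bounded in the Sobolev space of
order `n + 1`, and converge weakly to zero. -/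
theorem tendsto_inner_concentrated (hs : (s : ℝ) ≤ (n : ℝ) + 1) {η φ : Smooth n} (hη : η ∈ Test n)
    (hφ : φ ∈ Test n) (g : L2 n) :
    Tendsto (fun r : ℝ => ⟪g, opPow (resolvent n) ((n + 1 : ℕ) - s / 2)
      (cls ((shifted n ^ (n + 1)) (mulS (dilS r η) φ)))⟫_ℂ) atTop (𝓝 0) := by
  have hs' : (s : ℝ) ≤ (n + 1 : ℕ) := by push_cast; exact hs
  have hmem : ∀ r, mulS (dilS r η) φ ∈ Sch n := fun r =>
    Test_le_Sch (mulS_mem_Test_right (dilS r η) hφ)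
  obtain ⟨C, hC, hb⟩ := (IsConcentrated.one (n := n)).bound η hη φ hφ
  obtain ⟨C', hC', hb'⟩ := (IsConcentrated.shifted_pow (n := n) (n + 1)).bound η hη φ hφ
  simp only [pow_zero, mul_one, Module.End.one_apply] at hb
  refine tendsto_inner_of_tendsto_opPow (resolvent_nonneg n) (resolvent_injective n)
    (y := (s : ℝ) / 2) (by positivity) (B := C * C' + 1) ?_ ?_ g
  · filter_upwards [eventually_ge_atTop 1] with r hr
    have hr0 : 0 < r := by linarith
    have h := norm_opPow_cls_sq_le hs' (hmem r)
    -- The powers r^{-(n+1)} and r^{2(n+1)} r^{-(n+1)} cancel exactly: n + 1 is the critical order.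
    have h2 : ‖cls (mulS (dilS r η) φ)‖ * ‖cls ((shifted n ^ (n + 1)) (mulS (dilS r η) φ))‖ ≤
        C * C' := by
      calc _ ≤ (C * (r ^ (n + 1))⁻¹) * (C' * r ^ (2 * (n + 1)) * (r ^ (n + 1))⁻¹) :=
            mul_le_mul (hb r hr) (hb' r hr) (norm_nonneg _) (by positivity)
        _ = C * C' := by
            have hne : r ^ (n + 1) ≠ 0 := by positivity
            rw [two_mul, pow_add r (n + 1) (n + 1)]
            generalize r ^ (n + 1) = R at hne
            field_simp
    nlinarith [norm_nonneg (opPow (resolvent n) ((n + 1 : ℕ) - s / 2)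
      (cls ((shifted n ^ (n + 1)) (mulS (dilS r η) φ))))]
  · have e : ∀ r, opPow (resolvent n) ((s : ℝ) / 2) (opPow (resolvent n) ((n + 1 : ℕ) - s / 2)
        (cls ((shifted n ^ (n + 1)) (mulS (dilS r η) φ)))) = cls (mulS (dilS r η) φ) := fun r =>
      Sobolev.besselPotential_opPow (by have := s.2; linarith) (hmem r)
    simp only [e]
    rw [tendsto_zero_iff_norm_tendsto_zero]
    refine squeeze_zero' (Eventually.of_forall fun _ => norm_nonneg _)
      ((eventually_ge_atTop 1).mono hb) ?_
    simpa using (tendsto_inv_atTop_zero.comp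
      (tendsto_pow_atTop (α := ℝ) (Nat.succ_ne_zero n))).const_mul C

/-- The flat functions φ - η(δ_r ·)φ tend weakly to φ, so a vector orthogonal to D(A) annihilates
every test function, hence the dense range of (I + ℒ)^{n+1}, after an injective power of R. -/
theorem dense_domain_opA (hs : (s : ℝ) ≤ (n : ℝ) + 1) :
    Dense ((opA n s).domain : Set (Sobolev n s)) := by
  rw [Submodule.dense_iff_topologicalClosure_eq_top, Submodule.topologicalClosure_eq_top_iff,
    Submodule.eq_bot_iff]
  intro g hg
  have hk : (s : ℝ) / 2 ≤ (n + 1 : ℕ) := by have := s.2; push_cast; linarith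
  obtain ⟨η, hη, hη1⟩ := exists_cutoff n
  set g₀ := (Sobolev.ofL2 n s).symm g with hg₀
  have key : ∀ φ ∈ Test n, ⟪g₀, opPow (resolvent n) ((n + 1 : ℕ) - s / 2)
      (cls ((shifted n ^ (n + 1)) φ))⟫_ℂ = 0 := by
    intro φ hφ
    refine tendsto_nhds_unique (tendsto_const_nhds.congr' ?_)
      (tendsto_inner_concentrated hs hη hφ g₀)
    filter_upwards [eventually_gt_atTop 0] with r hr
    have hm := mulS_mem_Test_right (dilS r η) hφ
    have hflat : φ - mulS (dilS r η) φ ∈ flatFunctions n := by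
      refine mem_flatFunctions_of_eventuallyEq (sub_mem hφ hm) ?_
      have h1 : ∀ᶠ p in 𝓝 (0 : Heis n), (η : Heis n → ℂ) (dil r p) = 1 :=
        ((dil r).continuous.tendsto' 0 0 (map_zero _)).eventually hη1
      filter_upwards [h1] with p hp
      change (φ : Heis n → ℂ) p - (η : Heis n → ℂ) (dil r p) * (φ : Heis n → ℂ) p = 0
      rw [hp, one_mul, sub_self]
    obtain ⟨x, hx, -⟩ := exists_mem_domain (s := s) hflat
    have h2 : ⟪g, (x : Sobolev n s)⟫_ℂ = 0 := (Submodule.mem_orthogonal' _ _).1 hg _ x.2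
    rw [Sobolev.inner_eq, Sobolev.ofL2_symm_eq (flatFunctions_le_Sch hflat) hx hk, map_sub,
      cls_sub (shifted_pow_mem_Sch _ (Test_le_Sch hφ)) (shifted_pow_mem_Sch _ (Test_le_Sch hm)),
      map_sub, inner_sub_right] at h2
    exact sub_eq_zero.1 h2
  have h0 : g₀ = 0 := by
    refine opPow_apply_eq_zero (resolvent_nonneg n) (resolvent_injective n)
      (y := (n + 1 : ℕ) - s / 2) (by linarith) ?_
    refine eq_zero_of_inner_shifted_pow_eq_zero (n + 1) _ fun f hf => ?_
    rw [inner_opPow_left (resolvent_nonneg n)]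
    exact key f hf
  exact (LinearEquiv.map_eq_zero_iff _).1 h0

/-- The functional (I + ℒ)u ↦ u(0) is bounded in the norm of W^{s,2}. It is 0 on (I + A)D(A) and 1
at (I + ℒ)φ. -/
theorem not_dense_range_add_opA (hn : 1 ≤ n) (hs : (n : ℝ) - 1 < s) :
    ¬ Dense (Set.range fun x : (opA n s).domain => (x : Sobolev n s) + opA n s x) := by
  intro hd
  obtain ⟨m, C, hC, hm, hb⟩ := exists_norm_apply_zero_le_opPow hn hs
  obtain ⟨k, rfl⟩ : ∃ k, m = k + 1 := Nat.exists_eq_succ_of_ne_zero (by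
    rintro rfl
    have := s.2
    push_cast at hm
    linarith)
  have hk : (s : ℝ) / 2 ≤ k := by push_cast at hm; linarith
  obtain ⟨φ, hφ, hφ1⟩ := exists_cutoff n
  have h1 : (φ : Heis n → ℂ) 0 = 1 := hφ1.self_of_nhds
  have hφS := Test_le_Sch hφ
  obtain ⟨w, hw⟩ := Sobolev.exists_toL2_eq_cls s (shifted_mem_Sch hφS)
  -- Any radius below 1/C works: the evaluation bound for φ - f gives 1 ≤ C times the distance.
  -- Taking C + 1 covers C = 0.
  obtain ⟨_, hy, x, rfl⟩ := Metric.dense_iff.1 hd w (1 / (C + 1)) (by positivity)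
  obtain ⟨f, hf, hx1, hx2⟩ := exists_flat_of_mem_domain x
  have hfS := flatFunctions_le_Sch hf
  have hfL := sublaplacian_mem_Sch hfS
  have hdiff : (w - ((x : Sobolev n s) + opA n s x)).toL2 = cls (shifted n (φ - f)) := by
    rw [map_sub, map_add, hw, hx1, hx2, ← cls_add hfS hfL, ← shifted_apply,
      ← cls_sub (shifted_mem_Sch hφS) (shifted_mem_Sch hfS), map_sub]
  have h2 := Sobolev.ofL2_symm_eq (shifted_mem_Sch (sub_mem hφS hfS)) hdiff hk
  have h3 := hb _ (sub_mem hφS hfS)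
  have h4 : ((φ - f : Smooth n) : Heis n → ℂ) 0 = 1 := by
    change (φ : Heis n → ℂ) 0 - (f : Heis n → ℂ) 0 = 1
    rw [h1, apply_zero_of_mem_flatFunctions hf, sub_zero]
  rw [h4, norm_one, shifted_pow_succ_apply, Nat.cast_add, Nat.cast_one, add_sub_cancel_right, ← h2,
    ← Sobolev.norm_eq] at h3
  rw [Metric.mem_ball, dist_comm, dist_eq_norm, lt_div_iff₀ (by positivity)] at hy
  nlinarith [norm_nonneg (w - ((x : Sobolev n s) + opA n s x))]

end Heisenberg
end

/-! ### The main theorem -/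

theorem proposition3p3 (n : ℕ) (hn : 1 ≤ n) (s : ℝ≥0) (hs : (n : ℝ) - 1 < s)
    (hs' : (s : ℝ) ≤ (n : ℝ) + 1) :
    (∀ f ∈ Heisenberg.flatFunctions n, ∃ u : (Heisenberg.opA n s).domain,
      (u : Heisenberg.Sobolev n s).toL2 =ᵐ[volume] (f : Heisenberg.Heis n → ℂ) ∧
      (Heisenberg.opA n s u).toL2 =ᵐ[volume]
        (Heisenberg.sublaplacian n f : Heisenberg.Heis n → ℂ)) ∧
    Dense ((Heisenberg.opA n s).domain : Set (Heisenberg.Sobolev n s)) ∧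
    (Heisenberg.opA n s).IsFormalAdjoint (Heisenberg.opA n s) ∧
    ¬ Dense (Set.range fun u : (Heisenberg.opA n s).domain =>
      (u : Heisenberg.Sobolev n s) + Heisenberg.opA n s u) ∧
    ¬ IsEssentiallySelfAdjoint (Heisenberg.opA n s) := by
  have hnd := Heisenberg.not_dense_range_add_opA hn hs
  refine ⟨fun f hf => ?_, Heisenberg.dense_domain_opA hs', Heisenberg.isFormalAdjoint_opA n s, hnd,
    fun h => hnd (Heisenberg.dense_range_of_isSelfAdjoint_closure
      Heisenberg.norm_le_norm_add_opA h.2.2)⟩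
  have hS := Heisenberg.flatFunctions_le_Sch hf
  obtain ⟨u, h1, h2⟩ := Heisenberg.exists_mem_domain (s := s) hf
  exact ⟨u, (Heisenberg.ae_eq_iff_eq_cls hS).2 h1,
    (Heisenberg.ae_eq_iff_eq_cls (Heisenberg.sublaplacian_mem_Sch hS)).2 h2⟩
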